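/- Let $(R,\mathfrak m,k)$ be a Noetherian Cohen–Macaulay local ring of Krull dimension $d$ that has a canonical module $\omega$ (a maximal Cohen–Macaulay module of finite injective dimension and type $1$). For a finitely generated $R$-module $M$ let $\mu(M)$ be its minimal number of generators and $e(M)=\lim_{n\to\infty}\frac{d!}{n^d}\,\mathrm{length}_R(M/\mathfrak m^nM)$ its multiplicity. A finitely generated module $M$ is called Cohen–Macaulay if $M=0$ or $\operatorname{depth}M=d$, and Ulrich if it is Cohen–Macaulay and $e(M)=\mu(M)$. Assume that $R$ has minimal multiplicity, i.e. $e(R)=\mu(\mathfrak m)-d+1$. Let $\mathrm{ul}(R)$ be the full subcategory of the category of $R$-modules consisting of the Ulrich modules, and let $\mathcal S$ be the class of short exact sequences $0\to L\to M\to N\to 0$ of $R$-modules with $L,M,N$ Ulrich. Call $L\to M$ an inflation and $M\to N$ a deflation if they occur in a sequence of $\mathcal S$. Then $(\mathrm{ul}(R),\mathcal S)$ is an exact category in the sense of Quillen. That is, $\mathrm{ul}(R)$ is additive; $\mathcal S$ is closed under isomorphism and consists of kernel–cokernel pairs in $\mathrm{ul}(R)$; the identity of $0$ is a deflation; compositions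 of deflations are deflations; the pullback of a deflation along any morphism exists and is a deflation; and the pushout of an inflation along any morphism exists and is an inflation. Call an object $P$ projective if $\operatorname{Hom}(P,-)$ sends deflations to surjections, and an object $I$ injective if $\operatorname{Hom}(-,I)$ sends inflations to surjections. Then $(\mathrm{ul}(R),\mathcal S)$ has enough projectives (every object is the target of a deflation from a projective object) and enough injectives (every object is the source of an inflation into an injective object). The projective objects are exactly the modules in $\operatorname{add}(\Omega^dk)$, and the injective objects are exactly the modules in $\operatorname{add}((\Omega^dk)^\dagger)$. Here $\Omega^dk$ is the $d$-th syzygy of $k$ in its minimal free resolution, $(-)^\dagger=\operatorname{Hom}_R(-,\omega)$, and $\operatorname{add}X$ consists of the direct summands of finite direct sums of copies of $X$. -/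

import Mathlib

open CategoryTheory CategoryTheory.Limits IsLocalRing

universe u v w

/-! ### Depth, multiplicity, Cohen--Macaulay and Ulrich modules over a local ring -/

section Local

variable (R : Type u) [CommRing R] [IsLocalRing R]

/-- The depth of a module over a local ring: the supremum of the lengths of the `M`-regular
sequences in the maximal ideal. For a nonzero finitely generated module, "weakly regular" and
"regular" agree by Nakayama's lemma; the zero module has depth `∞`, as usual. -/
noncomputable def moduleDepth (M : Type v) [AddCommGroup M] [Module R M] : ℕ∞ :=
  ⨆ (rs : List R) (_ : ∀ r ∈ rs, r ∈ maximalIdeal R)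
    (_ : RingTheory.Sequence.IsWeaklyRegular M rs), (rs.length : ℕ∞)

/-- A (Noetherian) local ring is Cohen--Macaulay if its depth is its Krull dimension. -/
def IsCMLocalRing : Prop :=
  ((moduleDepth R R : ℕ∞) : WithBot ℕ∞) = ringKrullDim R

/-- A (maximal) Cohen--Macaulay module: finitely generated, and either zero or of depth `dim R`. -/
def IsMaximalCM (M : Type v) [AddCommGroup M] [Module R M] : Prop :=
  Module.Finite R M ∧
    (Subsingleton M ∨ ((moduleDepth R M : ℕ∞) : WithBot ℕ∞) = ringKrullDim R)

/-- The Krull dimension of a ring of finite dimension, as a natural number. -/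
noncomputable def krullDimNat : ℕ :=
  ((ringKrullDim R).unbotD 0).toNat

/-- `e` is the multiplicity `e(M)` of the finitely generated module `M` with respect to the maximal
ideal: with `d = dim R`, it is the limit of `d! · length (M / 𝔪ⁿ M) / nᵈ` as `n → ∞`. -/
def HasMultiplicity (M : Type v) [AddCommGroup M] [Module R M] (e : ℝ) : Prop :=
  Filter.Tendsto
    (fun n : ℕ =>
      ((krullDimNat R).factorial : ℝ) *
        ((Module.length R (M ⧸ (maximalIdeal R ^ n • ⊤ : Submodule R M))).toNat : ℝ) /
          (n : ℝ) ^ krullDimNat R)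
    Filter.atTop (nhds e)

/-- The minimal number of generators `μ(M)` of a finitely generated module. -/
noncomputable def minGenerators (M : Type v) [AddCommGroup M] [Module R M] : ℕ :=
  (⊤ : Submodule R M).spanFinrank

/-- An Ulrich module: a (maximal) Cohen--Macaulay module `M` with `e(M) = μ(M)`. -/
def IsUlrich (M : Type v) [AddCommGroup M] [Module R M] : Prop :=
  IsMaximalCM R M ∧ HasMultiplicity R M (minGenerators R M : ℝ)

/-- Minimal multiplicity: `e(R) = edim R - dim R + 1`, where the embedding dimension `edim R` is the
minimal number of generators of the maximal ideal. -/
def HasMinimalMultiplicity : Prop :=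
  HasMultiplicity R R (((maximalIdeal R).spanFinrank : ℝ) - (krullDimNat R : ℝ) + 1)

/-- A canonical module: a maximal Cohen--Macaulay module of finite injective dimension and of type
one. The type of a maximal Cohen--Macaulay module `ω` is the dimension over the residue field `k` of
`Ext^d_R(k, ω)`, `d = dim R`, which is the length of this `R`-module. -/
def IsCanonicalModule (ω : Type u) [AddCommGroup ω] [Module R ω] : Prop :=
  IsMaximalCM R ω ∧
    (∃ n : ℕ, HasInjectiveDimensionLE (ModuleCat.of R ω) n) ∧
    Module.length R
      (Abelian.Ext (ModuleCat.of R (ResidueField R)) (ModuleCat.of R ω) (krullDimNat R)) = 1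

end Local

/-! ### Syzygies in the minimal free resolution -/

section Syzygy

variable (R : Type u) [CommRing R]

theorem exists_minimalCover (M : Type v) [AddCommGroup M] [Module R M] [Module.Finite R M] :
    ∃ f : (Fin (minGenerators R M) → R) →ₗ[R] M, Function.Surjective f := by
  obtain ⟨s, hs, hspan⟩ :=
    (Module.Finite.fg_top (R := R) (M := M)).exists_span_finset_card_eq_spanFinrank
  have e : Fin (minGenerators R M) ≃ s := (s.equivFinOfCardEq hs).symm
  refine ⟨Fintype.linearCombination R (fun i => ((e i : s) : M)), ?_⟩
  rw [← LinearMap.range_eq_top, Fintype.range_linearCombination, ← hspan]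
  congr 1
  ext x
  constructor
  · rintro ⟨i, rfl⟩
    exact (e i).2
  · intro hx
    exact ⟨e.symm ⟨x, hx⟩, by simp⟩

/-- A minimal free cover `R^μ(M) → M` of a finitely generated module (over a local ring, this is
the start of the minimal free resolution of `M`). -/
noncomputable def minimalCover (M : Type v) [AddCommGroup M] [Module R M] [Module.Finite R M] :
    (Fin (minGenerators R M) → R) →ₗ[R] M :=
  Classical.choose (exists_minimalCover R M)

/-- The `n`-th syzygy `Ω^n M` in the minimal free resolution of a finitely generated module over a
Noetherian local ring: `Ω^0 M = M`, and `Ω^(n+1) M` is the kernel of a minimal free cover of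
`Ω^n M`. -/
noncomputable def syzygy [IsNoetherianRing R] : ℕ → FGModuleCat.{u} R → FGModuleCat.{u} R
  | 0, M => M
  | n + 1, M => FGModuleCat.of R (LinearMap.ker (minimalCover R (syzygy n M)))

/-- `M` belongs to `add X`: it is a direct summand of a finite direct sum of copies of `X`. -/
def InAdd (X : Type v) [AddCommGroup X] [Module R X] (M : Type w) [AddCommGroup M] [Module R M] :
    Prop :=
  ∃ (n : ℕ) (i : M →ₗ[R] (Fin n → X)) (r : (Fin n → X) →ₗ[R] M), r ∘ₗ i = LinearMap.id

end Syzygy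

/-! ### Exact categories -/

section Exact

variable {A : Type v} [Category.{w} A] [Preadditive A]

/-- `i` is an inflation of the class `E` of pairs `(i, d)`. -/
def IsInflation (E : ObjectProperty (ShortComplex A)) {X Y : A} (i : X ⟶ Y) : Prop :=
  ∃ (Z : A) (d : Y ⟶ Z) (h : i ≫ d = 0), E (ShortComplex.mk i d h)

/-- `d` is a deflation of the class `E` of pairs `(i, d)`. -/
def IsDeflation (E : ObjectProperty (ShortComplex A)) {Y Z : A} (d : Y ⟶ Z) : Prop :=
  ∃ (X : A) (i : X ⟶ Y) (h : i ≫ d = 0), E (ShortComplex.mk i d h)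

/-- `(A, E)` is a (Quillen) exact category: `A` is additive, `E` is a class, closed under
isomorphism, of pairs `(i, d)` with `i` a kernel of `d` and `d` a cokernel of `i`, and the axioms
(Ex0), (Ex1), (Ex2) and (Ex2ᵒᵖ) hold. -/
structure IsExactCategory (E : ObjectProperty (ShortComplex A)) : Prop where
  hasZeroObject : HasZeroObject A
  hasFiniteBiproducts : HasFiniteBiproducts A
  isKernel : ∀ S : ShortComplex A, E S → Nonempty (IsLimit (KernelFork.ofι S.f S.zero))
  isCokernel : ∀ S : ShortComplex A, E S → Nonempty (IsColimit (CokernelCofork.ofπ S.g S.zero))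
  closedUnderIso : E.IsClosedUnderIsomorphisms
  ex0 : ∀ Z : A, IsZero Z → IsDeflation E (𝟙 Z)
  ex1 : ∀ {X Y Z : A} (d : X ⟶ Y) (d' : Y ⟶ Z),
    IsDeflation E d → IsDeflation E d' → IsDeflation E (d ≫ d')
  ex2 : ∀ {Z' Y Z : A} (f : Z' ⟶ Z) (d : Y ⟶ Z), IsDeflation E d →
    ∃ (Y' : A) (f' : Y' ⟶ Y) (d' : Y' ⟶ Z'), IsPullback f' d' d f ∧ IsDeflation E d'
  ex2op : ∀ {X X' Y : A} (f : X ⟶ X') (i : X ⟶ Y), IsInflation E i →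
    ∃ (Y' : A) (f' : Y ⟶ Y') (i' : X' ⟶ Y'), IsPushout i f f' i' ∧ IsInflation E i'

/-- `P` is projective in `(A, E)`: `Hom(P, -)` sends deflations to surjections. -/
def IsExactProjective (E : ObjectProperty (ShortComplex A)) (P : A) : Prop :=
  ∀ {Y Z : A} (d : Y ⟶ Z), IsDeflation E d → ∀ f : P ⟶ Z, ∃ g : P ⟶ Y, g ≫ d = f

/-- `I` is injective in `(A, E)`: `Hom(-, I)` sends inflations to surjections. -/
def IsExactInjective (E : ObjectProperty (ShortComplex A)) (I : A) : Prop :=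
  ∀ {X Y : A} (i : X ⟶ Y), IsInflation E i → ∀ f : X ⟶ I, ∃ g : Y ⟶ I, i ≫ g = f

/-- `(A, E)` has enough projectives: every object is the target of a deflation from a
projective. -/
def HasEnoughExactProjectives (E : ObjectProperty (ShortComplex A)) : Prop :=
  ∀ X : A, ∃ (P : A) (d : P ⟶ X), IsExactProjective E P ∧ IsDeflation E d

/-- `(A, E)` has enough injectives: every object is the source of an inflation into an
injective. -/
def HasEnoughExactInjectives (E : ObjectProperty (ShortComplex A)) : Prop :=
  ∀ X : A, ∃ (I : A) (i : X ⟶ I), IsExactInjective E I ∧ IsInflation E i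

end Exact

/-! ### The category of Ulrich modules -/

section Ul

variable (R : Type u) [CommRing R] [IsLocalRing R]

/-- The property of being an Ulrich `R`-module. -/
def ulrichProperty : ObjectProperty (ModuleCat.{u} R) := fun M => IsUlrich R M

/-- The full subcategory `ul(R)` of Ulrich modules in the category of `R`-modules. -/
abbrev Ul := (ulrichProperty R).FullSubcategory

/-- The class of short exact sequences `0 → L → M → N → 0` of `R`-modules with `L`, `M`, `N`
Ulrich. -/
def ulrichSequences : ObjectProperty (ShortComplex (Ul R)) :=
  fun S => (S.map (ulrichProperty R).ι).ShortExact

end Ul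

/-! Everything rests on a numerical criterion. Let `S` be `R[X]` localised at `𝔪R[X]`: it is
faithfully flat over `R`, its maximal ideal is `𝔪S`, and its residue field is infinite. Passing from
`M` to `S ⊗ M` preserves lengths, numbers of generators and lower bounds on depth. Over `S`,
finitely many maximal Cohen–Macaulay (MCM) modules have a common superficial regular sequence `x` of
length `d`, and then `e(M)` is the length of `S ⊗ M` modulo `x`. So an MCM module `M` is Ulrich iff
`𝔪(S ⊗ M) ⊆ x(S ⊗ M)`, that is, iff `S ⊗ M` modulo `x` is a vector space
(`ComputesMultiplicity.isUlrich_iff`). In a short exact sequence with Ulrich middle and MCM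
right-hand term the outer terms inherit this (`IsUlrich.of_shortExact`). Hence deflations are the
surjections, inflations are the injections with MCM cokernel, and the axioms follow. For the ring,
minimal multiplicity gives `𝔪² ⊆ (x)`, with `x` independent modulo `𝔪²`.

Projectives. Let `P = Ω^d k`, let `η ∈ Ext^d(k, P)` be the class of the truncated resolution, and
for `x`-regular `M` let `κ_M ∈ Ext^d(M/xM, M)` be the iterated extension class. An element of
`Ext^d(k, N)` can be written as `η g` with `g : P → N`, unique up to maps that lift along every
surjection onto `N`. It can also be written as `v κ_N` with `v : k → N/xN`. If `M → N` is onto and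
`M/xM` is a vector space, then `v` lifts to `M/xM`, so `g` lifts to `M`
(`IsSyzygyClass.exists_lift_of_le`). The same dictionary gives, for Ulrich `N`, enough maps `P → N`
to generate `N` (`IsSyzygyClass.exists_comp_ne_zero`). It also shows that `P` is Ulrich, and there
minimal multiplicity enters (`IsMinSyzygy.smul_top_le`). Lifting and generation descend from `S` to
`R` by faithful flatness.

Injectives. Finite injective dimension makes `Ext^i(M, ω)` vanish for MCM `M` and `i > 0`, so `(-)†`
is exact on MCM modules and preserves both MCM and Ulrich modules. As `Hom(L, P†) = Hom(P, L†)`, the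
module `P†` is injective. A surjection `P^n → X†` transposes to `X → (P^n)†`. Since `Ext^d(k, ω) ≠
0`, maps to `ω` detect elements of `X/xX` for a regular system of parameters `x` of `R`, so the
transpose is injective modulo `x` and its cokernel is MCM (`flip_injective_and_depthGE`). No
biduality theorem is needed. -/

set_option linter.unusedSectionVars false

/-! ### Depth through the vanishing of `Ext` -/

section Depth

open Abelian RingTheory.Sequence Pointwise

/-- The short exact sequence of module categories attached to an exact pair of linear maps. -/
theorem shortExact_of_linearMaps {A : Type u} [CommRing A] {L M N : Type u} [AddCommGroup L]
    [AddCommGroup M] [AddCommGroup N] [Module A L] [Module A M] [Module A N]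
    {f : L →ₗ[A] M} {g : M →ₗ[A] N} (hf : Function.Injective f) (hfg : Function.Exact f g)
    (hg : Function.Surjective g) :
    (ModuleCat.shortComplexOfCompEqZero f g hfg.linearMap_comp_eq_zero).ShortExact :=
  ModuleCat.shortComplex_shortExact _ hfg hf hg

section

variable {A : Type u} [CommRing A]

theorem subsingleton_ext_of_covariant_middle {X : ModuleCat.{u} A}
    {S : ShortComplex (ModuleCat.{u} A)} (hS : S.ShortExact) {i : ℕ}
    (h₁ : Subsingleton (Ext X S.X₁ i)) (h₃ : Subsingleton (Ext X S.X₃ i)) :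
    Subsingleton (Ext X S.X₂ i) := by
  refine subsingleton_of_forall_eq 0 fun x => ?_
  obtain ⟨y, rfl⟩ := Ext.covariant_sequence_exact₂ X hS x (Subsingleton.elim _ _)
  rw [Subsingleton.elim y 0, Ext.zero_comp]

theorem subsingleton_ext_of_covariant_right {X : ModuleCat.{u} A}
    {S : ShortComplex (ModuleCat.{u} A)} (hS : S.ShortExact) {i : ℕ}
    (h₁ : Subsingleton (Ext X S.X₁ (i + 1))) (h₂ : Subsingleton (Ext X S.X₂ i)) :
    Subsingleton (Ext X S.X₃ i) := by
  refine subsingleton_of_forall_eq 0 fun x => ?_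
  obtain ⟨y, rfl⟩ := Ext.covariant_sequence_exact₃ X hS x rfl (Subsingleton.elim _ _)
  rw [Subsingleton.elim y 0, Ext.zero_comp]

theorem subsingleton_ext_of_covariant_left {X : ModuleCat.{u} A}
    {S : ShortComplex (ModuleCat.{u} A)} (hS : S.ShortExact) {i : ℕ}
    (h₂ : Subsingleton (Ext X S.X₂ (i + 1))) (h₃ : Subsingleton (Ext X S.X₃ i)) :
    Subsingleton (Ext X S.X₁ (i + 1)) := by
  refine subsingleton_of_forall_eq 0 fun x => ?_
  obtain ⟨y, rfl⟩ := Ext.covariant_sequence_exact₁ X hS x (Subsingleton.elim _ _) rfl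
  rw [Subsingleton.elim y 0, Ext.zero_comp]

theorem subsingleton_ext_zero_of_injective {X Y Z : ModuleCat.{u} A} (f : Y ⟶ Z)
    [Mono f] (h : Subsingleton (Ext X Z 0)) : Subsingleton (Ext X Y 0) := by
  refine subsingleton_of_forall_eq 0 fun x => ?_
  apply Ext.postcomp_mk₀_injective_of_mono X f
  exact Subsingleton.elim _ _

end

variable (A : Type u) [CommRing A] [IsLocalRing A]

/-- `Ext^i(k, M) = 0` for all `i < n`, where `k` is the residue field. -/
def DepthGE (n : ℕ) (M : Type u) [AddCommGroup M] [Module A M] : Prop :=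
  ∀ i < n, Subsingleton (Ext (ModuleCat.of A (ResidueField A)) (ModuleCat.of A M) i)

variable {A} {L M N : Type u} [AddCommGroup L] [AddCommGroup M] [AddCommGroup N] [Module A L]
  [Module A M] [Module A N]

theorem DepthGE.mono {m n : ℕ} (h : m ≤ n) (hM : DepthGE A n M) : DepthGE A m M :=
  fun i hi => hM i (hi.trans_le h)

theorem DepthGE.middle {n : ℕ} {f : L →ₗ[A] M} {g : M →ₗ[A] N} (hf : Function.Injective f)
    (hfg : Function.Exact f g) (hg : Function.Surjective g) (hL : DepthGE A n L)
    (hN : DepthGE A n N) : DepthGE A n M := fun i hi =>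
  subsingleton_ext_of_covariant_middle (shortExact_of_linearMaps hf hfg hg) (hL i hi) (hN i hi)

theorem DepthGE.right {n : ℕ} {f : L →ₗ[A] M} {g : M →ₗ[A] N} (hf : Function.Injective f)
    (hfg : Function.Exact f g) (hg : Function.Surjective g) (hL : DepthGE A (n + 1) L)
    (hM : DepthGE A n M) : DepthGE A n N := fun i hi =>
  subsingleton_ext_of_covariant_right (shortExact_of_linearMaps hf hfg hg)
    (hL (i + 1) (by omega)) (hM i hi)

theorem DepthGE.left {n : ℕ} {f : L →ₗ[A] M} {g : M →ₗ[A] N} (hf : Function.Injective f)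
    (hfg : Function.Exact f g) (hg : Function.Surjective g) (hM : DepthGE A (n + 1) M)
    (hN : DepthGE A n N) : DepthGE A (n + 1) L := by
  intro i hi
  have hS := shortExact_of_linearMaps hf hfg hg
  rcases i with _ | i
  · have := hS.mono_f
    exact subsingleton_ext_zero_of_injective (Y := ModuleCat.of A L) (Z := ModuleCat.of A M)
      (ModuleCat.ofHom f) (hM 0 hi)
  · exact subsingleton_ext_of_covariant_left hS (hM (i + 1) hi) (hN i (by omega))

theorem DepthGE.kernel {n : ℕ} {f : L →ₗ[A] M} {g : M →ₗ[A] N} (hf : Function.Injective f)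
    (hfg : Function.Exact f g) (hg : Function.Surjective g) (hM : DepthGE A n M)
    (hN : DepthGE A n N) : DepthGE A n L := by
  rcases n with _ | n
  · intro i hi
    omega
  · exact DepthGE.left hf hfg hg hM (hN.mono n.le_succ)

theorem DepthGE.of_equiv {n : ℕ} (e : M ≃ₗ[A] N) (hM : DepthGE A n M) : DepthGE A n N := by
  -- The isomorphism is read as a short exact sequence whose right-hand term is the zero module.
  refine DepthGE.middle (L := M) (M := N) (N := (⊥ : Submodule A M)) (f := e.toLinearMap) (g := 0)
    e.injective ?_ (fun x => ⟨0, Subsingleton.elim _ _⟩) hM ?_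
  · intro y
    exact ⟨fun _ => e.surjective y, fun _ => rfl⟩
  · intro i _
    have : IsZero (ModuleCat.of A (⊥ : Submodule A M)) := ModuleCat.isZero_of_subsingleton _
    refine subsingleton_of_forall_eq 0 fun x => ?_
    rw [← Ext.comp_mk₀_id x, this.eq_of_src (𝟙 _) 0, Ext.mk₀_zero, Ext.comp_zero]

theorem DepthGE.of_subsingleton (n : ℕ) [Subsingleton M] : DepthGE A n M := by
  intro i _
  have : IsZero (ModuleCat.of A M) := ModuleCat.isZero_of_subsingleton _
  refine subsingleton_of_forall_eq 0 fun x => ?_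
  rw [← Ext.comp_mk₀_id x, this.eq_of_src (𝟙 _) 0, Ext.mk₀_zero, Ext.comp_zero]

theorem DepthGE.prod {n : ℕ} (hM : DepthGE A n M) (hN : DepthGE A n N) : DepthGE A n (M × N) :=
  DepthGE.middle (f := LinearMap.inl A M N) (g := LinearMap.snd A M N) LinearMap.inl_injective
    Function.Exact.inl_snd LinearMap.snd_surjective hM hN

theorem DepthGE.pi {n : ℕ} (m : ℕ) (hM : DepthGE A n M) : DepthGE A n (Fin m → M) := by
  induction m with
  | zero => exact DepthGE.of_subsingleton n
  | succ m ih => exact (hM.prod ih).of_equiv (Fin.consLinearEquiv A (fun _ => M))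

theorem DepthGE.quotSMulTop {n : ℕ} {x : A} (hx : IsSMulRegular M x)
    (hM : DepthGE A (n + 1) M) : DepthGE A n (QuotSMulTop x M) :=
  DepthGE.right (f := LinearMap.lsmul A M x) (g := (x • (⊤ : Submodule A M)).mkQ) hx
    (LinearMap.exact_lsmul_mkQ_smul_top M x) (Submodule.mkQ_surjective _) hM
    (hM.mono n.le_succ)

variable [IsNoetherianRing A]

theorem support_residueField :
    Module.support A (ResidueField A) = PrimeSpectrum.zeroLocus (maximalIdeal A) := by
  change Module.support A (A ⧸ maximalIdeal A) = _
  rw [Module.support_eq_zeroLocus, Ideal.annihilator_quotient]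

/-- Rees' characterisation of depth, from `Ext` to sequences. With the converse
`depthGE_of_isWeaklyRegular` it lets depth be handled through long exact sequences. -/
theorem DepthGE.exists_isWeaklyRegular [Module.Finite A M] {n : ℕ} (hM : DepthGE A n M) :
    ∃ rs : List A, rs.length = n ∧ (∀ r ∈ rs, r ∈ maximalIdeal A) ∧ IsWeaklyRegular M rs := by
  cases subsingleton_or_nontrivial M with
  | inl h =>
    -- On the zero module every sequence is weakly regular.
    refine ⟨List.replicate n 0, by simp, fun r hr => ?_, ?_⟩
    · rw [List.eq_of_mem_replicate hr]
      exact zero_mem _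
    · refine (isWeaklyRegular_iff _ _).mpr fun i hi => ?_
      exact fun x y _ => Subsingleton.elim _ _
  | inr h =>
    obtain ⟨rs, h₁, h₂, h₃⟩ := ModuleCat.exists_isRegular_of_exists_subsingleton_ext
      (maximalIdeal A) n (ModuleCat.of A M)
      (lt_top_iff_ne_top.mpr (Ne.symm (Submodule.top_ne_ideal_smul_of_le_jacobson_annihilator
        (maximalIdeal_le_jacobson _))))
      (ModuleCat.of A (ResidueField A)) support_residueField hM
    exact ⟨rs, h₁, h₂, h₃.toIsWeaklyRegular⟩

theorem subsingleton_ext_of_isWeaklyRegular [Module.Finite A M] {rs : List A}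
    (hrs : ∀ r ∈ rs, r ∈ maximalIdeal A) (h : IsWeaklyRegular M rs) (X : ModuleCat.{u} A)
    [Module.Finite A X] (hX : Module.support A X ⊆ PrimeSpectrum.zeroLocus (maximalIdeal A))
    {i : ℕ} (hi : i < rs.length) : Subsingleton (Ext X (ModuleCat.of A M) i) := by
  cases subsingleton_or_nontrivial M with
  | inl _ =>
    have : IsZero (ModuleCat.of A M) := ModuleCat.isZero_of_subsingleton _
    refine subsingleton_of_forall_eq 0 fun x => ?_
    rw [← Ext.comp_mk₀_id x, this.eq_of_src (𝟙 _) 0, Ext.mk₀_zero, Ext.comp_zero]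
  | inr _ =>
    exact ModuleCat.subsingleton_ext_of_exists_isRegular (maximalIdeal A) X hX (ModuleCat.of A M)
      (lt_top_iff_ne_top.mpr (Ne.symm (Submodule.top_ne_ideal_smul_of_le_jacobson_annihilator
        (maximalIdeal_le_jacobson _)))) rs hrs (IsRegular.of_isWeaklyRegular_of_mem_maximalIdeal M hrs h) i hi

theorem depthGE_of_isWeaklyRegular [Module.Finite A M] {rs : List A}
    (hrs : ∀ r ∈ rs, r ∈ maximalIdeal A) (h : IsWeaklyRegular M rs) :
    DepthGE A rs.length M := fun _ hi =>
  subsingleton_ext_of_isWeaklyRegular hrs h _ support_residueField.subset hi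

/-- Each regular element lowers the dimension of the support by one, and the final quotient is
nonzero by Nakayama, so its support has dimension at least `0`. -/
theorem length_le_of_isWeaklyRegular [Module.Finite A M] [Nontrivial M] {d : ℕ}
    (hd : ringKrullDim A = d) {rs : List A} (hrs : ∀ r ∈ rs, r ∈ maximalIdeal A)
    (h : IsWeaklyRegular M rs) : rs.length ≤ d := by
  have hreg := IsRegular.of_isWeaklyRegular_of_mem_maximalIdeal M hrs h
  have := hreg.quot_ofList_smul_nontrivial (M := M) ⊤
  have h₁ := Module.supportDim_add_length_eq_supportDim_of_isRegular rs hreg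
  have h₂ := Module.supportDim_le_ringKrullDim A M
  have h₃ : (0 : WithBot ℕ∞) ≤ Module.supportDim A (M ⧸ Ideal.ofList rs • (⊤ : Submodule A M)) := by
    rw [Module.supportDim]
    have := Module.supportDim_ne_bot_of_nontrivial A (M ⧸ Ideal.ofList rs • (⊤ : Submodule A M))
    rw [Module.supportDim] at this
    exact Order.krullDim_nonneg_iff.mpr (Order.krullDim_ne_bot_iff.mp this)
  have h₄ : ((rs.length : ℕ) : WithBot ℕ∞) ≤ (d : ℕ) := by
    rw [← hd]
    refine le_trans ?_ h₂
    rw [← h₁]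
    exact le_add_of_nonneg_left h₃
  exact_mod_cast h₄

theorem moduleDepth_eq_iff [Module.Finite A M] [Nontrivial M] {d : ℕ} (hd : ringKrullDim A = d) :
    ((moduleDepth A M : ℕ∞) : WithBot ℕ∞) = ringKrullDim A ↔ DepthGE A d M := by
  have hle : moduleDepth A M ≤ d := by
    refine iSup_le fun rs => iSup_le fun hrs => iSup_le fun h => ?_
    exact_mod_cast length_le_of_isWeaklyRegular hd hrs h
  rw [hd]
  constructor
  · intro h
    have h' : moduleDepth A M = d := by exact_mod_cast h
    rcases d with _ | d
    · intro i hi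
      omega
    by_contra hcon
    -- Here `d` is the predecessor of the dimension. If no sequence is longer than `d`, neither is
    -- the supremum.
    have : moduleDepth A M ≤ d := by
      refine iSup_le fun rs => iSup_le fun hrs => iSup_le fun hreg => ?_
      by_contra hlt
      have hlt' : d + 1 ≤ rs.length := by
        have : d < rs.length := by exact_mod_cast not_le.mp hlt
        omega
      exact hcon ((depthGE_of_isWeaklyRegular hrs hreg).mono hlt')
    rw [h'] at this
    have : d + 1 ≤ d := by exact_mod_cast this
    omega
  · intro h
    obtain ⟨rs, hlen, hrs, hreg⟩ := h.exists_isWeaklyRegular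
    have : (d : ℕ∞) ≤ moduleDepth A M := by
      refine le_iSup_of_le rs (le_iSup_of_le hrs (le_iSup_of_le hreg ?_))
      rw [hlen]
    rw [le_antisymm hle this]
    rfl

theorem isMaximalCM_iff {d : ℕ} (hd : ringKrullDim A = d) :
    IsMaximalCM A M ↔ Module.Finite A M ∧ DepthGE A d M := by
  refine and_congr_right fun hfin => ?_
  cases subsingleton_or_nontrivial M with
  | inl h => exact iff_of_true (Or.inl h) (DepthGE.of_subsingleton d)
  | inr h =>
    rw [moduleDepth_eq_iff hd, or_iff_right (not_subsingleton M)]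

end Depth

/-! ### Lengths of quotients and minimal numbers of generators -/

section Length

open IsLocalRing

variable {A : Type u} [CommRing A] [IsLocalRing A]

theorem length_quotient_maximalIdeal_smul (M : Type v) [AddCommGroup M] [Module A M]
    [Module.Finite A M] :
    Module.length A (M ⧸ (maximalIdeal A • ⊤ : Submodule A M)) = minGenerators A M := by
  let Q := (⊤ : Submodule A M) ⧸ (maximalIdeal A • ⊤ : Submodule A (⊤ : Submodule A M))
  let : Field (A ⧸ maximalIdeal A) := Ideal.Quotient.field _
  have e : Q ≃ₗ[A] M ⧸ (maximalIdeal A • ⊤ : Submodule A M) :=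
    Submodule.Quotient.equiv _ _ Submodule.topEquiv (by
      rw [Submodule.map_smul'', Submodule.map_top]
      simp)
  have : Module.Finite (A ⧸ maximalIdeal A) Q :=
    Module.Finite.of_restrictScalars_finite A _ _
  rw [← e.length_eq, Module.length_eq_of_surjective (S := A) (R := A ⧸ maximalIdeal A) (M := Q)
    Ideal.Quotient.mk_surjective, Module.length_eq_finrank, minGenerators,
    IsLocalRing.spanFinrank_eq_finrank_quotient _ Module.Finite.fg_top]

theorem length_quotient_eq_add {M : Type v} [AddCommGroup M] [Module A M] {p q : Submodule A M}
    (hpq : p ≤ q) : Module.length A (M ⧸ p) =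
      Module.length A (q.map p.mkQ) + Module.length A (M ⧸ q) := by
  rw [← (Submodule.quotientQuotientEquivQuotient p q hpq).length_eq]
  exact Module.length_eq_add_of_exact (q.map p.mkQ).subtype (q.map p.mkQ).mkQ
    Subtype.val_injective (Submodule.mkQ_surjective _) (LinearMap.exact_subtype_mkQ _)

theorem le_of_length_quotient_le {M : Type v} [AddCommGroup M] [Module A M] {p q : Submodule A M}
    (hpq : p ≤ q) (hp : Module.length A (M ⧸ p) ≠ ⊤)
    (h : Module.length A (M ⧸ p) ≤ Module.length A (M ⧸ q)) : q ≤ p := by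
  have hadd := length_quotient_eq_add hpq
  have hq : Module.length A (M ⧸ q) ≠ ⊤ := fun hq => hp (by rw [hadd, hq, add_top])
  have h0 : Module.length A (q.map p.mkQ) = 0 := by
    rw [hadd] at h
    by_contra hne
    have h1 : 1 ≤ Module.length A (q.map p.mkQ) := Order.one_le_iff_ne_zero.mpr hne
    have h2 : 1 + Module.length A (M ⧸ q) ≤ Module.length A (M ⧸ q) :=
      (add_le_add_left h1 _).trans h
    lift Module.length A (M ⧸ q) to ℕ using hq with l
    have : 1 + l ≤ l := by exact_mod_cast h2
    omega
  rw [Module.length_eq_zero_iff, Submodule.subsingleton_iff_eq_bot] at h0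
  have := Submodule.map_le_iff_le_comap.mp h0.le
  rwa [Submodule.comap_bot, Submodule.ker_mkQ] at this

end Length

/-! ### Ext classes of regular sequences -/

section KoszulClass

open Abelian RingTheory.Sequence Pointwise

variable {A : Type u} [CommRing A]

/-- The quotient `M / rM`. -/
def quotOne (r : A) (M : ModuleCat.{u} A) : ModuleCat.{u} A := ModuleCat.of A (QuotSMulTop r M)

/-- The projection `M → M / rM`. -/
def quotOneProj (r : A) (M : ModuleCat.{u} A) : M ⟶ quotOne r M :=
  ModuleCat.ofHom (r • (⊤ : Submodule A M)).mkQ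

/-- The map `M / rM → N / rN` induced by a map `M → N`. -/
def quotOneMap (r : A) {M N : ModuleCat.{u} A} (f : M ⟶ N) : quotOne r M ⟶ quotOne r N :=
  ModuleCat.ofHom (QuotSMulTop.map r f.hom)

theorem smul_comp_quotOneProj (r : A) (M : ModuleCat.{u} A) : (r • 𝟙 M) ≫ quotOneProj r M = 0 :=
  (ModuleCat.smulShortComplex M r).zero

/-- The sequence `M → M → M / rM`. -/
def quotOneComplex (r : A) (M : ModuleCat.{u} A) : ShortComplex (ModuleCat.{u} A) :=
  ShortComplex.mk (X₁ := M) (X₂ := M) (X₃ := quotOne r M) (r • 𝟙 M) (quotOneProj r M)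
    (smul_comp_quotOneProj r M)

theorem quotOneComplex_shortExact {r : A} {M : ModuleCat.{u} A} (h : IsSMulRegular M r) :
    (quotOneComplex r M).ShortExact :=
  h.smulShortComplex_shortExact

/-- The class in `Ext¹(M / rM, M)` of the extension `0 → M → M → M / rM → 0`. -/
noncomputable def smulClass (r : A) (M : ModuleCat.{u} A) (h : IsSMulRegular M r) :
    Ext (quotOne r M) M 1 :=
  (quotOneComplex_shortExact h).extClass

theorem quotOneProj_naturality (r : A) {M N : ModuleCat.{u} A} (f : M ⟶ N) :
    f ≫ quotOneProj r N = quotOneProj r M ≫ quotOneMap r f := rfl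

theorem quotOneProj_surjective (r : A) (M : ModuleCat.{u} A) :
    Function.Surjective (quotOneProj r M) := Submodule.mkQ_surjective _

theorem quotOneMap_surjective (r : A) {M N : ModuleCat.{u} A} (f : M ⟶ N)
    (hf : Function.Surjective f) : Function.Surjective (quotOneMap r f) := by
  intro y
  obtain ⟨y, rfl⟩ := quotOneProj_surjective r N y
  obtain ⟨x, rfl⟩ := hf y
  exact ⟨quotOneProj r M x, rfl⟩

theorem smulClass_naturality (r : A) {M N : ModuleCat.{u} A} (f : M ⟶ N)
    (hM : IsSMulRegular M r) (hN : IsSMulRegular N r) :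
    (smulClass r M hM).comp (Ext.mk₀ f) (add_zero 1) =
      (Ext.mk₀ (quotOneMap r f)).comp (smulClass r N hN) (zero_add 1) := by
  let φ : quotOneComplex r M ⟶ quotOneComplex r N :=
    { τ₁ := f
      τ₂ := f
      τ₃ := quotOneMap r f
      comm₁₂ := by simp [quotOneComplex]
      comm₂₃ := rfl }
  exact ShortComplex.ShortExact.extClass_naturality (quotOneComplex_shortExact hM)
    (quotOneComplex_shortExact hN) φ

/-- Multiplication by `r` on `Ext` is composition with `r • 𝟙 M`; by the long exact sequence, the
classes it kills are images of the connecting map. -/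
theorem exists_comp_smulClass {r : A} {M : ModuleCat.{u} A} (h : IsSMulRegular M r)
    {X : ModuleCat.{u} A} {n : ℕ} (u : Ext X M (n + 1)) (hu : r • u = 0) :
    ∃ v : Ext X (quotOne r M) n, v.comp (smulClass r M h) rfl = u := by
  have hu' : u.comp (Ext.mk₀ (r • 𝟙 M)) (add_zero (n + 1)) = 0 := by
    rw [← Ext.smul_eq_comp_mk₀, hu]
  exact Ext.covariant_sequence_exact₁ X (quotOneComplex_shortExact h) u hu' rfl

theorem exists_mk₀_comp_of_comp_smulClass {r : A} {M : ModuleCat.{u} A} (h : IsSMulRegular M r)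
    {X : ModuleCat.{u} A} {n : ℕ} (v : Ext X (quotOne r M) n)
    (hv : v.comp (smulClass r M h) rfl = 0) :
    ∃ w : Ext X M n, w.comp (Ext.mk₀ (quotOneProj r M)) (add_zero n) = v :=
  Ext.covariant_sequence_exact₃ X (quotOneComplex_shortExact h) v rfl hv

theorem exists_smul_of_smulClass_comp {r : A} {M : ModuleCat.{u} A} (h : IsSMulRegular M r)
    {N : ModuleCat.{u} A} {n : ℕ} (u : Ext M N n)
    (hu : (smulClass r M h).comp u (add_comm 1 n) = 0) : ∃ w : Ext M N n, r • w = u := by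
  obtain ⟨w, hw⟩ : ∃ w : Ext M N n, (Ext.mk₀ (r • 𝟙 M)).comp w (zero_add n) = u :=
    Ext.contravariant_sequence_exact₁ (quotOneComplex_shortExact h) N u (add_comm 1 n) hu
  refine ⟨w, ?_⟩
  rw [← hw]
  rw [Ext.mk₀_smul, Ext.smul_comp, Ext.mk₀_id_comp]

theorem exists_smulClass_comp {r : A} {M : ModuleCat.{u} A} (h : IsSMulRegular M r)
    {N : ModuleCat.{u} A} {n : ℕ} (hN : Subsingleton (Ext M N (n + 1)))
    (v : Ext (quotOne r M) N (n + 1)) :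
    ∃ u : Ext M N n, (smulClass r M h).comp u (add_comm 1 n) = v :=
  Ext.contravariant_sequence_exact₃ (quotOneComplex_shortExact h) N v (hN.elim _ _)
    (add_comm 1 n)

/-- The quotient of a module by a sequence of elements, as an iterated quotient. -/
def quotSeq : List A → ModuleCat.{u} A → ModuleCat.{u} A
  | [], M => M
  | r :: rs, M => quotSeq rs (quotOne r M)

/-- The projection of a module to its quotient by a sequence of elements. -/
def quotSeqProj : (rs : List A) → (M : ModuleCat.{u} A) → (M ⟶ quotSeq rs M)
  | [], M => 𝟙 M
  | r :: rs, M => quotOneProj r M ≫ quotSeqProj rs (quotOne r M)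

/-- The map induced on the quotients by a sequence of elements. -/
def quotSeqMap : (rs : List A) → {M N : ModuleCat.{u} A} → (M ⟶ N) → (quotSeq rs M ⟶ quotSeq rs N)
  | [], _, _, f => f
  | r :: rs, _, _, f => quotSeqMap rs (quotOneMap r f)

theorem quotSeqProj_surjective (rs : List A) (M : ModuleCat.{u} A) :
    Function.Surjective (quotSeqProj rs M) := by
  induction rs generalizing M with
  | nil => exact Function.surjective_id
  | cons r rs ih => exact (ih (quotOne r M)).comp (quotOneProj_surjective r M)

theorem quotSeqProj_eq_zero_iff (rs : List A) {M : ModuleCat.{u} A} (x : M) :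
    quotSeqProj rs M x = 0 ↔ x ∈ Ideal.ofList rs • (⊤ : Submodule A M) := by
  induction rs generalizing M with
  | nil =>
    rw [Ideal.ofList_nil, Submodule.bot_smul]
    rfl
  | cons r rs ih =>
    have h := ih (M := quotOne r M) ((r • (⊤ : Submodule A M)).mkQ x)
    have := Submodule.comap_map_eq (r • (⊤ : Submodule A M)).mkQ
      (Ideal.ofList rs • (⊤ : Submodule A M))
    rw [Submodule.map_smul'', Submodule.map_top, Submodule.range_mkQ, Submodule.ker_mkQ] at this
    rw [Ideal.ofList_cons_smul, sup_comm, ← this]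
    exact h

theorem quotSeqProj_naturality (rs : List A) {M N : ModuleCat.{u} A} (f : M ⟶ N) :
    f ≫ quotSeqProj rs N = quotSeqProj rs M ≫ quotSeqMap rs f := by
  induction rs generalizing M N with
  | nil =>
    change f ≫ 𝟙 N = 𝟙 M ≫ f
    simp
  | cons r rs ih =>
    change f ≫ quotOneProj r N ≫ quotSeqProj rs (quotOne r N) =
      (quotOneProj r M ≫ quotSeqProj rs (quotOne r M)) ≫ quotSeqMap rs (quotOneMap r f)
    rw [Category.assoc, ← ih, ← Category.assoc, ← Category.assoc, quotOneProj_naturality]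

theorem quotSeqMap_surjective (rs : List A) {M N : ModuleCat.{u} A} (f : M ⟶ N)
    (hf : Function.Surjective f) : Function.Surjective (quotSeqMap rs f) := by
  induction rs generalizing M N with
  | nil => exact hf
  | cons r rs ih => exact ih _ (quotOneMap_surjective r f hf)

/-- The iterated extension class of a module on which a sequence is regular. -/
noncomputable def koszulClass : (rs : List A) → (M : ModuleCat.{u} A) → IsWeaklyRegular M rs →
    Ext (quotSeq rs M) M rs.length
  | [], M, _ => Ext.mk₀ (𝟙 M)
  | r :: rs, M, h =>
    (koszulClass rs (quotOne r M) ((isWeaklyRegular_cons_iff M r rs).mp h).2).comp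
      (smulClass r M ((isWeaklyRegular_cons_iff M r rs).mp h).1) rfl

theorem koszulClass_naturality (rs : List A) {M N : ModuleCat.{u} A} (f : M ⟶ N)
    (hM : IsWeaklyRegular M rs) (hN : IsWeaklyRegular N rs) :
    (koszulClass rs M hM).comp (Ext.mk₀ f) (add_zero _) =
      (Ext.mk₀ (quotSeqMap rs f)).comp (koszulClass rs N hN) (zero_add _) := by
  induction rs generalizing M N with
  | nil =>
    change (Ext.mk₀ (𝟙 M)).comp (Ext.mk₀ f) (add_zero 0) =
      (Ext.mk₀ f).comp (Ext.mk₀ (𝟙 N)) (zero_add 0)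
    simp
  | cons r rs ih =>
    obtain ⟨hM₁, hM₂⟩ := (isWeaklyRegular_cons_iff M r rs).mp hM
    obtain ⟨hN₁, hN₂⟩ := (isWeaklyRegular_cons_iff N r rs).mp hN
    change ((koszulClass rs (quotOne r M) hM₂).comp (smulClass r M hM₁) rfl).comp
      (Ext.mk₀ f) (add_zero (rs.length + 1)) =
      (Ext.mk₀ (quotSeqMap rs (quotOneMap r f))).comp
        ((koszulClass rs (quotOne r N) hN₂).comp (smulClass r N hN₁) rfl)
          (zero_add (rs.length + 1))
    rw [Ext.comp_assoc_of_third_deg_zero, smulClass_naturality r f hM₁ hN₁,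
      ← Ext.comp_assoc_of_second_deg_zero, ih (quotOneMap r f) hM₂ hN₂,
      Ext.comp_assoc _ _ _ (zero_add _) rfl (by omega)]

/-- A sequence that kills `X` kills every `Ext` out of `X`, so each connecting map in the composite
is onto. For `X = k` and `n = 0` this and the next lemma amount to `Hom(k, M/xM) ≅ Ext^d(k, M)`. -/
theorem exists_comp_koszulClass (rs : List A) {M : ModuleCat.{u} A} (hM : IsWeaklyRegular M rs)
    {X : ModuleCat.{u} A} (hX : ∀ r ∈ rs, r • 𝟙 X = 0) {n m : ℕ} (hnm : n + rs.length = m)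
    (u : Ext X M m) : ∃ v : Ext X (quotSeq rs M) n, v.comp (koszulClass rs M hM) hnm = u := by
  induction rs generalizing M m with
  | nil =>
    obtain rfl : n = m := hnm
    refine ⟨u, ?_⟩
    change u.comp (Ext.mk₀ (𝟙 M)) _ = u
    simp
  | cons r rs ih =>
    obtain ⟨hM₁, hM₂⟩ := (isWeaklyRegular_cons_iff M r rs).mp hM
    obtain rfl : n + rs.length + 1 = m := by rw [← hnm, List.length_cons, add_assoc]
    have hu : r • u = 0 := by
      rw [← Ext.mk₀_id_comp u, ← Ext.smul_comp, ← Ext.mk₀_smul, hX r List.mem_cons_self,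
        Ext.mk₀_zero, Ext.zero_comp]
    obtain ⟨u', rfl⟩ := exists_comp_smulClass hM₁ u hu
    obtain ⟨v, rfl⟩ := ih hM₂ (fun s hs => hX s (List.mem_cons_of_mem _ hs)) rfl u'
    refine ⟨v, ?_⟩
    change v.comp ((koszulClass rs (quotOne r M) hM₂).comp (smulClass r M hM₁) rfl) _ = _
    rw [Ext.comp_assoc _ _ _ rfl rfl (by omega)]

/-- The kernel of each connecting map comes from an `Ext` of `M` in degree below the length of the
sequence, which vanishes. -/
theorem eq_zero_of_comp_koszulClass (rs : List A) {M : ModuleCat.{u} A}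
    (hM : IsWeaklyRegular M rs) {X : ModuleCat.{u} A}
    (hX : ∀ i < rs.length, Subsingleton (Ext X M i)) : ∀ v : Ext X (quotSeq rs M) 0,
    v.comp (koszulClass rs M hM) (zero_add _) = 0 → v = 0 := by
  induction rs generalizing M with
  | nil =>
    change ∀ v : Ext X M 0, v.comp (Ext.mk₀ (𝟙 M)) (zero_add 0) = 0 → v = 0
    intro v hv
    rwa [Ext.comp_mk₀_id] at hv
  | cons r rs ih =>
    obtain ⟨hM₁, hM₂⟩ := (isWeaklyRegular_cons_iff M r rs).mp hM
    change ∀ v : Ext X (quotSeq rs (quotOne r M)) 0,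
      v.comp ((koszulClass rs (quotOne r M) hM₂).comp (smulClass r M hM₁) rfl)
        (zero_add (rs.length + 1)) = 0 → v = 0
    intro v hv
    refine ih hM₂ (fun i hi => ?_) v ?_
    · exact subsingleton_ext_of_covariant_right (quotOneComplex_shortExact hM₁)
        (hX (i + 1) (by simpa using hi)) (hX i (by simp; omega))
    · rw [← Ext.comp_assoc _ _ _ (zero_add rs.length) rfl (by omega)] at hv
      obtain ⟨w, hw⟩ := exists_mk₀_comp_of_comp_smulClass hM₁ _ hv
      rw [← hw]
      have := hX rs.length (by simp)
      rw [Subsingleton.elim w 0, Ext.zero_comp]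

/-- Write `σ` for the class of multiplication by the first element `r`. By induction `σ u` is a
combination of classes in `Ext^(n+1)(M/rM, N)` with coefficients in the ideal of the remaining
elements. These classes are all of the form `σ w`, because `Ext^(n+1)(M, N) = 0`. So `u` differs
from such a combination by a class killed by `σ`, that is, by a multiple of `r`. -/
theorem mem_smul_top_of_koszulClass_comp (rs : List A) {M : ModuleCat.{u} A}
    (hM : IsWeaklyRegular M rs) {N : ModuleCat.{u} A} {n m : ℕ}
    (hN : ∀ i, n < i → Subsingleton (Ext M N i)) (hnm : rs.length + n = m) (u : Ext M N n)
    (hu : (koszulClass rs M hM).comp u hnm = 0) :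
    u ∈ Ideal.ofList rs • (⊤ : Submodule A (Ext M N n)) := by
  induction rs generalizing M n m with
  | nil =>
    obtain rfl : n = m := by simpa using hnm
    change (Ext.mk₀ (𝟙 M)).comp u _ = 0 at hu
    rw [Ext.mk₀_id_comp] at hu
    rw [hu]
    exact zero_mem _
  | cons r rs ih =>
    obtain ⟨hM₁, hM₂⟩ := (isWeaklyRegular_cons_iff M r rs).mp hM
    change ((koszulClass rs (quotOne r M) hM₂).comp (smulClass r M hM₁) rfl).comp u _ = 0 at hu
    rw [Ext.comp_assoc _ _ _ rfl (add_comm 1 n) (by simp at hnm; omega)] at hu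
    have h := ih hM₂ (n := n + 1) (m := m) ?_ (by simp at hnm; omega) _ hu
    · have hσ : ∃ w ∈ Ideal.ofList rs • (⊤ : Submodule A (Ext M N n)),
          (smulClass r M hM₁).comp w (add_comm 1 n) =
            (smulClass r M hM₁).comp u (add_comm 1 n) := by
        refine Submodule.smul_induction_on (p := fun y => ∃ w ∈ Ideal.ofList rs •
          (⊤ : Submodule A (Ext M N n)), (smulClass r M hM₁).comp w (add_comm 1 n) = y) h ?_ ?_
        · intro a ha v _
          obtain ⟨w, rfl⟩ := exists_smulClass_comp hM₁ (hN (n + 1) n.lt_succ_self) v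
          exact ⟨a • w, Submodule.smul_mem_smul ha trivial, by rw [Ext.comp_smul]⟩
        · rintro _ _ ⟨w, hw, rfl⟩ ⟨w', hw', rfl⟩
          exact ⟨w + w', add_mem hw hw', by rw [Ext.comp_add]⟩
      obtain ⟨w, hw, hwu⟩ := hσ
      obtain ⟨z, hz⟩ := exists_smul_of_smulClass_comp hM₁ (u - w) (by
        rw [sub_eq_add_neg, Ext.comp_add, Ext.comp_neg, hwu, add_neg_cancel])
      rw [Ideal.ofList_cons_smul]
      have : u = r • z + w := by rw [hz, sub_add_cancel]
      rw [this]
      exact Submodule.add_mem_sup (Submodule.smul_mem_pointwise_smul _ _ _ trivial) hw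
    · intro i hi
      obtain ⟨i, rfl⟩ : ∃ j, i = j + 1 := ⟨i - 1, by omega⟩
      have h₁ := hN i (by omega)
      have h₂ := hN (i + 1) (by omega)
      refine subsingleton_of_forall_eq 0 fun x => ?_
      obtain ⟨y, rfl⟩ := exists_smulClass_comp hM₁ h₂ x
      rw [Subsingleton.elim y 0, Ext.comp_zero]

end KoszulClass

/-! ### The residue field as a module, and self-extensions of it -/

section ResidueModule

open Abelian RingTheory.Sequence Pointwise

theorem exists_factor {A : Type u} [CommRing A] {M Q N : ModuleCat.{u} A} (q : M ⟶ Q)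
    (hq : Function.Surjective q) (f : M ⟶ N) (h : ∀ x, q x = 0 → f x = 0) :
    ∃ f' : Q ⟶ N, q ≫ f' = f := by
  let e := q.hom.quotKerEquivOfSurjective hq
  refine ⟨ModuleCat.ofHom ((LinearMap.ker q.hom).liftQ f.hom h ∘ₗ e.symm.toLinearMap), ?_⟩
  ext x
  have : e.symm (q.hom x) = Submodule.Quotient.mk x := by
    rw [LinearEquiv.symm_apply_eq]
    rfl
  change (LinearMap.ker q.hom).liftQ f.hom h (e.symm (q.hom x)) = f.hom x
  rw [this]
  rfl

variable (A : Type u) [CommRing A] [IsLocalRing A]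

/-- The residue field as an object of the category of modules. -/
noncomputable abbrev resMod : ModuleCat.{u} A := ModuleCat.of A (ResidueField A)

/-- The projection of a local ring to its residue field, as a morphism of modules. -/
noncomputable def resProj : ModuleCat.of A A ⟶ resMod A := ModuleCat.ofHom (Algebra.linearMap A (ResidueField A))

variable {A}

theorem resProj_apply (a : A) : resProj A a = residue A a := rfl

theorem resProj_surjective : Function.Surjective (resProj A) := residue_surjective

theorem resProj_eq_zero_iff (a : A) : resProj A a = 0 ↔ a ∈ maximalIdeal A :=
  residue_eq_zero_iff a

theorem smul_resMod {a : A} (ha : a ∈ maximalIdeal A) (x : resMod A) : a • x = 0 := by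
  change (algebraMap A (ResidueField A) a) * x = 0
  rw [ResidueField.algebraMap_eq, (residue_eq_zero_iff a).mpr ha, zero_mul]

theorem smul_id_resMod {a : A} (ha : a ∈ maximalIdeal A) : a • 𝟙 (resMod A) = 0 := by
  ext x
  exact smul_resMod ha x

theorem exists_resMod_hom {Q : ModuleCat.{u} A} (y : Q) (hy : ∀ a ∈ maximalIdeal A, a • y = 0) :
    ∃ f : resMod A ⟶ Q, f (1 : ResidueField A) = y := by
  obtain ⟨f, hf⟩ := exists_factor (resProj A) resProj_surjective
    (ModuleCat.ofHom (LinearMap.toSpanSingleton A Q y)) (fun a ha =>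
      hy a ((resProj_eq_zero_iff a).mp ha))
  refine ⟨f, ?_⟩
  have h1 : f (resProj A (1 : A)) = (1 : A) • y := congr($hf (1 : A))
  rwa [one_smul, resProj_apply, map_one] at h1

theorem resMod_hom_ext {Q : ModuleCat.{u} A} {f g : resMod A ⟶ Q}
    (h : f (1 : ResidueField A) = g (1 : ResidueField A)) : f = g := by
  have : Epi (resProj A) := (ModuleCat.epi_iff_surjective _).mpr resProj_surjective
  rw [← cancel_epi (resProj A)]
  ext
  change f (resProj A (1 : A)) = g (resProj A (1 : A))
  rwa [resProj_apply, map_one]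

theorem hom_self_ext {Q : ModuleCat.{u} A} {f g : ModuleCat.of A A ⟶ Q}
    (h : f (1 : A) = g (1 : A)) : f = g := by
  ext
  exact h

/-- A sequence is independent modulo `J` if no element lies in the ideal generated by `J` and the
preceding elements. -/
def IndepSeq : Ideal A → List A → Prop
  | _, [] => True
  | J, r :: rs => r ∉ J ∧ IndepSeq (J ⊔ Ideal.span {r}) rs

/-- Modulo `J ⊇ 𝔪²` the ideal `𝔪` is a vector space over the residue field. An ideal maximal among
those above `J` that avoid `x` is a hyperplane complementary to `x`. -/
theorem exists_hyperplane [IsNoetherianRing A] {J : Ideal A} (hJ : maximalIdeal A ^ 2 ≤ J) {x : A}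
    (hx : x ∈ maximalIdeal A) (hxJ : x ∉ J) :
    ∃ H : Ideal A, J ≤ H ∧ H ≤ maximalIdeal A ∧ x ∉ H ∧
      ∀ y ∈ maximalIdeal A, ∃ a : A, y - a * x ∈ H := by
  obtain ⟨H, ⟨hJH, hxH⟩, hmax⟩ := set_has_maximal_iff_noetherian.mpr ‹IsNoetherianRing A›
    {H : Ideal A | J ≤ H ∧ x ∉ H} ⟨J, le_rfl, hxJ⟩
  have hHm : H ≤ maximalIdeal A := le_maximalIdeal (fun h => hxH (h ▸ trivial))
  refine ⟨H, hJH, hHm, hxH, fun y hy => ?_⟩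
  by_cases hyH : y ∈ H
  · exact ⟨0, by simpa using hyH⟩
  have hx' : x ∈ H ⊔ Ideal.span {y} := by
    by_contra hcon
    refine hmax (H ⊔ Ideal.span {y}) ⟨hJH.trans le_sup_left, hcon⟩ (lt_of_le_of_ne le_sup_left ?_)
    intro heq
    exact hyH (heq ▸ Ideal.mem_sup_right (Ideal.mem_span_singleton_self y))
  obtain ⟨h, hh, z, hz, rfl⟩ := Submodule.mem_sup.mp hx'
  obtain ⟨a, rfl⟩ := Ideal.mem_span_singleton'.mp hz
  -- If `a` were in `𝔪`, then `a * y ∈ 𝔪² ≤ H` and so `x ∈ H`. Hence `a` is a unit and can be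
  -- divided out.
  by_cases ha : a ∈ maximalIdeal A
  · refine absurd (H.add_mem hh (hJH (hJ ?_))) hxH
    rw [pow_two]
    exact Ideal.mul_mem_mul ha hy
  · obtain ⟨b, hb⟩ : IsUnit a := by simpa [mem_maximalIdeal] using ha
    refine ⟨(b⁻¹ : Aˣ), ?_⟩
    have : y - (b⁻¹ : Aˣ) * (h + a * y) = -((b⁻¹ : Aˣ) * h) := by
      have hab : ((b⁻¹ : Aˣ) : A) * a = 1 := by rw [← hb, Units.inv_mul]
      linear_combination -y * hab
    rw [this]
    exact H.neg_mem (H.smul_mem _ hh)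

/-- With `H` a hyperplane of `𝔪` avoiding `r`, multiplication by `r` embeds `k` in `A/H` with
quotient `k`. The cyclic module `M` maps to `A/H` since its relations lie in `J ⊆ H`. This gives a
morphism from `0 → M → M → M/rM → 0` to `0 → k → A/H → k → 0`, and `ε` is the class of the latter.
-/
theorem exists_smulClass_comp_resMod [IsNoetherianRing A] {J : Ideal A}
    (hJ : maximalIdeal A ^ 2 ≤ J) {r : A} (hr : r ∈ maximalIdeal A) (hrJ : r ∉ J)
    {M : ModuleCat.{u} A} (g : ModuleCat.of A A ⟶ M) (hg : Function.Surjective g)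
    (hgJ : ∀ a : A, g a = 0 → a ∈ J) (h : IsSMulRegular M r) (π : M ⟶ resMod A)
    (hπ : g ≫ π = resProj A) (π' : quotOne r M ⟶ resMod A) (hπ' : quotOneProj r M ≫ π' = π) :
    ∃ ε : Ext (resMod A) (resMod A) 1,
      (smulClass r M h).comp (Ext.mk₀ π) (add_zero 1) = (Ext.mk₀ π').comp ε (zero_add 1) := by
  obtain ⟨H, hJH, hHm, hrH, hH⟩ := exists_hyperplane hJ hr hrJ
  let ι : ResidueField A →ₗ[A] (A ⧸ H) := Submodule.mapQ (maximalIdeal A) H (LinearMap.lsmul A A r)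
    (fun a ha => hJH (hJ (by rw [pow_two]; exact Ideal.mul_mem_mul hr ha)))
  let p : (A ⧸ H) →ₗ[A] ResidueField A := Submodule.mapQ H (maximalIdeal A) LinearMap.id hHm
  have hι : ∀ a : A, ι (residue A a) = Submodule.Quotient.mk (r * a) := fun a => rfl
  have hp : ∀ a : A, p (Submodule.Quotient.mk a) = residue A a := fun a => rfl
  have hιinj : Function.Injective ι := by
    rw [injective_iff_map_eq_zero]
    intro x hx
    obtain ⟨a, rfl⟩ := residue_surjective x
    rw [hι, Submodule.Quotient.mk_eq_zero] at hx
    rw [residue_eq_zero_iff]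
    by_contra ha
    obtain ⟨b, rfl⟩ : IsUnit a := by simpa [mem_maximalIdeal] using ha
    apply hrH
    simpa [mul_assoc] using H.mul_mem_right ((b⁻¹ : Aˣ) : A) hx
  have hex : Function.Exact ι p := by
    intro y
    obtain ⟨a, rfl⟩ := Submodule.Quotient.mk_surjective _ y
    rw [hp, residue_eq_zero_iff]
    constructor
    · intro ha
      obtain ⟨b, hb⟩ := hH a ha
      refine ⟨residue A b, ?_⟩
      rw [hι, eq_comm, Submodule.Quotient.eq, mul_comm]
      exact hb
    · rintro ⟨x, hx⟩
      obtain ⟨b, rfl⟩ := residue_surjective x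
      rw [hι, Submodule.Quotient.eq] at hx
      have := Ideal.sub_mem _ (Ideal.mul_mem_right b _ hr) (hHm hx)
      simpa using this
  have hpsurj : Function.Surjective p := by
    intro x
    obtain ⟨a, rfl⟩ := residue_surjective x
    exact ⟨_, hp a⟩
  have hS := shortExact_of_linearMaps hιinj hex hpsurj
  obtain ⟨τ, hτ⟩ := exists_factor g hg (ModuleCat.ofHom H.mkQ) (fun a ha =>
    (Submodule.Quotient.mk_eq_zero H).mpr (hJH (hgJ a ha)))
  have hτ' : ∀ a : A, τ (g a) = Submodule.Quotient.mk a := fun a => congr($hτ a)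
  have hπg : ∀ a : A, π (g a) = residue A a := fun a => congr($hπ a)
  let φ : quotOneComplex r M ⟶
      ModuleCat.shortComplexOfCompEqZero ι p hex.linearMap_comp_eq_zero :=
    { τ₁ := π
      τ₂ := τ
      τ₃ := π'
      comm₁₂ := by
        ext x
        obtain ⟨a, rfl⟩ := hg x
        change ι (π (g a)) = τ (r • g a)
        rw [hπg, hι, map_smul, hτ']
        rfl
      comm₂₃ := by
        change τ ≫ ModuleCat.ofHom p = quotOneProj r M ≫ π'
        rw [hπ']
        ext x
        obtain ⟨a, rfl⟩ := hg x
        change p (τ (g a)) = π (g a)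
        rw [hτ', hp, hπg] }
  exact ⟨hS.extClass,
    ShortComplex.ShortExact.extClass_naturality (quotOneComplex_shortExact h) hS φ⟩

/-- `ε` is the Yoneda product of the self-extensions of `k` attached to the members of the sequence.
Each element divided out is added to `J`, which is why independence is defined successively. -/
theorem exists_koszulClass_comp_resMod [IsNoetherianRing A] (rs : List A)
    (hrs : ∀ r ∈ rs, r ∈ maximalIdeal A) {J : Ideal A}
    (hJ : maximalIdeal A ^ 2 ≤ J) (hind : IndepSeq J rs)
    {M : ModuleCat.{u} A} (g : ModuleCat.of A A ⟶ M) (hg : Function.Surjective g)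
    (hgJ : ∀ a : A, g a = 0 → a ∈ J) (h : IsWeaklyRegular M rs) (π : M ⟶ resMod A)
    (hπ : g ≫ π = resProj A) :
    ∃ (π' : quotSeq rs M ⟶ resMod A) (ε : Ext (resMod A) (resMod A) rs.length),
      quotSeqProj rs M ≫ π' = π ∧
      (koszulClass rs M h).comp (Ext.mk₀ π) (add_zero _) = (Ext.mk₀ π').comp ε (zero_add _) := by
  induction rs generalizing M J with
  | nil =>
    refine ⟨π, Ext.mk₀ (𝟙 _), Category.id_comp π, ?_⟩
    change (Ext.mk₀ (𝟙 M)).comp (Ext.mk₀ π) (add_zero 0) =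
      (Ext.mk₀ π).comp (Ext.mk₀ (𝟙 _)) (zero_add 0)
    rw [Ext.mk₀_id_comp, Ext.comp_mk₀_id]
  | cons r rs ih =>
    obtain ⟨h₁, h₂⟩ := (isWeaklyRegular_cons_iff M r rs).mp h
    have hr := hrs r List.mem_cons_self
    have hker : ∀ x : M, quotOneProj r M x = 0 → ∃ y : M, r • y = x := fun x hx =>
      (Submodule.mem_smul_pointwise_iff_exists x r ⊤).mp
        ((Submodule.Quotient.mk_eq_zero _).mp hx) |>.imp fun y hy => hy.2
    obtain ⟨π', hπ'⟩ := exists_factor (quotOneProj r M) (quotOneProj_surjective r M) π (by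
      intro x hx
      obtain ⟨y, rfl⟩ := hker x hx
      rw [map_smul]
      exact smul_resMod hr _)
    obtain ⟨ε₁, hε₁⟩ := exists_smulClass_comp_resMod hJ hr hind.1 g hg hgJ h₁ π hπ π' hπ'
    obtain ⟨π'', ε, hπ'', hε⟩ := ih (fun s hs => hrs s (List.mem_cons_of_mem _ hs))
      (J := J ⊔ Ideal.span {r}) (hJ.trans le_sup_left) hind.2 (M := quotOne r M)
      (g ≫ quotOneProj r M) ((quotOneProj_surjective r M).comp hg) (by
        intro a ha
        obtain ⟨y, hy⟩ := hker _ ha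
        obtain ⟨b, rfl⟩ := hg y
        have : a - r * b ∈ J := by
          apply hgJ
          have h1 : g (a - r * b) = g a - g (r • b) := map_sub g.hom a (r • b)
          have h2 : g (r • b) = r • g b := map_smul g.hom r b
          rw [h1, h2, hy]
          exact sub_self (g a)
        have h3 : a = (a - r * b) + b * r := by ring
        rw [h3]
        exact Submodule.add_mem_sup this (Ideal.mul_mem_left _ _ (Ideal.mem_span_singleton_self r)))
      h₂ π' (by rw [Category.assoc, hπ', hπ])
    refine ⟨π'', ε.comp ε₁ rfl, ?_, ?_⟩
    · change (quotOneProj r M ≫ quotSeqProj rs (quotOne r M)) ≫ π'' = π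
      rw [Category.assoc, hπ'', hπ']
    · change ((koszulClass rs (quotOne r M) h₂).comp (smulClass r M h₁) rfl).comp
        (Ext.mk₀ π) (add_zero (rs.length + 1)) =
        (Ext.mk₀ π'').comp (ε.comp ε₁ rfl) (zero_add (rs.length + 1))
      rw [Ext.comp_assoc_of_third_deg_zero, hε₁, ← Ext.comp_assoc_of_second_deg_zero, hε,
        Ext.comp_assoc _ _ _ (zero_add _) rfl (by omega)]

/-- As `A` is projective, the kernel of composition with the iterated class on `Hom(A, k)` lies in
`(x) Hom(A, k)`, which is zero, whereas `A → k` is not. -/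
theorem koszulClass_comp_ne_zero {rs : List A}
    (hrs : ∀ r ∈ rs, r ∈ maximalIdeal A) (h : IsWeaklyRegular (ModuleCat.of A A) rs) :
    (koszulClass rs (ModuleCat.of A A) h).comp (Ext.mk₀ (resProj A)) (add_zero _) ≠ 0 := by
  intro h0
  have hproj : Projective (ModuleCat.of A A) :=
    ModuleCat.projective_of_free (Module.Basis.singleton PUnit.{1} A)
  have hmem := mem_smul_top_of_koszulClass_comp rs h (N := resMod A) (n := 0) (by
    intro i hi
    obtain ⟨j, rfl⟩ : ∃ j, i = j + 1 := ⟨i - 1, by omega⟩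
    exact Ext.subsingleton_of_projective _ _ _) (add_zero _) _ h0
  have hbot : Ideal.ofList rs • (⊤ : Submodule A (Ext (ModuleCat.of A A) (resMod A) 0)) ≤ ⊥ := by
    rw [Submodule.smul_le]
    intro a ha x _
    have ha' : a ∈ maximalIdeal A := Ideal.span_le.mpr hrs ha
    rw [Submodule.mem_bot, ← Ext.comp_mk₀_id x, ← Ext.comp_smul, ← Ext.mk₀_smul,
      smul_id_resMod ha', Ext.mk₀_zero, Ext.comp_zero]
  have h1 := (Submodule.mem_bot A).mp (hbot hmem)
  rw [Ext.mk₀_eq_zero_iff] at h1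
  have h2 : resProj A (1 : A) = 0 := by rw [h1]; rfl
  rw [resProj_eq_zero_iff] at h2
  exact (Ideal.ne_top_iff_one _).mp (maximalIdeal.isMaximal A).ne_top h2

end ResidueModule

/-! ### Minimal syzygies of the residue field -/

section MinimalSyzygy

open Abelian RingTheory.Sequence Pointwise

variable (A : Type u) [CommRing A] [IsLocalRing A]

/-- `P` is an `n`-th syzygy of the residue field in a minimal free resolution. -/
def IsMinSyzygy : ℕ → ModuleCat.{u} A → Prop
  | 0, P => Nonempty (resMod A ≅ P)
  | n + 1, P => ∃ (P' : ModuleCat.{u} A) (m : ℕ) (i : P →ₗ[A] (Fin m → A))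
      (p : (Fin m → A) →ₗ[A] P'), IsMinSyzygy n P' ∧ Function.Injective i ∧ Function.Exact i p ∧
        Function.Surjective p ∧ LinearMap.range i ≤ maximalIdeal A • ⊤

variable {A}

/-- The properties of the class `η ∈ Ext^n(k, P)` of a free resolution of `k` up to the `n`-th
syzygy `P`. -/
structure IsSyzygyClass {n : ℕ} {P : ModuleCat.{u} A} (η : Ext (resMod A) P n) : Prop where
  exists_comp : ∀ (N : ModuleCat.{u} A) (j l : ℕ) (h : n + j = l) (x : Ext (resMod A) N l),
    ∃ y : Ext P N j, η.comp y h = x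
  eq_zero : ∀ (N : ModuleCat.{u} A) (j l : ℕ) (h : n + (j + 1) = l) (y : Ext P N (j + 1)),
    η.comp y h = 0 → y = 0
  exists_lift : ∀ (M N : ModuleCat.{u} A) (p : M ⟶ N), Function.Surjective p →
    ∀ g : P ⟶ N, η.comp (Ext.mk₀ g) (add_zero n) = 0 → ∃ g' : P ⟶ M, g' ≫ p = g
  exists_eq_comp : ∀ (X : ModuleCat.{u} A),
    (∀ i ≤ n, Subsingleton (Ext X (ModuleCat.of A A) i)) → ∀ x : Ext X P n,
    ∃ f : X ⟶ resMod A, (Ext.mk₀ f).comp η (zero_add n) = x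

theorem subsingleton_ext_pi {A : Type u} [CommRing A] {X : ModuleCat.{u} A} {M : Type u}
    [AddCommGroup M] [Module A M]
    {i : ℕ} (h : Subsingleton (Ext X (ModuleCat.of A M) i)) (m : ℕ) :
    Subsingleton (Ext X (ModuleCat.of A (Fin m → M)) i) := by
  induction m with
  | zero =>
    have : IsZero (ModuleCat.of A (Fin 0 → M)) := ModuleCat.isZero_of_subsingleton _
    refine subsingleton_of_forall_eq 0 fun x => ?_
    rw [← Ext.comp_mk₀_id x, this.eq_of_src (𝟙 _) 0, Ext.mk₀_zero, Ext.comp_zero]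
  | succ m ih =>
    have hS := shortExact_of_linearMaps (A := A)
      (f := (Fin.consLinearEquiv A (fun _ : Fin (m + 1) => M)).toLinearMap ∘ₗ
        LinearMap.inl A M (Fin m → M))
      (g := LinearMap.snd A M (Fin m → M) ∘ₗ
        (Fin.consLinearEquiv A (fun _ : Fin (m + 1) => M)).symm.toLinearMap)
      ((Fin.consLinearEquiv A (fun _ : Fin (m + 1) => M)).injective.comp
        (LinearMap.inl_injective (R := A) (M := M) (M₂ := Fin m → M)))
      (by
        intro y
        obtain ⟨⟨a, b⟩, rfl⟩ := (Fin.consLinearEquiv A (fun _ : Fin (m + 1) => M)).surjective y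
        simp only [LinearMap.comp_apply, LinearEquiv.coe_coe, LinearEquiv.symm_apply_apply,
          LinearMap.snd_apply, Set.mem_range, LinearMap.inl_apply, EmbeddingLike.apply_eq_iff_eq,
          Prod.mk.injEq]
        exact ⟨fun hb => ⟨a, rfl, hb.symm⟩, fun ⟨_, _, hb⟩ => hb.symm⟩)
      ((LinearMap.snd_surjective (R := A) (M := M) (M₂ := Fin m → M)).comp
        (Fin.consLinearEquiv A (fun _ : Fin (m + 1) => M)).symm.surjective)
    exact subsingleton_ext_of_covariant_middle hS h ih

theorem isSyzygyClass_zero {P : ModuleCat.{u} A} (e : resMod A ≅ P) :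
    IsSyzygyClass (Ext.mk₀ e.hom) where
  exists_comp N j l h x := by
    obtain rfl : j = l := by omega
    refine ⟨(Ext.mk₀ e.inv).comp x (zero_add j), ?_⟩
    rw [Ext.mk₀_comp_mk₀_assoc, e.hom_inv_id, Ext.mk₀_id_comp]
  eq_zero N j l h y hy := by
    obtain rfl : j + 1 = l := by omega
    rw [← Ext.mk₀_id_comp y, ← e.inv_hom_id, ← Ext.mk₀_comp_mk₀_assoc, hy, Ext.comp_zero]
  exists_lift M N p _ g hg := by
    rw [Ext.mk₀_comp_mk₀, Ext.mk₀_eq_zero_iff] at hg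
    refine ⟨0, ?_⟩
    rw [zero_comp, ← cancel_epi e.hom, hg, comp_zero]
  exists_eq_comp X _ x := by
    obtain ⟨f, rfl⟩ := (Ext.mk₀_bijective X P).2 x
    refine ⟨f ≫ e.inv, ?_⟩
    rw [Ext.mk₀_comp_mk₀, Category.assoc, e.inv_hom_id, Category.comp_id]

/-- Dimension shifting: positive `Ext` out of the free module vanishes, and for the last property
`Ext` from `X` into it vanishes by assumption. -/
theorem isSyzygyClass_succ {n : ℕ} {P P' : ModuleCat.{u} A} {η : Ext (resMod A) P' n}
    (hη : IsSyzygyClass η) {m : ℕ} {i : P →ₗ[A] (Fin m → A)} {p : (Fin m → A) →ₗ[A] P'}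
    (hi : Function.Injective i) (hip : Function.Exact i p) (hp : Function.Surjective p) :
    IsSyzygyClass (η.comp (shortExact_of_linearMaps hi hip hp).extClass rfl) := by
  have hS := shortExact_of_linearMaps hi hip hp
  have hF : Projective (ModuleCat.of A (Fin m → A)) :=
    (IsProjective.iff_projective (R := A) (Fin m → A)).mp inferInstance
  have hzero : ∀ (N : ModuleCat.{u} A) (j : ℕ),
      Subsingleton (Ext (ModuleCat.of A (Fin m → A)) N (j + 1)) := fun N j =>
    Ext.subsingleton_of_projective _ _ _
  refine ⟨fun N j l h x => ?_, fun N j l h y hy => ?_, fun M N q hq g hg => ?_, fun X hX x => ?_⟩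
  · obtain ⟨y', rfl⟩ := hη.exists_comp N (j + 1) l (by omega) x
    obtain ⟨y, rfl⟩ := Ext.contravariant_sequence_exact₃ hS N y' ((hzero N j).elim _ _)
      (add_comm 1 j)
    exact ⟨y, Ext.comp_assoc _ _ _ rfl (add_comm 1 j) (by omega)⟩
  · rw [Ext.comp_assoc _ _ _ rfl (add_comm 1 (j + 1)) (by omega)] at hy
    have h1 := hη.eq_zero N (j + 1) l (by omega) _ hy
    obtain ⟨z, hz⟩ := Ext.contravariant_sequence_exact₁ hS N y (add_comm 1 (j + 1)) h1
    rw [← hz, (hzero N j).elim z 0, Ext.comp_zero]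
  -- A map killed by the new class is killed by the connecting class, so it extends to the free
  -- module, where projectivity provides a lift.
  · rw [Ext.comp_assoc _ _ _ rfl (add_comm 1 0) (by omega)] at hg
    have h1 := hη.eq_zero N 0 (n + 1) rfl _ hg
    obtain ⟨z, hz⟩ := Ext.contravariant_sequence_exact₁ hS N _ (add_comm 1 0) h1
    obtain ⟨h, rfl⟩ := (Ext.mk₀_bijective _ _).2 z
    rw [Ext.mk₀_comp_mk₀] at hz
    have hz' := (Ext.mk₀_bijective _ _).1 hz
    have : Epi q := (ModuleCat.epi_iff_surjective _).mpr hq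
    have hh : Projective.factorThru (P := ModuleCat.of A (Fin m → A)) h q ≫ q = h :=
      Projective.factorThru_comp _ _
    refine ⟨ModuleCat.ofHom i ≫ Projective.factorThru (P := ModuleCat.of A (Fin m → A)) h q, ?_⟩
    rw [Category.assoc, hh]
    exact hz'
  · have hXF := subsingleton_ext_pi (hX (n + 1) le_rfl) m
    obtain ⟨y, rfl⟩ := Ext.covariant_sequence_exact₁ X hS x (hXF.elim _ _) rfl
    obtain ⟨f, rfl⟩ := hη.exists_eq_comp X (fun j hj => hX j (hj.trans n.le_succ)) y
    exact ⟨f, (Ext.comp_assoc _ _ _ (zero_add n) rfl (by omega)).symm⟩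

theorem isSyzygyClass_succ_of_eq {n l : ℕ} (h : n + 1 = l) {P P' : ModuleCat.{u} A}
    {η : Ext (resMod A) P' n}
    (hη : IsSyzygyClass η) {m : ℕ} {i : P →ₗ[A] (Fin m → A)} {p : (Fin m → A) →ₗ[A] P'}
    (hi : Function.Injective i) (hip : Function.Exact i p) (hp : Function.Surjective p) :
    IsSyzygyClass (η.comp (shortExact_of_linearMaps hi hip hp).extClass h) := by
  subst h
  exact isSyzygyClass_succ hη hi hip hp

theorem IsMinSyzygy.exists_isSyzygyClass {n : ℕ} {P : ModuleCat.{u} A} (hP : IsMinSyzygy A n P) :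
    ∃ η : Ext (resMod A) P n, IsSyzygyClass η := by
  induction n generalizing P with
  | zero =>
    obtain ⟨e⟩ := hP
    exact ⟨_, isSyzygyClass_zero e⟩
  | succ n ih =>
    obtain ⟨P', m, i, p, hP', hi, hip, hp, -⟩ := hP
    obtain ⟨η, hη⟩ := ih hP'
    exact ⟨_, isSyzygyClass_succ hη hi hip hp⟩

theorem quotSeqMap_smul_eq_zero {rs : List A} {M : ModuleCat.{u} A}
    (hM : maximalIdeal A • (⊤ : Submodule A M) ≤ Ideal.ofList rs • ⊤) {a : A}
    (ha : a ∈ maximalIdeal A) (y : quotSeq rs M) : a • y = 0 := by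
  obtain ⟨x, rfl⟩ := quotSeqProj_surjective rs M y
  rw [← map_smul, quotSeqProj_eq_zero_iff]
  exact hM (Submodule.smul_mem_smul ha trivial)

/-- The class `η g` equals `v κ_N` for some `v : k → N/xN`. As `𝔪` kills `M/xM`, the map `v` lifts
to `v' : k → M/xM`, and `v' κ_M = η g₁` for some `g₁ : P → M`. Then `g - g₁ p` is killed by `η` and
lifts as well. -/
theorem IsSyzygyClass.exists_lift_of_le {rs : List A} {P : ModuleCat.{u} A}
    {η : Ext (resMod A) P rs.length} (hη : IsSyzygyClass η)
    (hrs : ∀ r ∈ rs, r ∈ maximalIdeal A) {M N : ModuleCat.{u} A} (hM : IsWeaklyRegular M rs)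
    (hN : IsWeaklyRegular N rs)
    (hM' : maximalIdeal A • (⊤ : Submodule A M) ≤ Ideal.ofList rs • ⊤) (p : M ⟶ N)
    (hp : Function.Surjective p) (g : P ⟶ N) : ∃ g' : P ⟶ M, g' ≫ p = g := by
  obtain ⟨v, hv⟩ := exists_comp_koszulClass rs hN (X := resMod A)
    (fun r hr => smul_id_resMod (hrs r hr)) (zero_add _) (η.comp (Ext.mk₀ g) (add_zero _))
  obtain ⟨v, rfl⟩ := (Ext.mk₀_bijective _ _).2 v
  obtain ⟨y, hy⟩ := quotSeqMap_surjective rs p hp (v (1 : ResidueField A))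
  obtain ⟨v', hv'⟩ := exists_resMod_hom y (fun a ha => quotSeqMap_smul_eq_zero hM' ha y)
  have hvv : v' ≫ quotSeqMap rs p = v := by
    apply resMod_hom_ext
    change quotSeqMap rs p (v' _) = _
    rw [hv', hy]
  obtain ⟨z, hz⟩ := hη.exists_comp M 0 _ rfl ((Ext.mk₀ v').comp (koszulClass rs M hM) (zero_add _))
  obtain ⟨g₁, rfl⟩ := (Ext.mk₀_bijective _ _).2 z
  have h1 : η.comp (Ext.mk₀ (g₁ ≫ p)) (add_zero _) = η.comp (Ext.mk₀ g) (add_zero _) := by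
    rw [← hv, ← hvv, ← Ext.mk₀_comp_mk₀, ← Ext.mk₀_comp_mk₀, Ext.comp_assoc_of_second_deg_zero,
      ← koszulClass_naturality rs p hM hN, ← Ext.comp_assoc_of_third_deg_zero,
      ← Ext.comp_assoc_of_third_deg_zero, hz]
  obtain ⟨g₂, hg₂⟩ := hη.exists_lift M N p hp (g - g₁ ≫ p) (by
    rw [sub_eq_add_neg, Ext.mk₀_add, Ext.mk₀_neg, Ext.comp_add, Ext.comp_neg, h1, add_neg_cancel])
  exact ⟨g₁ + g₂, by rw [Preadditive.add_comp, hg₂, add_sub_cancel]⟩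

/-- Choose `x` in `N` with `h x = 1`. Its class modulo the sequence is killed by `𝔪`, so it defines
`w : k → N/(rs)N`, and `w κ_N = η g` for some `g`. If `g h` were zero, naturality of the iterated
class would make its product with `A → k` vanish. -/
theorem IsSyzygyClass.exists_comp_ne_zero {rs : List A} {P : ModuleCat.{u} A}
    {η : Ext (resMod A) P rs.length} (hη : IsSyzygyClass η)
    (hrs : ∀ r ∈ rs, r ∈ maximalIdeal A) (hA : IsWeaklyRegular (ModuleCat.of A A) rs)
    {N : ModuleCat.{u} A} (hN : IsWeaklyRegular N rs)
    (hN' : maximalIdeal A • (⊤ : Submodule A N) ≤ Ideal.ofList rs • ⊤) (h : N ⟶ resMod A)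
    (hh : h ≠ 0) : ∃ g : P ⟶ N, g ≫ h ≠ 0 := by
  obtain ⟨x, hx⟩ : ∃ x : N, h x = (1 : ResidueField A) := by
    obtain ⟨y, hy⟩ : ∃ y : N, h y ≠ 0 := by
      by_contra! hcon
      exact hh (ModuleCat.hom_ext (LinearMap.ext hcon))
    obtain ⟨a, ha⟩ := residue_surjective (R := A) ((h y : ResidueField A)⁻¹)
    refine ⟨a • y, ?_⟩
    rw [map_smul]
    change residue A a * (h y : ResidueField A) = 1
    rw [ha]
    exact inv_mul_cancel₀ hy
  let f : ModuleCat.of A A ⟶ N := ModuleCat.ofHom (LinearMap.toSpanSingleton A N x)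
  have hf1 : f (1 : A) = x := LinearMap.toSpanSingleton_apply_one A N x
  have hfh : f ≫ h = resProj A := by
    apply hom_self_ext
    change h (f (1 : A)) = resProj A (1 : A)
    rw [hf1, hx, resProj_apply, map_one]
  obtain ⟨π, hπ⟩ := exists_factor (quotSeqProj rs (ModuleCat.of A A))
    (quotSeqProj_surjective rs _) (resProj A) (by
      intro a ha
      rw [quotSeqProj_eq_zero_iff] at ha
      rw [resProj_eq_zero_iff]
      have : Ideal.ofList rs • (⊤ : Submodule A A) ≤ maximalIdeal A := by
        rw [smul_eq_mul]
        exact Ideal.mul_le_left.trans (Ideal.span_le.mpr hrs)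
      exact this ha)
  obtain ⟨w, hw⟩ := exists_resMod_hom (quotSeqProj rs N x)
    (fun a ha => quotSeqMap_smul_eq_zero hN' ha _)
  have hπw : π ≫ w = quotSeqMap rs f := by
    have : Epi (quotSeqProj rs (ModuleCat.of A A)) :=
      (ModuleCat.epi_iff_surjective _).mpr (quotSeqProj_surjective rs _)
    rw [← cancel_epi (quotSeqProj rs (ModuleCat.of A A)), ← Category.assoc, hπ,
      ← quotSeqProj_naturality]
    apply hom_self_ext
    change w (resProj A (1 : A)) = quotSeqProj rs N (f (1 : A))
    rw [hf1, resProj_apply, map_one, hw]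
  obtain ⟨z, hz⟩ := hη.exists_comp N 0 _ rfl ((Ext.mk₀ w).comp (koszulClass rs N hN) (zero_add _))
  obtain ⟨g, rfl⟩ := (Ext.mk₀_bijective _ _).2 z
  refine ⟨g, fun hg => koszulClass_comp_ne_zero hrs hA ?_⟩
  rw [← hfh, ← Ext.mk₀_comp_mk₀, ← Ext.comp_assoc_of_third_deg_zero,
    koszulClass_naturality rs f hA hN, ← hπw, ← Ext.mk₀_comp_mk₀,
    Ext.comp_assoc_of_second_deg_zero, ← hz, Ext.comp_assoc_of_third_deg_zero,
    Ext.comp_assoc_of_third_deg_zero, Ext.mk₀_comp_mk₀, hg, Ext.mk₀_zero, Ext.comp_zero,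
    Ext.comp_zero]

theorem resMod_hom_eq_smul {X : ModuleCat.{u} A} (g : ModuleCat.of A A ⟶ X)
    (hg : Function.Surjective g) (π f : X ⟶ resMod A) (hπ : g ≫ π = resProj A) :
    ∃ a : A, f = a • π := by
  obtain ⟨a, ha⟩ := residue_surjective (R := A) (f (g (1 : A)) : ResidueField A)
  refine ⟨a, ?_⟩
  have : Epi g := (ModuleCat.epi_iff_surjective _).mpr hg
  rw [← cancel_epi g, Linear.comp_smul, hπ]
  apply hom_self_ext
  change f (g (1 : A)) = residue A a * residue A 1
  rw [ha, (residue A).map_one, mul_one]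

theorem smul_id_quotSeq {rs : List A} {a : A} (ha : a ∈ Ideal.ofList rs) (M : ModuleCat.{u} A) :
    a • 𝟙 (quotSeq rs M) = 0 := by
  have : Epi (quotSeqProj rs M) :=
    (ModuleCat.epi_iff_surjective _).mpr (quotSeqProj_surjective rs _)
  rw [← cancel_epi (quotSeqProj rs M), Linear.comp_smul, Category.comp_id, comp_zero]
  ext x
  change a • quotSeqProj rs M x = 0
  rw [← map_smul, quotSeqProj_eq_zero_iff]
  exact Submodule.smul_mem_smul ha trivial

theorem koszulClass_comp_toSpanSingleton {rs : List A}
    (hA : IsWeaklyRegular (ModuleCat.of A A) rs) {N : ModuleCat.{u} A} {y : N}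
    (hy : y ∈ Ideal.ofList rs • (⊤ : Submodule A N)) :
    (koszulClass rs (ModuleCat.of A A) hA).comp
      (Ext.mk₀ (ModuleCat.ofHom (LinearMap.toSpanSingleton A N y))) (add_zero _) = 0 := by
  induction hy using Submodule.smul_induction_on' with
  | smul a ha z hz =>
    have : ModuleCat.ofHom (LinearMap.toSpanSingleton A N (a • z)) =
        a • ModuleCat.ofHom (LinearMap.toSpanSingleton A N z) := by
      apply hom_self_ext
      change (1 : A) • a • z = a • (1 : A) • z
      rw [one_smul, one_smul]
    rw [this, Ext.mk₀_smul, Ext.comp_smul, ← Ext.smul_comp, ← Ext.mk₀_id_comp (koszulClass _ _ _),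
      ← Ext.smul_comp, ← Ext.mk₀_smul, smul_id_quotSeq ha, Ext.mk₀_zero, Ext.zero_comp,
      Ext.zero_comp]
  | add y hy z hz h1 h2 =>
    have : ModuleCat.ofHom (LinearMap.toSpanSingleton A N (y + z)) =
        ModuleCat.ofHom (LinearMap.toSpanSingleton A N y) +
          ModuleCat.ofHom (LinearMap.toSpanSingleton A N z) := by
      apply hom_self_ext
      change (1 : A) • (y + z) = (1 : A) • y + (1 : A) • z
      rw [smul_add]
    rw [this, Ext.mk₀_add, Ext.comp_add, h1, h2, add_zero]

/-- With the preceding lemma, membership in `(rs)N` becomes the vanishing of a single `Ext` class.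
The proof reads the general kernel statement on `Ext⁰(A, N) = Hom(A, N) = N`. -/
theorem mem_smul_top_of_koszulClass_comp_toSpanSingleton {rs : List A}
    (hA : IsWeaklyRegular (ModuleCat.of A A) rs) {N : ModuleCat.{u} A} {y : N}
    (hy : (koszulClass rs (ModuleCat.of A A) hA).comp
      (Ext.mk₀ (ModuleCat.ofHom (LinearMap.toSpanSingleton A N y))) (add_zero _) = 0) :
    y ∈ Ideal.ofList rs • (⊤ : Submodule A N) := by
  have hproj : Projective (ModuleCat.of A A) :=
    ModuleCat.projective_of_free (Module.Basis.singleton PUnit.{1} A)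
  have hmem := mem_smul_top_of_koszulClass_comp rs hA (n := 0) (by
    intro j hj
    obtain ⟨l, rfl⟩ : ∃ l, j = l + 1 := ⟨j - 1, by omega⟩
    exact Ext.subsingleton_of_projective _ _ _) (add_zero _) _ hy
  let ev : Ext (ModuleCat.of A A) N 0 →ₗ[A] N :=
    LinearMap.applyₗ (1 : A) ∘ₗ
      ((Ext.linearEquiv₀ (R := A)).trans ModuleCat.homLinearEquiv).toLinearMap
  have hev : ev (Ext.mk₀ (ModuleCat.ofHom (LinearMap.toSpanSingleton A N y))) = y := by
    have : Ext.linearEquiv₀ (R := A)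
        (Ext.mk₀ (ModuleCat.ofHom (LinearMap.toSpanSingleton A N y))) =
        ModuleCat.ofHom (LinearMap.toSpanSingleton A N y) :=
      (Ext.linearEquiv₀ (R := A)).apply_symm_apply _
    change (Ext.linearEquiv₀ (R := A)
      (Ext.mk₀ (ModuleCat.ofHom (LinearMap.toSpanSingleton A N y)))).hom (1 : A) = y
    rw [this]
    exact one_smul A y
  rw [← hev]
  have := Submodule.mem_map_of_mem (f := ev) hmem
  rw [Submodule.map_smul''] at this
  exact Submodule.smul_mono le_rfl le_top this

theorem support_quotSeq_subset {rs : List A} {n : ℕ} (h : maximalIdeal A ^ n ≤ Ideal.ofList rs)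
    (M : ModuleCat.{u} A) :
    Module.support A (quotSeq rs M) ⊆ PrimeSpectrum.zeroLocus (maximalIdeal A) := by
  intro p hp
  rw [PrimeSpectrum.mem_zeroLocus, SetLike.coe_subset_coe]
  refine p.2.le_of_pow_le (n := n) ?_
  intro a ha
  by_contra hap
  obtain ⟨x, hx⟩ := Module.mem_support_iff_exists_annihilator.mp hp
  refine hap (hx ?_)
  rw [Submodule.mem_annihilator_span_singleton]
  exact congr($(smul_id_quotSeq (h ha) M) x)

/-- To place `b x` in `(rs)P`, its class in `Ext^d(A/(rs), P)` is shown to vanish. It dies in the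
free module, hence has the form `a π η'` with `π : A/(rs) → k` and `a ∈ A`. If `a ∈ 𝔪` it is zero,
and a unit `a` contradicts the nonvanishing of the iterated class composed with `A → k`. -/
theorem IsMinSyzygy.smul_top_le [IsNoetherianRing A] {rs : List A}
    (hrs : ∀ r ∈ rs, r ∈ maximalIdeal A) (hA : IsWeaklyRegular (ModuleCat.of A A) rs)
    (hsq : maximalIdeal A ^ 2 ≤ Ideal.ofList rs) (hind : IndepSeq (maximalIdeal A ^ 2) rs)
    {P : ModuleCat.{u} A} (hP : IsMinSyzygy A rs.length P) :
    maximalIdeal A • (⊤ : Submodule A P) ≤ Ideal.ofList rs • ⊤ := by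
  obtain ⟨d, hd⟩ : ∃ d, rs.length = d := ⟨_, rfl⟩
  rw [hd] at hP
  rcases d with _ | d
  · obtain ⟨e⟩ := hP
    rw [Submodule.smul_le]
    intro a ha x _
    have : x = e.hom (e.inv x) := congr($(e.inv_hom_id) x).symm
    rw [this, ← map_smul, smul_resMod ha, map_zero]
    exact zero_mem _
  obtain ⟨P', m, i, p, hP', hi, hip, hp, hmin⟩ := hP
  obtain ⟨η, hη⟩ := hP'.exists_isSyzygyClass
  have hS := shortExact_of_linearMaps hi hip hp
  set θ := koszulClass rs (ModuleCat.of A A) hA with hθ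
  obtain ⟨π, ε, hπ, hε⟩ := exists_koszulClass_comp_resMod rs hrs le_rfl hind
    (𝟙 (ModuleCat.of A A)) Function.surjective_id (fun a ha => by
      have : a = 0 := ha
      rw [this]
      exact zero_mem _) hA (resProj A) (Category.id_comp _)
  rw [Submodule.smul_le]
  intro b hb x _
  apply mem_smul_top_of_koszulClass_comp_toSpanSingleton hA
  -- Minimality gives `i x ∈ 𝔪F`, so `i (b • x) ∈ 𝔪²F`, and `𝔪²` lies in the ideal of the sequence.
  have hFx : i (b • x) ∈ Ideal.ofList rs • (⊤ : Submodule A (Fin m → A)) := by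
    refine Submodule.smul_mono_left hsq ?_
    rw [pow_two, Submodule.mul_smul, map_smul]
    exact Submodule.smul_mem_smul hb (hmin ⟨x, rfl⟩)
  have hspan : ModuleCat.ofHom (LinearMap.toSpanSingleton A P (b • x)) ≫ ModuleCat.ofHom i =
      ModuleCat.ofHom (LinearMap.toSpanSingleton A (Fin m → A) (i (b • x))) := by
    apply hom_self_ext
    exact i.map_smul 1 (b • x)
  set f := ModuleCat.ofHom (LinearMap.toSpanSingleton A P (b • x)) with hf
  have h0 : (θ.comp (Ext.mk₀ f) (add_zero _)).comp (Ext.mk₀ (ModuleCat.ofHom i)) (add_zero _) =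
      0 := by
    rw [Ext.comp_assoc_of_third_deg_zero, Ext.mk₀_comp_mk₀, hspan]
    exact koszulClass_comp_toSpanSingleton (N := ModuleCat.of A (Fin m → A)) hA hFx
  obtain ⟨v, hv⟩ := Ext.covariant_sequence_exact₁ _ hS _ h0 hd.symm
  have hfin : Module.Finite A (quotSeq rs (ModuleCat.of A A)) :=
    Module.Finite.of_surjective (quotSeqProj rs (ModuleCat.of A A)).hom
      (quotSeqProj_surjective rs _)
  -- `Ext` from `A/(rs)` to `A` vanishes below degree `d + 1`, the length of the sequence, which is
  -- what descending the resolution to `k` requires.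
  obtain ⟨w, hw⟩ := hη.exists_eq_comp (quotSeq rs (ModuleCat.of A A)) (fun j hj =>
    subsingleton_ext_of_isWeaklyRegular hrs hA _ (support_quotSeq_subset hsq _) (by omega)) v
  obtain ⟨a, ha⟩ := resMod_hom_eq_smul (quotSeqProj rs (ModuleCat.of A A))
    (quotSeqProj_surjective rs _) π w hπ
  set η' := η.comp hS.extClass hd.symm with hη'def
  have hη'' : IsSyzygyClass (n := rs.length) (P := P) η' :=
    isSyzygyClass_succ_of_eq hd.symm hη hi hip hp
  have hθf : θ.comp (Ext.mk₀ f) (add_zero _) = a • (Ext.mk₀ π).comp η' (zero_add _) := by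
    rw [← hv, ← hw, Ext.comp_assoc _ _ _ (zero_add d) hd.symm (by omega), ha, Ext.mk₀_smul,
      Ext.smul_comp]
  by_cases ham : a ∈ maximalIdeal A
  · rw [hθf, ← Ext.smul_comp, ← Ext.mk₀_smul, ← Category.comp_id π, ← Linear.comp_smul,
      smul_id_resMod ham, comp_zero, Ext.mk₀_zero, Ext.zero_comp]
  exfalso
  -- Write `ε = η' g` with `g : P → k`. Then `θ` composed with `A → k` is `π η' g = a⁻¹ θ f g`, and
  -- `f g = 0` because `b` kills `k`.
  obtain ⟨c, rfl⟩ : IsUnit a := by simpa [mem_maximalIdeal] using ham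
  obtain ⟨z, hz⟩ := hη''.exists_comp (resMod A) 0 _ (add_zero _) ε
  obtain ⟨g, rfl⟩ := (Ext.mk₀_bijective _ _).2 z
  have hfg : f ≫ g = 0 := by
    apply hom_self_ext
    change g ((1 : A) • b • x) = 0
    rw [one_smul, map_smul]
    exact smul_resMod hb _
  refine koszulClass_comp_ne_zero hrs hA ?_
  rw [hε, ← hz, ← Ext.comp_assoc_of_third_deg_zero]
  have h2 : (Ext.mk₀ π).comp η' (zero_add _) = ((c⁻¹ : Aˣ) : A) • θ.comp (Ext.mk₀ f) (add_zero _) := by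
    rw [hθf, smul_smul, Units.inv_mul, one_smul]
  rw [h2, Ext.smul_comp, Ext.comp_assoc_of_third_deg_zero, Ext.mk₀_comp_mk₀, hfg, Ext.mk₀_zero,
    Ext.comp_zero, smul_zero]

end MinimalSyzygy

/-! ### Superficial elements -/

section Superficial

open Pointwise Polynomial

section Avoidance

variable {A : Type u} [CommRing A] [IsLocalRing A]

/-- Avoidance for arbitrary ideals, prime or not: on the line `x + a y` each ideal of the family is
met for at most one residue class of `a`, and the residue field is infinite. -/
theorem exists_mem_forall_notMem [Infinite (ResidueField A)] {I : Ideal A} {F : Set (Ideal A)}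
    (hF : F.Finite) (h : ∀ J ∈ F, ¬ I ≤ J) : ∃ x ∈ I, ∀ J ∈ F, x ∉ J := by
  induction F, hF using Set.Finite.induction_on with
  | empty => exact ⟨0, zero_mem _, by simp⟩
  | @insert J F _ hF ih =>
    obtain ⟨x, hxI, hx⟩ := ih (fun J hJ => h J (Set.mem_insert_of_mem _ hJ))
    obtain ⟨y, hyI, hy⟩ := SetLike.not_le_iff_exists.mp (h J (Set.mem_insert _ _))
    let bad : Ideal A → Set (ResidueField A) := fun K => {c | ∃ a, residue A a = c ∧ x + a * y ∈ K}
    have hbad : ∀ K ∈ insert J F, (bad K).Subsingleton := by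
      rintro K hK _ ⟨a, rfl, ha⟩ _ ⟨b, rfl, hb⟩
      by_contra hne
      have hu : IsUnit (a - b) := by
        rw [← residue_ne_zero_iff_isUnit, map_sub, sub_ne_zero]
        exact hne
      have hyK : y ∈ K := by
        rw [← Ideal.unit_mul_mem_iff_mem K hu]
        convert K.sub_mem ha hb using 1
        ring
      rcases hK with rfl | hK
      · exact hy hyK
      · exact hx K hK ((Ideal.add_mem_iff_left K (K.mul_mem_left a hyK)).mp ha)
    have hfin : (⋃ K ∈ insert J F, bad K).Finite :=
      (hF.insert J).biUnion fun K hK => (hbad K hK).finite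
    obtain ⟨c, hc⟩ := hfin.exists_notMem
    obtain ⟨a, rfl⟩ := residue_surjective (R := A) c
    refine ⟨x + a * y, I.add_mem hxI (I.mul_mem_left a hyI), fun K hK hmem => hc ?_⟩
    exact Set.mem_biUnion hK ⟨a, rfl, hmem⟩

end Avoidance

/-! ### Superficial elements through the Rees algebra -/

variable {A : Type u} [CommRing A] [IsNoetherianRing A] (I : Ideal A)

/-- The degree one element of the Rees algebra attached to an element of `I`. -/
noncomputable def reesAlgebra.degreeOne (x : I) : reesAlgebra I :=
  ⟨monomial 1 (x : A), reesAlgebra.monomial_mem.mpr (by simp)⟩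

/-- The ideal of elements of `I` whose degree one class lies in an ideal of the Rees algebra. -/
noncomputable def reesAlgebra.degreeOneComap (q : Ideal (reesAlgebra I)) : Ideal A where
  carrier := {x | ∃ h : x ∈ I, reesAlgebra.degreeOne I ⟨x, h⟩ ∈ q}
  add_mem' := by
    rintro x y ⟨hx, hx'⟩ ⟨hy, hy'⟩
    refine ⟨I.add_mem hx hy, ?_⟩
    convert q.add_mem hx' hy' using 1
    exact Subtype.ext ((monomial 1).map_add x y)
  zero_mem' := by
    refine ⟨I.zero_mem, ?_⟩
    convert q.zero_mem using 1
    exact Subtype.ext (monomial_zero_right 1)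
  smul_mem' := by
    rintro a x ⟨hx, hx'⟩
    refine ⟨I.mul_mem_left a hx, ?_⟩
    convert q.mul_mem_left (algebraMap A (reesAlgebra I) a) hx' using 1
    refine Subtype.ext ?_
    change monomial 1 (a * x) = C a * monomial 1 x
    rw [C_mul_monomial]

theorem reesAlgebra.monomial_mem_span_pow {a : A} {c : ℕ} (ha : a ∈ I ^ c) :
    (⟨monomial c a, reesAlgebra.monomial_mem.mpr ha⟩ : reesAlgebra I) ∈
      Ideal.span (Set.range (reesAlgebra.degreeOne I)) ^ c := by
  induction c generalizing a with
  | zero => simp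
  | succ c ih =>
    suffices h : ∀ b ∈ I ^ c * I, ∃ h : b ∈ I ^ (c + 1),
        (⟨monomial (c + 1) b, reesAlgebra.monomial_mem.mpr h⟩ : reesAlgebra I) ∈
          Ideal.span (Set.range (reesAlgebra.degreeOne I)) ^ (c + 1) by
      obtain ⟨_, h⟩ := h a (by rwa [← pow_succ])
      exact h
    intro b hb
    induction hb using Submodule.mul_induction_on' with
    | mem_mul_mem b hb x hx =>
      refine ⟨pow_succ I c ▸ Ideal.mul_mem_mul hb hx, ?_⟩
      rw [pow_succ (Ideal.span _)]
      convert Ideal.mul_mem_mul (ih hb) (Ideal.subset_span (Set.mem_range_self (⟨x, hx⟩ : I))) using 1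
      refine Subtype.ext ?_
      change monomial (c + 1) (b * x) = monomial c b * monomial 1 x
      rw [monomial_mul_monomial]
    | add x _ y _ hx hy =>
      obtain ⟨hx, hx'⟩ := hx
      obtain ⟨hy, hy'⟩ := hy
      refine ⟨Ideal.add_mem _ hx hy, ?_⟩
      convert Ideal.add_mem _ hx' hy' using 1
      exact Subtype.ext ((monomial _).map_add x y)

/-- A minimal prime over the annihilator of the kernel of `x` is an associated prime of `G`
containing `x`, hence contains `J`. So `J` lies in the radical of that annihilator. -/
theorem exists_finite_forall_isAssociatedPrime {B : Type*} [CommRing B] [IsNoetherianRing B]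
    {G : Type*} [AddCommGroup G] [Module B G] [Module.Finite B G] {J : Ideal B} {x : B}
    (h : ∀ p ∈ associatedPrimes B G, x ∈ p → J ≤ p) :
    ∃ c : ℕ, ∀ g : G, x • g = 0 → ∀ b ∈ J ^ c, b • g = 0 := by
  let K := LinearMap.ker (LinearMap.lsmul B G x)
  have hK : J ≤ (Module.annihilator B K).radical := by
    rw [← Ideal.sInf_minimalPrimes]
    refine le_sInf fun p hp => ?_
    have hp' := Module.associatedPrimes.minimalPrimes_annihilator_subset_associatedPrimes B K hp
    refine h p (associatedPrimes.subset_of_injective K.injective_subtype hp') (hp.1.2 ?_)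
    rw [Module.mem_annihilator]
    exact fun g => Subtype.ext g.2
  obtain ⟨c, hc⟩ := Ideal.exists_pow_le_of_le_radical_of_fg_radical hK (IsNoetherian.noetherian _)
  refine ⟨c, fun g hg b hb => ?_⟩
  exact congrArg Subtype.val (Module.mem_annihilator.mp (hc hb) (⟨g, hg⟩ : K))

variable (M : Type u) [AddCommGroup M] [Module A M] [Module.Finite A M]

/-- The filtration of the elements `z ∈ I ^ j M` such that `x z ∈ I ^ (j + 2) M`. -/
noncomputable def degreeOneKernelFiltration (x : A) : I.Filtration M where
  N j := I ^ j • ⊤ ⊓ (I ^ (j + 2) • ⊤ : Submodule A M).comap (LinearMap.lsmul A M x)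
  mono j := inf_le_inf (Submodule.smul_mono_left (Ideal.pow_le_pow_right j.le_succ))
    (Submodule.comap_mono (Submodule.smul_mono_left (Ideal.pow_le_pow_right (by omega))))
  smul_le j := by
    rw [Submodule.smul_le]
    intro a ha z hz
    refine ⟨?_, ?_⟩
    · rw [pow_succ', Submodule.mul_smul]
      exact Submodule.smul_mem_smul ha hz.1
    · rw [show j + 1 + 2 = (j + 2) + 1 by omega, pow_succ', Submodule.mul_smul]
      change x • a • z ∈ I • I ^ (j + 2) • (⊤ : Submodule A M)
      rw [smul_comm x a z]
      exact Submodule.smul_mem_smul ha hz.2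

/-- The ideals to avoid are the degree-one traces of the associated primes of the associated graded
module that do not contain the ideal generated in degree one. Off these, the kernel of `x` on the
graded module is killed by `I^c`. That kernel comes from a stable filtration, so in high degree it
is `I^c` times an earlier piece and vanishes. -/
theorem exists_finite_superficial : ∃ F : Set (Ideal A), F.Finite ∧ (∀ J ∈ F, ¬ I ≤ J) ∧
    ∀ x ∈ I, (∀ J ∈ F, x ∉ J) → ∃ c, ∀ j ≥ c, ∀ z ∈ (I ^ j • ⊤ : Submodule A M),
      x • z ∈ (I ^ (j + 2) • ⊤ : Submodule A M) → z ∈ (I ^ (j + 1) • ⊤ : Submodule A M) := by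
  let N := (I.stableFiltration (⊤ : Submodule A M)).submodule
  let N' := (I.stableFiltration (I • ⊤ : Submodule A M)).submodule
  have hN : N.FG := by
    refine (Ideal.Filtration.submodule_fg_iff_stable _ (fun i => IsNoetherian.noetherian _)).mpr ?_
    exact Ideal.stableFiltration_stable I ⊤
  -- The associated graded module, realised as the sum of all `I^j M` modulo the sum of all `I^(j+1)
  -- M`.
  let G := N.map N'.mkQ
  have : Module.Finite (reesAlgebra I) G := Module.Finite.iff_fg.mpr (hN.map _)
  let J := Ideal.span (Set.range (reesAlgebra.degreeOne I))
  refine ⟨reesAlgebra.degreeOneComap I '' {p ∈ associatedPrimes (reesAlgebra I) G | ¬ J ≤ p},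
    ((associatedPrimes.finite _ _).subset (Set.sep_subset _ _)).image _, ?_, ?_⟩
  · rintro _ ⟨p, ⟨-, hp⟩, rfl⟩ hle
    refine hp (Ideal.span_le.mpr ?_)
    rintro _ ⟨x, rfl⟩
    exact (hle x.2).2
  intro x hxI hx
  obtain ⟨c, hc⟩ := exists_finite_forall_isAssociatedPrime (B := reesAlgebra I) (G := G) (J := J)
    (x := reesAlgebra.degreeOne I ⟨x, hxI⟩) (by
      intro p hp hxp
      by_contra hJ
      exact hx _ ⟨p, ⟨hp, hJ⟩, rfl⟩ ⟨hxI, hxp⟩)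
  have key : ∀ j, ∀ z ∈ (degreeOneKernelFiltration I M x).N j, ∀ a ∈ I ^ c,
      a • z ∈ (I ^ (j + c + 1) • ⊤ : Submodule A M) := by
    rintro j z ⟨hz, hxz⟩ a ha
    have hzN : PolynomialModule.single A j z ∈ N := by
      intro i
      rw [PolynomialModule.coeff_single, Finsupp.single_apply]
      split_ifs with h
      · exact h ▸ hz
      · exact zero_mem _
    have h1 := hc ⟨N'.mkQ (PolynomialModule.single A j z), ⟨_, hzN, rfl⟩⟩ (by
      refine Subtype.ext ?_
      change N'.mkQ (monomial 1 x • PolynomialModule.single A j z) = 0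
      rw [PolynomialModule.monomial_smul_single, Submodule.mkQ_apply,
        Submodule.Quotient.mk_eq_zero]
      intro i
      rw [PolynomialModule.coeff_single, Finsupp.single_apply]
      split_ifs with h
      · subst h
        change _ ∈ I ^ (1 + j) • I • (⊤ : Submodule A M)
        rw [← Submodule.mul_smul, ← pow_succ, show 1 + j + 1 = j + 2 by omega]
        exact hxz
      · exact zero_mem _) _ (reesAlgebra.monomial_mem_span_pow I ha)
    have h2 : N'.mkQ (monomial c a • PolynomialModule.single A j z) = 0 := congrArg Subtype.val h1
    rw [PolynomialModule.monomial_smul_single, Submodule.mkQ_apply,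
      Submodule.Quotient.mk_eq_zero] at h2
    have h3 := h2 (c + j)
    rw [PolynomialModule.coeff_single, Finsupp.single_eq_same] at h3
    change _ ∈ I ^ (c + j) • I • (⊤ : Submodule A M) at h3
    rwa [← Submodule.mul_smul, ← pow_succ, show c + j + 1 = j + c + 1 by omega] at h3
  have hstable : (degreeOneKernelFiltration I M x).Stable := by
    refine Ideal.Filtration.Stable.of_le (Ideal.stableFiltration_stable I (⊤ : Submodule A M))
      (fun i => ?_)
    exact inf_le_left
  obtain ⟨n₀, hn₀⟩ := hstable.exists_pow_smul_eq_of_ge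
  refine ⟨n₀ + c, fun j hj z hz hxz => ?_⟩
  have hz' : z ∈ (degreeOneKernelFiltration I M x).N j := ⟨hz, hxz⟩
  obtain ⟨i, rfl⟩ : ∃ i, j = i + c := ⟨j - c, by omega⟩
  have h4 : (degreeOneKernelFiltration I M x).N (i + c) =
      I ^ c • (degreeOneKernelFiltration I M x).N i := by
    rw [hn₀ (i + c) (by omega), hn₀ i (by omega), ← Submodule.mul_smul, ← pow_add]
    congr 2
    omega
  rw [h4] at hz'
  exact Submodule.smul_le.mpr (fun a ha w hw => key i w hw a ha) hz'

/-- Artin–Rees on `xM` and regularity of `x` put `z` in `I^c M`; superficiality then raises the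
exponent one step at a time. -/
theorem exists_forall_mem_of_smul_mem {x : A} (hx : IsSMulRegular M x) {c : ℕ}
    (hc : ∀ j ≥ c, ∀ z ∈ (I ^ j • ⊤ : Submodule A M),
      x • z ∈ (I ^ (j + 2) • ⊤ : Submodule A M) → z ∈ (I ^ (j + 1) • ⊤ : Submodule A M)) :
    ∃ c, ∀ j ≥ c, ∀ z : M, x • z ∈ (I ^ (j + 1) • ⊤ : Submodule A M) →
      z ∈ (I ^ j • ⊤ : Submodule A M) := by
  obtain ⟨k, hk⟩ := Ideal.exists_pow_inf_eq_pow_smul I (LinearMap.range (LinearMap.lsmul A M x))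
  refine ⟨c + k, fun j hj z hz => ?_⟩
  have h1 : ∀ i, c + i ≤ j → z ∈ (I ^ (c + i) • ⊤ : Submodule A M) := by
    intro i
    induction i with
    | zero =>
      intro _
      have h2 : x • z ∈ (I ^ (c + k) • ⊤ ⊓ LinearMap.range (LinearMap.lsmul A M x) :
          Submodule A M) :=
        ⟨Submodule.smul_mono_left (Ideal.pow_le_pow_right (by omega)) hz, ⟨z, rfl⟩⟩
      rw [hk (c + k) (by omega), Nat.add_sub_cancel] at h2
      have h3 := Submodule.smul_mono le_rfl inf_le_right h2
      rw [← Submodule.map_top, ← Submodule.map_smul''] at h3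
      obtain ⟨w, hw, hwz⟩ := h3
      have : w = z := hx hwz
      rw [← this]
      exact hw
    | succ i ih =>
      intro hi
      exact hc (c + i) (by omega) z (ih (by omega))
        (Submodule.smul_mono_left (Ideal.pow_le_pow_right (by omega)) hz)
  have := h1 (j - c) (by omega)
  rwa [show c + (j - c) = j by omega] at this

end Superficial

/-! ### Growth of Hilbert--Samuel functions -/

section Growth

open RingTheory.Sequence Pointwise Filter Asymptotics

theorem tendsto_choose_add_atTop (d : ℕ) :
    Tendsto (fun n : ℕ => ((n + (d + 1)).choose (d + 1) : ℝ)) atTop atTop := by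
  refine tendsto_natCast_atTop_atTop.comp (tendsto_atTop_mono (fun n => ?_) tendsto_id)
  rw [← Nat.choose_symm_add]
  rcases n with _ | n
  · simp
  · calc n + 1 ≤ ((n + 1) + 1).choose (n + 1) := by simp
      _ ≤ ((n + 1) + (d + 1)).choose (n + 1) := Nat.choose_le_choose _ (by omega)

/-- Growth is measured against `(n+d).choose d`, whose differences are exact by Pascal's rule; being
asymptotic to `n^d / d!`, it recovers the normalisation of the multiplicity. -/
theorem tendsto_of_isLittleO_choose {d : ℕ} {h : ℕ → ℝ} {l : ℝ}
    (hh : (fun n : ℕ => h n - l * ((n + d).choose d : ℝ)) =o[atTop]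
      (fun n : ℕ => ((n + d).choose d : ℝ))) :
    Tendsto (fun n : ℕ => (d.factorial : ℝ) * h n / (n : ℝ) ^ d) atTop (nhds l) := by
  have hpos : ∀ n : ℕ, ((n + d).choose d : ℝ) ≠ 0 := fun n => by
    exact_mod_cast (Nat.choose_pos (by omega)).ne'
  have h1 : Tendsto (fun n : ℕ => h n / ((n + d).choose d : ℝ)) atTop (nhds l) := by
    have h2 := hh.tendsto_div_nhds_zero.add_const l
    rw [zero_add] at h2
    refine h2.congr fun n => ?_
    have := hpos n
    field_simp
    ring
  have h3 : Tendsto (fun n : ℕ => (d.factorial : ℝ) * ((n + d).choose d : ℝ) / (n : ℝ) ^ d) atTop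
      (nhds 1) := by
    have h4 := (isEquivalent_choose d).comp_tendsto (tendsto_add_atTop_nat d)
    have h5 : (fun n : ℕ => (((n + d : ℕ) : ℝ) ^ d / d.factorial)) ~[atTop]
        (fun n : ℕ => ((n : ℝ) ^ d / d.factorial)) := by
      refine IsEquivalent.div (IsEquivalent.pow ?_ d) IsEquivalent.refl
      rw [isEquivalent_iff_exists_eq_mul]
      refine ⟨fun n : ℕ => 1 + d / (n : ℝ), ?_, ?_⟩
      · have := tendsto_const_div_atTop_nhds_zero_nat (d : ℝ)
        simpa using this.const_add 1
      · filter_upwards [eventually_gt_atTop 0] with n hn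
        have : (n : ℝ) ≠ 0 := by exact_mod_cast hn.ne'
        change ((n + d : ℕ) : ℝ) = (1 + d / (n : ℝ)) * n
        push_cast
        field_simp
    have h6 := h4.trans h5
    rw [isEquivalent_iff_tendsto_one] at h6
    · refine h6.congr fun n => ?_
      change ((n + d).choose d : ℝ) / ((n : ℝ) ^ d / d.factorial) = _
      rw [div_div_eq_mul_div, mul_comm]
    · filter_upwards [eventually_gt_atTop 0] with n hn
      have : (n : ℝ) ≠ 0 := by exact_mod_cast hn.ne'
      positivity
  have h7 := h1.mul h3
  rw [mul_one] at h7
  refine h7.congr fun n => ?_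
  have := hpos n
  field_simp

/-- A discrete l'Hôpital rule: little-o estimates for differences can be summed because the
comparison series diverges. -/
theorem isLittleO_choose_succ {d : ℕ} {h g : ℕ → ℝ} {l : ℝ}
    (hhg : ∀ᶠ n in atTop, h (n + 1) = h n + g (n + 1))
    (hg : (fun n : ℕ => g n - l * ((n + d).choose d : ℝ)) =o[atTop]
      (fun n : ℕ => ((n + d).choose d : ℝ))) :
    (fun n : ℕ => h n - l * ((n + (d + 1)).choose (d + 1) : ℝ)) =o[atTop]
      (fun n : ℕ => ((n + (d + 1)).choose (d + 1) : ℝ)) := by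
  let C : ℕ → ℝ := fun n => ((n + (d + 1)).choose (d + 1) : ℝ)
  let D : ℕ → ℝ := fun n => ((n + d).choose d : ℝ)
  have hC : Tendsto C atTop atTop := tendsto_choose_add_atTop d
  have hCD : ∀ n, C (n + 1) - C n = D (n + 1) := by
    intro n
    have : (n + 1 + (d + 1)).choose (d + 1) =
        (n + 1 + d).choose d + (n + (d + 1)).choose (d + 1) := by
      rw [show n + 1 + (d + 1) = (n + 1 + d) + 1 by ring, Nat.choose_succ_succ,
        show n + 1 + d = n + (d + 1) by ring]
    simp only [C, D, this]
    push_cast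
    ring
  have hsumD : ∀ n, ∑ i ∈ Finset.range n, D (i + 1) = C n - C 0 := fun n => by
    rw [← Finset.sum_range_sub]
    exact Finset.sum_congr rfl fun i _ => (hCD i).symm
  let f : ℕ → ℝ := fun n => h n - l * C n
  have h1 : (fun n => f (n + 1) - f n) =o[atTop] (fun n => D (n + 1)) := by
    refine (hg.comp_tendsto (tendsto_add_atTop_nat 1)).congr' ?_ EventuallyEq.rfl
    filter_upwards [hhg] with n hn
    simp only [Function.comp_apply, f, hn]
    have := hCD n
    simp only [D] at this
    rw [← this]
    ring
  have h2 := h1.sum_range (fun n => by positivity) (by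
    simp only [hsumD]
    exact tendsto_atTop_add_const_right _ _ hC)
  simp only [hsumD, Finset.sum_range_sub] at h2
  have hconst : ∀ c : ℝ, (fun _ : ℕ => c) =o[atTop] C := fun c =>
    isLittleO_const_left.mpr (Or.inr (tendsto_norm_atTop_atTop.comp hC))
  have h3 : (fun n => C n - C 0) =O[atTop] C := (isBigO_refl C atTop).sub (hconst _).isBigO
  refine ((h2.trans_isBigO h3).add (hconst (f 0))).congr_left fun n => ?_
  simp only [f, C]
  ring

variable {A : Type u} [CommRing A] [IsLocalRing A] [IsNoetherianRing A]

theorem length_ne_top_of_pow_smul_eq_zero {n : ℕ} {M : Type v} [AddCommGroup M] [Module A M]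
    [Module.Finite A M] (h : ∀ a ∈ maximalIdeal A ^ n, ∀ x : M, a • x = 0) :
    Module.length A M ≠ ⊤ := by
  induction n generalizing M with
  | zero =>
    have : Subsingleton M := ⟨fun x y => by
      rw [← one_smul A x, ← one_smul A y, h 1 (by simp) x, h 1 (by simp) y]⟩
    rw [Module.length_eq_zero_iff.mpr this]
    exact ENat.zero_ne_top
  | succ n ih =>
    let p : Submodule A M := maximalIdeal A • ⊤
    rw [Module.length_eq_add_of_exact p.subtype p.mkQ Subtype.val_injective
      (Submodule.mkQ_surjective _) (LinearMap.exact_subtype_mkQ _),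
      length_quotient_maximalIdeal_smul]
    refine WithTop.add_ne_top.mpr ⟨ih fun a ha x => Subtype.ext ?_, ENat.natCast_ne_top _⟩
    obtain ⟨x, hx⟩ := x
    change a • x = 0
    induction hx using Submodule.smul_induction_on' with
    | smul b hb y _ =>
      rw [smul_smul]
      exact h _ (pow_succ (maximalIdeal A) n ▸ Ideal.mul_mem_mul ha hb) y
    | add x _ y _ hx hy => rw [smul_add, hx, hy, add_zero]

/-- The Hilbert--Samuel function `n ↦ length (M / 𝔪 ^ n M)`. -/
noncomputable def hilbertSamuel (A : Type u) [CommRing A] [IsLocalRing A] (M : Type v)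
    [AddCommGroup M] [Module A M] (n : ℕ) : ℕ∞ :=
  Module.length A (M ⧸ (maximalIdeal A ^ n • ⊤ : Submodule A M))

theorem hilbertSamuel_ne_top (M : Type v) [AddCommGroup M] [Module A M] [Module.Finite A M]
    (n : ℕ) : hilbertSamuel A M n ≠ ⊤ := by
  refine length_ne_top_of_pow_smul_eq_zero (n := n) fun a ha x => ?_
  obtain ⟨x, rfl⟩ := Submodule.mkQ_surjective _ x
  rw [← map_smul, Submodule.mkQ_apply, Submodule.Quotient.mk_eq_zero]
  exact Submodule.smul_mem_smul ha trivial

/-- The hypothesis says that multiplication by `x` from `M/𝔪^n M` to `M/𝔪^(n+1) M` is injective; its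
cokernel is the corresponding quotient of `M/xM`. -/
theorem hilbertSamuel_quotOne {x : A} (hx : x ∈ maximalIdeal A) (M : ModuleCat.{u} A) {n : ℕ}
    (h : ∀ z : M, x • z ∈ (maximalIdeal A ^ (n + 1) • ⊤ : Submodule A M) →
      z ∈ (maximalIdeal A ^ n • ⊤ : Submodule A M)) :
    hilbertSamuel A M (n + 1) = hilbertSamuel A M n + hilbertSamuel A (quotOne x M) (n + 1) := by
  let p : Submodule A M := maximalIdeal A ^ n • ⊤
  let q : Submodule A M := maximalIdeal A ^ (n + 1) • ⊤
  let q' : Submodule A (quotOne x M) := maximalIdeal A ^ (n + 1) • ⊤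
  have hpq : p ≤ q.comap (LinearMap.lsmul A M x) := by
    rw [← Submodule.map_le_iff_le_comap, Submodule.map_smul'']
    simp only [q, pow_succ, Submodule.mul_smul]
    refine Submodule.smul_mono le_rfl ?_
    rw [Submodule.map_le_iff_le_comap]
    exact fun z _ => Submodule.smul_mem_smul hx trivial
  have hqq : q.map (quotOneProj x M).hom = q' := by
    rw [Submodule.map_smul'', Submodule.map_top, LinearMap.range_eq_top.mpr
      (quotOneProj_surjective x M)]
  refine Module.length_eq_add_of_exact (p.mapQ q (LinearMap.lsmul A M x) hpq)
    (q.mapQ q' (quotOneProj x M).hom (Submodule.map_le_iff_le_comap.mp hqq.le)) ?_ ?_ ?_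
  · rw [← LinearMap.ker_eq_bot, Submodule.ker_mapQ, ← le_bot_iff, Submodule.map_le_iff_le_comap,
      Submodule.comap_bot, Submodule.ker_mkQ]
    exact fun z hz => h z hz
  · intro y
    obtain ⟨y, rfl⟩ := Submodule.mkQ_surjective _ y
    obtain ⟨y, rfl⟩ := quotOneProj_surjective x M y
    exact ⟨q.mkQ y, rfl⟩
  · intro y
    obtain ⟨y, rfl⟩ := Submodule.mkQ_surjective _ y
    constructor
    · intro hy
      rw [Submodule.mkQ_apply, Submodule.mapQ_apply, Submodule.Quotient.mk_eq_zero, ← hqq] at hy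
      obtain ⟨w, hw, hwy⟩ := hy
      have h1 : y - w ∈ x • (⊤ : Submodule A M) := by
        rw [← Submodule.Quotient.mk_eq_zero]
        change (quotOneProj x M).hom (y - w) = 0
        rw [map_sub, hwy, sub_self]
      obtain ⟨z, -, hz⟩ := (Submodule.mem_smul_pointwise_iff_exists _ _ _).mp h1
      refine ⟨p.mkQ z, ?_⟩
      rw [Submodule.mkQ_apply, Submodule.mapQ_apply, Submodule.mkQ_apply,
        Submodule.Quotient.eq]
      change x • z - y ∈ q
      rw [hz, sub_sub_cancel_left]
      exact q.neg_mem hw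
    · rintro ⟨z, hz⟩
      obtain ⟨z, rfl⟩ := Submodule.mkQ_surjective _ z
      rw [← hz, Submodule.mkQ_apply, Submodule.mapQ_apply, Submodule.mapQ_apply]
      have : (quotOneProj x M).hom (x • z) = 0 := by
        refine (Submodule.Quotient.mk_eq_zero (x • (⊤ : Submodule A M))).mpr ?_
        exact Submodule.smul_mem_pointwise_smul z x ⊤ trivial
      change Submodule.Quotient.mk ((quotOneProj x M).hom (x • z)) = 0
      rw [this, Submodule.Quotient.mk_zero]

/-- The Hilbert--Samuel functions of the successive quotients of `M` by the members of the list
differ as they do for a superficial sequence. -/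
def IsSuperficialSeq : List A → ModuleCat.{u} A → Prop
  | [], _ => True
  | x :: xs, M => (∀ᶠ n in atTop, hilbertSamuel A M (n + 1) =
      hilbertSamuel A M n + hilbertSamuel A (quotOne x M) (n + 1)) ∧
      IsSuperficialSeq xs (quotOne x M)

/-- Each element replaces the Hilbert–Samuel function by its difference. After the last one the
function is eventually constant, equal to the length of the full quotient, which is therefore the
leading coefficient. -/
theorem IsSuperficialSeq.isLittleO {k : ℕ} {rs : List A} {M : ModuleCat.{u} A} [Module.Finite A M]
    (h : IsSuperficialSeq rs M) (hk : ∀ a ∈ maximalIdeal A ^ k, ∀ y : quotSeq rs M, a • y = 0) :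
    (fun n : ℕ => ((hilbertSamuel A M n).toNat : ℝ) -
      ((Module.length A (quotSeq rs M)).toNat : ℝ) * ((n + rs.length).choose rs.length : ℝ))
      =o[atTop] (fun n : ℕ => ((n + rs.length).choose rs.length : ℝ)) := by
  induction rs generalizing M with
  | nil =>
    refine (isLittleO_zero _ _).congr' ?_ EventuallyEq.rfl
    filter_upwards [eventually_ge_atTop k] with n hn
    have h0 : (maximalIdeal A ^ n • ⊤ : Submodule A M) = ⊥ := by
      rw [← le_bot_iff, Submodule.smul_le]
      intro a ha x _
      exact hk a (Ideal.pow_le_pow_right hn ha) x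
    have h1 : hilbertSamuel A M n = Module.length A M := by
      rw [hilbertSamuel]
      exact (Submodule.quotEquivOfEqBot _ h0).length_eq
    have h2 : Module.length A (quotSeq [] M) = Module.length A M := rfl
    simp [h1, h2]
  | cons x xs ih =>
    obtain ⟨h1, h2⟩ := h
    have hfin : Module.Finite A (quotOne x M) :=
      Module.Finite.of_surjective (quotOneProj x M).hom (quotOneProj_surjective x M)
    refine isLittleO_choose_succ (g := fun n => ((hilbertSamuel A (quotOne x M) n).toNat : ℝ)) ?_
      (ih h2 hk)
    filter_upwards [h1] with n hn
    rw [hn, ENat.toNat_add (hilbertSamuel_ne_top _ _) (hilbertSamuel_ne_top _ _), Nat.cast_add]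

theorem exists_superficialSeq [Infinite (ResidueField A)] {d : ℕ} (Ms : List (ModuleCat.{u} A))
    (hfin : ∀ M ∈ Ms, Module.Finite A M) (hM : ∀ M ∈ Ms, DepthGE A d M) :
    ∃ rs : List A, rs.length = d ∧ (∀ r ∈ rs, r ∈ maximalIdeal A) ∧
      ∀ M ∈ Ms, IsWeaklyRegular M rs ∧ IsSuperficialSeq rs M := by
  induction d generalizing Ms with
  | zero => exact ⟨[], rfl, by simp, fun M _ => ⟨IsWeaklyRegular.nil A M, trivial⟩⟩
  | succ d ih =>
    have h1 : ∀ M ∈ Ms, ∃ F : Set (Ideal A), F.Finite ∧ (∀ J ∈ F, ¬ maximalIdeal A ≤ J) ∧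
        ∀ x ∈ maximalIdeal A, (∀ J ∈ F, x ∉ J) → IsSMulRegular M x ∧
          ∀ᶠ n in atTop, hilbertSamuel A M (n + 1) =
            hilbertSamuel A M n + hilbertSamuel A (quotOne x M) (n + 1) := by
      intro M hMs
      have := hfin M hMs
      obtain ⟨F, hF, hF1, hF2⟩ := exists_finite_superficial (maximalIdeal A) M
      -- Avoiding the associated primes too makes `x` regular. None of them contains `𝔪`, since the
      -- depth is positive.
      refine ⟨F ∪ associatedPrimes A M, hF.union (associatedPrimes.finite A M), ?_, ?_⟩
      · rintro J (hJ | hJ) hle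
        · exact hF1 J hJ hle
        obtain ⟨rs, hlen, hrs, hreg⟩ := DepthGE.exists_isWeaklyRegular (hM M hMs)
        obtain ⟨r, rs, rfl⟩ := List.exists_cons_of_length_eq_add_one hlen
        rw [isWeaklyRegular_cons_iff] at hreg
        have h2 := biUnion_associatedPrimes_eq_zero_divisors A M
        have h3 : r ∈ ⋃ p ∈ associatedPrimes A M, (p : Set A) :=
          Set.mem_biUnion hJ (hle (hrs r (by simp)))
        rw [h2] at h3
        obtain ⟨z, hz, hz'⟩ := h3
        exact hz (hreg.1.right_eq_zero_of_smul hz')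
      · intro x hx hxF
        have hreg : IsSMulRegular M x := by
          rw [isSMulRegular_iff_right_eq_zero_of_smul]
          intro z hz
          by_contra hz0
          have h3 : x ∈ {r : A | ∃ x : M, x ≠ 0 ∧ r • x = 0} := ⟨z, hz0, hz⟩
          rw [← biUnion_associatedPrimes_eq_zero_divisors A M] at h3
          obtain ⟨p, hp, hxp⟩ := Set.mem_iUnion₂.mp h3
          exact hxF p (Or.inr hp) hxp
        refine ⟨hreg, ?_⟩
        obtain ⟨c, hc⟩ := hF2 x hx fun J hJ => hxF J (Or.inl hJ)
        obtain ⟨c, hc⟩ := exists_forall_mem_of_smul_mem (maximalIdeal A) M hreg hc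
        filter_upwards [eventually_ge_atTop c] with n hn
        exact hilbertSamuel_quotOne hx M (hc n hn)
    choose! F hF hF1 hF2 using h1
    -- The forbidden ideals of all modules in the list are united, so that one element serves them
    -- all.
    obtain ⟨x, hx, hxF⟩ := exists_mem_forall_notMem (I := maximalIdeal A)
      (F := ⋃ M ∈ {M | M ∈ Ms}, F M) (Ms.finite_toSet.biUnion hF) (by
        intro J hJ
        obtain ⟨M, hMs, hJ⟩ := Set.mem_iUnion₂.mp hJ
        exact hF1 M hMs J hJ)
    have hxF' : ∀ M ∈ Ms, ∀ J ∈ F M, x ∉ J := fun M hMs J hJ =>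
      hxF J (Set.mem_biUnion (show M ∈ {M | M ∈ Ms} from hMs) hJ)
    obtain ⟨rs, hlen, hrs, h⟩ := ih (Ms.map (quotOne x)) (by
        intro N hN
        obtain ⟨M, hMs, rfl⟩ := List.mem_map.mp hN
        have := hfin M hMs
        exact Module.Finite.of_surjective (quotOneProj x M).hom (quotOneProj_surjective x M)) (by
        intro N hN
        obtain ⟨M, hMs, rfl⟩ := List.mem_map.mp hN
        exact DepthGE.quotSMulTop (hF2 M hMs x hx (hxF' M hMs)).1 (hM M hMs))
    refine ⟨x :: rs, by rw [List.length_cons, hlen], ?_, fun M hMs => ⟨?_, ?_, ?_⟩⟩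
    · intro r hr
      rcases List.mem_cons.mp hr with rfl | hr
      · exact hx
      · exact hrs r hr
    · rw [isWeaklyRegular_cons_iff]
      exact ⟨(hF2 M hMs x hx (hxF' M hMs)).1, (h _ (List.mem_map_of_mem hMs)).1⟩
    · exact (hF2 M hMs x hx (hxF' M hMs)).2
    · exact (h _ (List.mem_map_of_mem hMs)).2

end Growth

/-! ### Flat extensions of local rings with infinite residue field -/

section FlatExtension

open RingTheory.Sequence Pointwise TensorProduct Polynomial

/-- A flat local extension of local rings such that the maximal ideal of the base generates the
maximal ideal. -/
class FlatLocalExtension (R : Type u) (S : Type v) [CommRing R] [CommRing S] [IsLocalRing R]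
    [IsLocalRing S] [Algebra R S] : Prop where
  flat : Module.Flat R S
  isLocalHom : IsLocalHom (algebraMap R S)
  map_maximalIdeal : (maximalIdeal R).map (algebraMap R S) = maximalIdeal S

attribute [instance] FlatLocalExtension.flat FlatLocalExtension.isLocalHom

/-- Localise `R[X]` at `𝔪R[X]`. The powers of `X` have distinct residues, so the residue field is
infinite even when `k` is finite. -/
theorem exists_flatLocalExtension (R : Type u) [CommRing R] [IsLocalRing R] [IsNoetherianRing R] :
    ∃ (S : Type u) (_ : CommRing S) (_ : IsLocalRing S) (_ : Algebra R S),
      IsNoetherianRing S ∧ FlatLocalExtension R S ∧ Infinite (ResidueField S) := by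
  let P : Ideal R[X] := (maximalIdeal R).map C
  have hP : P.IsPrime := Ideal.isPrime_map_C_of_isPrime
  let S := Localization.AtPrime P
  have hmap : (maximalIdeal R).map (algebraMap R S) = maximalIdeal S := by
    rw [← Localization.AtPrime.map_eq_maximalIdeal, IsScalarTower.algebraMap_eq R R[X] S,
      ← Ideal.map_map]
    rfl
  have hflat : Module.Flat R S := Module.Flat.trans R R[X] S
  have hlocal : IsLocalHom (algebraMap R S) := by
    refine ⟨fun a ha => ?_⟩
    by_contra hna
    have : algebraMap R S a ∈ maximalIdeal S := hmap ▸ Ideal.mem_map_of_mem _ hna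
    exact this ha
  refine ⟨S, inferInstance, inferInstance, inferInstance,
    IsLocalization.isNoetherianRing P.primeCompl S inferInstance, ⟨hflat, hlocal, hmap⟩, ?_⟩
  refine Infinite.of_injective
    (fun n : ℕ => residue S (algebraMap R[X] S (X ^ n))) fun m n hmn => ?_
  by_contra hne
  have h1 : algebraMap R[X] S (X ^ m - X ^ n) ∈ maximalIdeal S := by
    rw [← residue_eq_zero_iff, map_sub, map_sub, sub_eq_zero]
    exact hmn
  have h2 : (X ^ m - X ^ n : R[X]) ∈ P := by
    rwa [← Ideal.mem_comap, ← Ideal.under_def, Localization.AtPrime.under_maximalIdeal] at h1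
  rw [Ideal.mem_map_C_iff] at h2
  have h3 := h2 m
  rw [coeff_sub, coeff_X_pow_self, coeff_X_pow, if_neg hne, sub_zero] at h3
  exact (Ideal.ne_top_iff_one _).mp (Ideal.IsPrime.ne_top inferInstance) h3

variable {R S : Type u} [CommRing R] [CommRing S] [IsLocalRing R] [IsLocalRing S]
  [IsNoetherianRing R] [IsNoetherianRing S] [Algebra R S] [FlatLocalExtension R S]

instance : Module.FaithfullyFlat R S := Module.FaithfullyFlat.of_flat_of_isLocalHom

theorem length_tensorProduct (M : Type u) [AddCommGroup M] [Module R M] :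
    Module.length S (S ⊗[R] M) = Module.length R M := by
  have h : Module.length S (S ⧸ maximalIdeal S) = 1 :=
    Module.length_eq_one_iff.mpr (isSimpleModule_iff_isCoatom.mpr
      (Ideal.isMaximal_def.mp inferInstance))
  rw [IsLocalRing.length_baseChange R S M, FlatLocalExtension.map_maximalIdeal, h, mul_one]

theorem ker_lTensor_mkQ_smul_top (I : Ideal R) (M : Type u) [AddCommGroup M] [Module R M] :
    LinearMap.ker ((I • ⊤ : Submodule R M).mkQ.baseChange S) = I.map (algebraMap R S) • ⊤ := by
  set p : Submodule R M := I • ⊤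
  apply le_antisymm
  · have htmul : ∀ y ∈ p, ∀ s : S,
        s ⊗ₜ[R] y ∈ (I.map (algebraMap R S) • ⊤ : Submodule S (S ⊗[R] M)) := by
      intro y hy s
      induction hy using Submodule.smul_induction_on' with
      | smul a ha m _ =>
        rw [TensorProduct.tmul_smul, ← algebraMap_smul S a (s ⊗ₜ[R] m)]
        exact Submodule.smul_mem_smul (Ideal.mem_map_of_mem _ ha) trivial
      | add y _ z _ hy hz =>
        rw [TensorProduct.tmul_add]
        exact Submodule.add_mem _ hy hz
    intro x hx
    obtain ⟨y, rfl⟩ := (lTensor_exact S (LinearMap.exact_subtype_mkQ p)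
      (Submodule.mkQ_surjective p) x).mp hx
    clear hx
    induction y using TensorProduct.induction_on with
    | zero => simp
    | add y z hy hz =>
      rw [map_add]
      exact Submodule.add_mem _ hy hz
    | tmul s y => exact htmul y y.2 s
  · rw [Submodule.smul_le]
    intro a ha x _
    rw [LinearMap.mem_ker, map_smul]
    induction ha using Submodule.span_induction with
    | zero => rw [zero_smul]
    | add a b _ _ ha hb => rw [add_smul, ha, hb, add_zero]
    | smul b a _ ha => rw [smul_assoc, ha, smul_zero]
    | mem a ha =>
      obtain ⟨a, ha, rfl⟩ := ha
      rw [algebraMap_smul]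
      induction x using TensorProduct.induction_on with
      | zero => simp
      | add x y hx hy => rw [map_add, smul_add, hx trivial, hy trivial, add_zero]
      | tmul s m =>
        rw [LinearMap.baseChange_tmul, ← TensorProduct.tmul_smul, ← map_smul, Submodule.mkQ_apply,
          (Submodule.Quotient.mk_eq_zero p).mpr (Submodule.smul_mem_smul ha trivial),
          TensorProduct.tmul_zero]

theorem hilbertSamuel_tensorProduct (M : Type u) [AddCommGroup M] [Module R M] (n : ℕ) :
    hilbertSamuel S (S ⊗[R] M) n = hilbertSamuel R M n := by
  let f := (maximalIdeal R ^ n • ⊤ : Submodule R M).mkQ.baseChange S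
  have hf : Function.Surjective f := LinearMap.lTensor_surjective S (Submodule.mkQ_surjective _)
  have hker : LinearMap.ker f = maximalIdeal S ^ n • ⊤ := by
    rw [ker_lTensor_mkQ_smul_top, Ideal.map_pow, FlatLocalExtension.map_maximalIdeal]
  rw [hilbertSamuel, ← hker, (f.quotKerEquivOfSurjective hf).length_eq, length_tensorProduct]
  rfl

theorem hilbertSamuel_congr {A : Type u} [CommRing A] [IsLocalRing A] {M N : Type u}
    [AddCommGroup M] [Module A M] [AddCommGroup N] [Module A N] (e : M ≃ₗ[A] N) (n : ℕ) :
    hilbertSamuel A M n = hilbertSamuel A N n := by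
  refine (Submodule.Quotient.equiv _ _ e ?_).length_eq
  rw [Submodule.map_smul'', Submodule.map_top, LinearEquiv.range]

theorem hilbertSamuel_self (n : ℕ) : hilbertSamuel S S n = hilbertSamuel R R n := by
  rw [← hilbertSamuel_tensorProduct (S := S) R n]
  exact hilbertSamuel_congr (TensorProduct.AlgebraTensorModule.rid R S S).symm n

theorem DepthGE.tensorProduct {d : ℕ} {M : Type u} [AddCommGroup M] [Module R M] [Module.Finite R M]
    (h : DepthGE R d M) : DepthGE S d (S ⊗[R] M) := by
  obtain ⟨rs, hlen, hrs, hreg⟩ := h.exists_isWeaklyRegular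
  have h1 := hreg.of_flat_of_isBaseChange (TensorProduct.isBaseChange R M S)
  have h2 := depthGE_of_isWeaklyRegular (A := S) (by
    intro s hs
    obtain ⟨r, hr, rfl⟩ := List.mem_map.mp hs
    rw [← FlatLocalExtension.map_maximalIdeal (R := R)]
    exact Ideal.mem_map_of_mem _ (hrs r hr)) h1
  rwa [List.length_map, hlen] at h2

variable (R S) in
-- As `𝔪S` is the maximal ideal, the images of a system of parameters of `R` cut out only that
-- prime, and the height theorem bounds its height.
theorem ringKrullDim_le_of_flatLocalExtension {d : ℕ} (hd : ringKrullDim R = d) :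
    ringKrullDim S ≤ d := by
  rw [← IsLocalRing.maximalIdeal_height_eq_ringKrullDim] at hd ⊢
  have hd' : (maximalIdeal R).height = d := by exact_mod_cast hd
  obtain ⟨s, hs, hcard⟩ := Ideal.exists_finset_card_eq_height_of_isNoetherianRing (maximalIdeal R)
  rw [hd'] at hcard
  classical
  have hmin : maximalIdeal S ∈ (Ideal.span (s.image (algebraMap R S) : Set S)).minimalPrimes := by
    rw [Finset.coe_image, ← Ideal.map_span]
    refine ⟨⟨inferInstance, ?_⟩, fun q ⟨hq, hsq⟩ _ => ?_⟩
    · rw [← FlatLocalExtension.map_maximalIdeal (R := R)]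
      exact Ideal.map_mono hs.1.2
    · rw [← FlatLocalExtension.map_maximalIdeal (R := R), Ideal.map_le_iff_le_comap]
      exact hs.2 ⟨inferInstance, Ideal.map_le_iff_le_comap.mp hsq⟩
        (le_maximalIdeal (Ideal.IsPrime.ne_top inferInstance))
  have h1 := Ideal.height_le_card_of_mem_minimalPrimes_span_finset hmin
  have h2 : ((s.image (algebraMap R S)).card : ℕ∞) ≤ d := by
    rw [← hcard]
    exact_mod_cast Finset.card_image_le
  exact_mod_cast h1.trans h2

/-- Dividing by a regular sequence of length `d` leaves dimension zero, so the only prime over the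
sequence is the maximal ideal. -/
theorem exists_pow_le_ofList_of_ringKrullDim_le {d : ℕ} (hd : ringKrullDim S ≤ d) {rs : List S}
    (hlen : rs.length = d) (hrs : ∀ r ∈ rs, r ∈ maximalIdeal S) (hreg : IsWeaklyRegular S rs) :
    ∃ k, maximalIdeal S ^ k ≤ Ideal.ofList rs := by
  have hreg' := IsRegular.of_isWeaklyRegular_of_mem_maximalIdeal S hrs hreg
  have h1 := ringKrullDim_add_length_eq_ringKrullDim_of_isRegular rs hreg'
  have h0 : ringKrullDim (S ⧸ Ideal.ofList rs) ≤ 0 := by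
    rw [← h1, hlen] at hd
    generalize ringKrullDim (S ⧸ Ideal.ofList rs) = x at hd
    induction x with
    | bot => exact bot_le
    | coe x =>
      have h2 : x + d ≤ (d : ℕ∞) := by exact_mod_cast hd
      have h3 : x ≠ ⊤ := by
        rintro rfl
        rw [top_add] at h2
        exact absurd (top_le_iff.mp h2) (ENat.natCast_ne_top d)
      lift x to ℕ using h3
      have h4 : x + d ≤ d := by exact_mod_cast h2
      have h5 : x = 0 := by omega
      rw [h5]
      rfl
  have hdim : Ring.KrullDimLE 0 (S ⧸ Ideal.ofList rs) :=
    (Ring.krullDimLE_iff (n := 0)).mpr (by exact_mod_cast h0)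
  refine Ideal.exists_pow_le_of_le_radical_of_fg_radical ?_ (IsNoetherian.noetherian _)
  rw [Ideal.radical_eq_sInf]
  refine le_sInf fun p ⟨hp', hp⟩ => ?_
  have hpm : (p.map (Ideal.Quotient.mk (Ideal.ofList rs))).IsPrime :=
    Ideal.map_isPrime_of_surjective Ideal.Quotient.mk_surjective (by rwa [Ideal.mk_ker])
  have hmax := hpm.isMaximal'
  have h6 := Ideal.comap_isMaximal_of_surjective (Ideal.Quotient.mk (Ideal.ofList rs))
    Ideal.Quotient.mk_surjective (K := p.map (Ideal.Quotient.mk (Ideal.ofList rs)))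
  rw [Ideal.comap_map_of_surjective _ Ideal.Quotient.mk_surjective, ← RingHom.ker_eq_comap_bot,
    Ideal.mk_ker, sup_eq_left.mpr hp'] at h6
  exact (eq_maximalIdeal h6).ge

theorem smul_eq_zero_of_pow_le_ofList {k : ℕ} {rs : List S}
    (h : maximalIdeal S ^ k ≤ Ideal.ofList rs) (M : ModuleCat.{u} S) :
    ∀ a ∈ maximalIdeal S ^ k, ∀ y : quotSeq rs M, a • y = 0 := fun _ ha y =>
  congr($(smul_id_quotSeq (h ha) M) y)

theorem length_quotSeq_ne_top {k : ℕ} {rs : List S}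
    (h : maximalIdeal S ^ k ≤ Ideal.ofList rs) (M : ModuleCat.{u} S) [Module.Finite S M] :
    Module.length S (quotSeq rs M) ≠ ⊤ := by
  have : Module.Finite S (quotSeq rs M) :=
    Module.Finite.of_surjective (quotSeqProj rs M).hom (quotSeqProj_surjective rs M)
  exact length_ne_top_of_pow_smul_eq_zero (smul_eq_zero_of_pow_le_ofList h M)

theorem length_quotSeq (rs : List S) (M : ModuleCat.{u} S) :
    Module.length S (quotSeq rs M) =
      Module.length S (M ⧸ (Ideal.ofList rs • ⊤ : Submodule S M)) := by
  have hker : LinearMap.ker (quotSeqProj rs M).hom = Ideal.ofList rs • ⊤ :=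
    Submodule.ext fun x => quotSeqProj_eq_zero_iff rs x
  rw [← hker]
  exact ((quotSeqProj rs M).hom.quotKerEquivOfSurjective
    (quotSeqProj_surjective rs M)).length_eq.symm

theorem krullDimNat_eq {A : Type u} [CommRing A] {d : ℕ} (hd : ringKrullDim A = d) :
    krullDimNat A = d := by
  rw [krullDimNat, hd]
  rfl

/-- The conditions on a system of parameters of a flat extension under which it computes
multiplicities over the base. -/
structure ComputesMultiplicity (R : Type u) {S : Type u} [CommRing R] [CommRing S] [IsLocalRing R]
    [IsLocalRing S] [Algebra R S] (rs : List S) (M : Type u) [AddCommGroup M] [Module R M] :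
    Prop where
  isWeaklyRegular : IsWeaklyRegular (ModuleCat.of S (S ⊗[R] M)) rs
  length_ne_top : Module.length S (quotSeq rs (ModuleCat.of S (S ⊗[R] M))) ≠ ⊤
  hasMultiplicity : HasMultiplicity R M
    (Module.length S (quotSeq rs (ModuleCat.of S (S ⊗[R] M)))).toNat

variable (S) in
-- `R` joins the list so that the sequence is regular on `S`. It is then a system of parameters and
-- its quotients have finite length. Hilbert–Samuel functions over `S` and `R` agree, so the limit
-- is a multiplicity over `R`.
theorem exists_computesMultiplicity [Infinite (ResidueField S)] {d : ℕ} (hd : ringKrullDim R = d)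
    (hR : DepthGE R d R) (Ms : List (ModuleCat.{u} R)) (hfin : ∀ M ∈ Ms, Module.Finite R M)
    (hM : ∀ M ∈ Ms, DepthGE R d M) :
    ∃ rs : List S, rs.length = d ∧ (∀ r ∈ rs, r ∈ maximalIdeal S) ∧
      ComputesMultiplicity R rs R ∧ ∀ M ∈ Ms, ComputesMultiplicity R rs M := by
  have hfin' : ∀ M ∈ ModuleCat.of R R :: Ms, Module.Finite R M := by
    intro M hMs
    rcases List.mem_cons.mp hMs with rfl | hMs
    · exact inferInstanceAs (Module.Finite R R)
    · exact hfin M hMs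
  have hM' : ∀ M ∈ ModuleCat.of R R :: Ms, DepthGE R d M := by
    intro M hMs
    rcases List.mem_cons.mp hMs with rfl | hMs
    · exact hR
    · exact hM M hMs
  obtain ⟨rs, hlen, hrs, h⟩ := exists_superficialSeq (A := S) (d := d)
    ((ModuleCat.of R R :: Ms).map fun M : ModuleCat.{u} R => ModuleCat.of S (S ⊗[R] M)) (by
      intro N hN
      obtain ⟨M, hMs, rfl⟩ := List.mem_map.mp hN
      have := hfin' M hMs
      exact inferInstanceAs (Module.Finite S (S ⊗[R] M))) (by
      intro N hN
      obtain ⟨M, hMs, rfl⟩ := List.mem_map.mp hN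
      have := hfin' M hMs
      exact (hM' M hMs).tensorProduct)
  have hS : IsWeaklyRegular S rs :=
    ((TensorProduct.AlgebraTensorModule.rid R S S).isWeaklyRegular_congr rs).mp
      (h (ModuleCat.of S (S ⊗[R] R)) (List.mem_map_of_mem (a := ModuleCat.of R R) List.mem_cons_self)).1
  obtain ⟨k, hk⟩ := exists_pow_le_ofList_of_ringKrullDim_le
    (ringKrullDim_le_of_flatLocalExtension R S hd) hlen hrs hS
  have key : ∀ M ∈ ModuleCat.of R R :: Ms, ComputesMultiplicity R rs M := by
    intro M hMs
    have := hfin' M hMs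
    have hfinS : Module.Finite S (ModuleCat.of S (S ⊗[R] M)) :=
      inferInstanceAs (Module.Finite S (S ⊗[R] M))
    obtain ⟨h1, h2⟩ := h _ (List.mem_map_of_mem hMs)
    refine ⟨h1, length_quotSeq_ne_top hk _, ?_⟩
    have h3 := tendsto_of_isLittleO_choose (h2.isLittleO (smul_eq_zero_of_pow_le_ofList hk _))
    rw [hlen] at h3
    rw [HasMultiplicity, krullDimNat_eq hd]
    refine h3.congr fun n => ?_
    have h4 := hilbertSamuel_tensorProduct (R := R) (S := S) M n
    change _ * ((hilbertSamuel S (S ⊗[R] M) n).toNat : ℝ) / _ = _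
    rw [h4]
    rfl
  exact ⟨rs, hlen, hrs, key _ List.mem_cons_self, fun M hMs => key M (List.mem_cons_of_mem _ hMs)⟩

theorem HasMultiplicity.unique {M : Type u} [AddCommGroup M] [Module R M] {e e' : ℝ}
    (h : HasMultiplicity R M e) (h' : HasMultiplicity R M e') : e = e' :=
  tendsto_nhds_unique h h'

/-- `(J + (r))/J` is generated by an element killed by `𝔪`, because `r𝔪 ⊆ 𝔪² ⊆ J`, so its length is
at most one. -/
theorem length_quotient_le_add_one {J : Ideal S} (hJ : maximalIdeal S ^ 2 ≤ J) {r : S}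
    (hr : r ∈ maximalIdeal S) :
    Module.length S (S ⧸ J) ≤ Module.length S (S ⧸ (J ⊔ Ideal.span {r})) + 1 := by
  rw [length_quotient_eq_add (le_sup_left : J ≤ J ⊔ Ideal.span {r}), add_comm]
  gcongr
  let f : (S ⧸ maximalIdeal S) →ₗ[S] S ⧸ J :=
    (maximalIdeal S).liftQ (LinearMap.toSpanSingleton S (S ⧸ J) (J.mkQ r)) (by
      intro a ha
      rw [LinearMap.mem_ker, LinearMap.toSpanSingleton_apply, ← map_smul, Submodule.mkQ_apply,
        Submodule.Quotient.mk_eq_zero]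
      refine hJ ?_
      rw [pow_two]
      exact Ideal.mul_mem_mul ha hr)
  have hf : Submodule.map J.mkQ (J ⊔ Ideal.span {r}) = LinearMap.range f := by
    rw [Submodule.range_liftQ, LinearMap.range_toSpanSingleton, Submodule.map_sup,
      Submodule.map_span, Set.image_singleton]
    have : Submodule.map J.mkQ J = ⊥ := by
      rw [← le_bot_iff, Submodule.map_le_iff_le_comap, Submodule.comap_bot, Submodule.ker_mkQ]
    rw [this, bot_sup_eq]
  have h1 : Module.length S (S ⧸ maximalIdeal S) = 1 :=
    Module.length_eq_one_iff.mpr (isSimpleModule_iff_isCoatom.mpr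
      (Ideal.isMaximal_def.mp inferInstance))
  rw [hf, ← h1]
  exact Module.length_le_of_surjective f.rangeRestrict f.surjective_rangeRestrict

theorem length_quotient_le_add {J : Ideal S} (hJ : maximalIdeal S ^ 2 ≤ J) {rs : List S}
    (hrs : ∀ r ∈ rs, r ∈ maximalIdeal S) : Module.length S (S ⧸ J) ≤
      Module.length S (S ⧸ (J ⊔ Ideal.ofList rs)) + rs.length := by
  induction rs generalizing J with
  | nil => rw [Ideal.ofList_nil, sup_bot_eq, List.length_nil, Nat.cast_zero, add_zero]
  | cons r rs ih =>
    have h1 := length_quotient_le_add_one hJ (hrs r (by simp))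
    have h2 := ih (hJ.trans (le_sup_left : J ≤ J ⊔ Ideal.span {r}))
      (fun s hs => hrs s (by simp [hs]))
    rw [Ideal.ofList_cons, ← sup_assoc, List.length_cons, Nat.cast_add, Nat.cast_one, ← add_assoc]
    exact h1.trans (by gcongr)

/-- Each member lowers the length by at most one; a total drop equal to the number of members leaves
no redundant one. -/
theorem indepSeq_of_length_le {J : Ideal S} (hJ : maximalIdeal S ^ 2 ≤ J)
    (hfin : Module.length S (S ⧸ J) ≠ ⊤) {rs : List S} (hrs : ∀ r ∈ rs, r ∈ maximalIdeal S)
    (h : Module.length S (S ⧸ (J ⊔ Ideal.ofList rs)) + rs.length ≤ Module.length S (S ⧸ J)) :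
    IndepSeq J rs := by
  induction rs generalizing J with
  | nil => trivial
  | cons r rs ih =>
    have hr := hrs r (by simp)
    have hrs' : ∀ s ∈ rs, s ∈ maximalIdeal S := fun s hs => hrs s (by simp [hs])
    have hJ' : maximalIdeal S ^ 2 ≤ J ⊔ Ideal.span {r} := hJ.trans le_sup_left
    have h1 := length_quotient_le_add_one hJ hr
    have h2 := length_quotient_le_add hJ' hrs'
    have hfin' : Module.length S (S ⧸ (J ⊔ Ideal.span {r})) ≠ ⊤ := fun htop => by
      rw [length_quotient_eq_add (le_sup_left : J ≤ J ⊔ Ideal.span {r}), htop, add_top] at hfin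
      exact hfin rfl
    rw [Ideal.ofList_cons, ← sup_assoc, List.length_cons, Nat.cast_add, Nat.cast_one,
      ← add_assoc] at h
    refine ⟨fun hrJ => ?_, ih hJ' hfin' hrs' ?_⟩
    · have h3 : J ⊔ Ideal.span {r} = J :=
        sup_eq_left.mpr ((Ideal.span_singleton_le_iff_mem J).mpr hrJ)
      rw [h3] at h2 h
      have h4 := (add_le_add_left h2 1).trans h
      lift Module.length S (S ⧸ J) to ℕ using hfin with l
      have : l + 1 ≤ l := by exact_mod_cast h4
      omega
    · exact (WithTop.add_le_add_iff_right ENat.one_ne_top).mp (h.trans h1)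

theorem hilbertSamuel_two : hilbertSamuel R R 2 = (maximalIdeal R).spanFinrank + 1 := by
  have h1 : Module.length R (R ⧸ maximalIdeal R) = 1 :=
    Module.length_eq_one_iff.mpr (isSimpleModule_iff_isCoatom.mpr
      (Ideal.isMaximal_def.mp inferInstance))
  set m := maximalIdeal R
  have hsq : m ^ 2 • (⊤ : Submodule R R) = m • m := by
    rw [pow_two, Submodule.mul_smul, Ideal.smul_eq_mul m ⊤, Ideal.mul_top]
  have hle : m ^ 2 • (⊤ : Submodule R R) ≤ m := hsq.le.trans Ideal.mul_le_left
  rw [hilbertSamuel, length_quotient_eq_add hle, h1]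
  congr 1
  let f : m →ₗ[R] R ⧸ (m ^ 2 • (⊤ : Submodule R R)) := (Submodule.mkQ _) ∘ₗ m.subtype
  have hker : LinearMap.ker f = m • ⊤ := by
    rw [LinearMap.ker_comp, Submodule.ker_mkQ, hsq]
    have : m • m = (m • (⊤ : Submodule R m)).map m.subtype := by
      rw [Submodule.map_smul'', Submodule.map_top, Submodule.range_subtype]
    rw [this, Submodule.comap_map_eq_of_injective m.subtype_injective]
  have hrange : LinearMap.range f = Submodule.map (Submodule.mkQ _) m := by
    rw [LinearMap.range_comp, Submodule.range_subtype]
  rw [← hrange, ← f.quotKerEquivRange.length_eq, hker, length_quotient_maximalIdeal_smul,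
    minGenerators, Submodule.spanFinrank_top]

/-- Since `S/𝔪²` has length `edim R + 1`, minimal multiplicity reads `length S/(x) + d = length
S/𝔪²`. Dividing `S/𝔪²` by `d` elements costs at most `d`, and `S/(𝔪² + (x))` is a quotient of
`S/(x)`. Both estimates are therefore equalities. -/
theorem HasMinimalMultiplicity.pow_two_le_and_indepSeq (hmin : HasMinimalMultiplicity R) {d : ℕ}
    (hd : ringKrullDim R = d) {rs : List S} (hlen : rs.length = d)
    (hrs : ∀ r ∈ rs, r ∈ maximalIdeal S) (h : ComputesMultiplicity R rs R) :
    maximalIdeal S ^ 2 ≤ Ideal.ofList rs ∧ IndepSeq (maximalIdeal S ^ 2) rs := by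
  have h1 := HasMultiplicity.unique hmin h.hasMultiplicity
  have h2 : Module.length S (quotSeq rs (ModuleCat.of S (S ⊗[R] R))) =
      Module.length S (S ⧸ Ideal.ofList rs) := by
    rw [length_quotSeq]
    refine (Submodule.Quotient.equiv _ _ (TensorProduct.AlgebraTensorModule.rid R S S) ?_).length_eq
    rw [Submodule.map_smul'', Submodule.map_top, LinearEquiv.range, smul_eq_mul, Ideal.mul_top]
  have hfin := h.length_ne_top
  have h3 : hilbertSamuel S S 2 = Module.length S (S ⧸ maximalIdeal S ^ 2) := by
    rw [hilbertSamuel, smul_eq_mul, Ideal.mul_top]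
  have h4 : Module.length S (S ⧸ Ideal.ofList rs) + rs.length =
      Module.length S (S ⧸ maximalIdeal S ^ 2) := by
    rw [← h3, hilbertSamuel_self (R := R), hilbertSamuel_two, hlen]
    rw [h2] at h1 hfin
    lift Module.length S (S ⧸ Ideal.ofList rs) to ℕ using hfin with l
    rw [krullDimNat_eq hd, ENat.toNat_natCast] at h1
    have : (l : ℝ) + d = (maximalIdeal R).spanFinrank + 1 := by linarith
    exact_mod_cast this
  have hfin2 : Module.length S (S ⧸ maximalIdeal S ^ 2) ≠ ⊤ := by
    rw [← h3]
    exact hilbertSamuel_ne_top S 2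
  have h5 := length_quotient_le_add (le_refl (maximalIdeal S ^ 2)) hrs
  have h6 : Module.length S (S ⧸ (maximalIdeal S ^ 2 ⊔ Ideal.ofList rs)) ≤
      Module.length S (S ⧸ Ideal.ofList rs) :=
    Module.length_le_of_surjective
      (Submodule.factor (le_sup_right : Ideal.ofList rs ≤ maximalIdeal S ^ 2 ⊔ Ideal.ofList rs))
      (Submodule.factor_surjective _)
  have h7 : Module.length S (S ⧸ Ideal.ofList rs) ≤
      Module.length S (S ⧸ (maximalIdeal S ^ 2 ⊔ Ideal.ofList rs)) := by
    rw [← h4] at h5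
    exact (WithTop.add_le_add_iff_right (ENat.natCast_ne_top _)).mp h5
  refine ⟨le_sup_left.trans (le_of_length_quotient_le le_sup_right (h2 ▸ hfin) h7), ?_⟩
  refine indepSeq_of_length_le le_rfl hfin2 hrs ?_
  rw [← h4]
  gcongr

end FlatExtension

/-! ### Ulrich modules -/

section UlrichModules

open RingTheory.Sequence Pointwise TensorProduct

theorem mem_ofList_smul_top_of_injective {A : Type u} [CommRing A] {L M N : Type v}
    [AddCommGroup L] [AddCommGroup M] [AddCommGroup N] [Module A L] [Module A M] [Module A N]
    {f : L →ₗ[A] M} {g : M →ₗ[A] N} (hf : Function.Injective f) (hfg : Function.Exact f g)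
    (hg : Function.Surjective g) {rs : List A} (hrs : IsWeaklyRegular N rs) {x : L}
    (hx : f x ∈ (Ideal.ofList rs • ⊤ : Submodule A M)) : x ∈ (Ideal.ofList rs • ⊤ : Submodule A L) := by
  -- The sequence begins with the zero map from a trivial module, so that exactness at `L`, before
  -- and after reduction, expresses injectivity.
  have h := map_first_exact_on_four_term_right_exact_of_isSMulRegular_last
    (f₁ := (0 : PUnit.{1} →ₗ[A] L)) (by
      intro y
      constructor
      · intro hy
        exact ⟨0, (hf (hy.trans (map_zero f).symm)).symm⟩
      · rintro ⟨_, rfl⟩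
        exact map_zero f) hfg hg hrs
  obtain ⟨z, hz⟩ := (h (Submodule.Quotient.mk x)).mp (by
    rw [Submodule.mapQ_apply, Submodule.Quotient.mk_eq_zero]
    exact hx)
  obtain ⟨z, rfl⟩ := Submodule.Quotient.mk_surjective _ z
  rw [Submodule.mapQ_apply, LinearMap.zero_apply, Submodule.Quotient.mk_zero, eq_comm,
    Submodule.Quotient.mk_eq_zero] at hz
  exact hz

theorem smul_top_le_of_surjective {A : Type u} [CommRing A] {M N : Type v}
    [AddCommGroup M] [AddCommGroup N] [Module A M] [Module A N] {I J : Ideal A}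
    {g : M →ₗ[A] N} (hg : Function.Surjective g)
    (h : (I • ⊤ : Submodule A M) ≤ J • ⊤) : (I • ⊤ : Submodule A N) ≤ J • ⊤ := by
  rw [← LinearMap.range_eq_top.mpr hg, ← Submodule.map_top, ← Submodule.map_smul'',
    ← Submodule.map_smul'']
  exact Submodule.map_mono h

theorem DepthGE.of_retract {A : Type u} [CommRing A] [IsLocalRing A] {n : ℕ} {M N : Type u}
    [AddCommGroup M] [AddCommGroup N] [Module A M] [Module A N] (i : M →ₗ[A] N) (r : N →ₗ[A] M)
    (h : r ∘ₗ i = LinearMap.id) (hN : DepthGE A n N) : DepthGE A n M := fun j hj =>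
  subsingleton_of_forall_eq 0 fun x => by
    have h1 : (ModuleCat.ofHom i : ModuleCat.of A M ⟶ ModuleCat.of A N) ≫ ModuleCat.ofHom r =
        𝟙 _ := by
      rw [← ModuleCat.ofHom_comp, h]
      rfl
    rw [← Abelian.Ext.comp_mk₀_id x, ← h1, ← Abelian.Ext.mk₀_comp_mk₀,
      ← Abelian.Ext.comp_assoc_of_second_deg_zero, (hN j hj).elim (x.comp _ _) 0,
      Abelian.Ext.zero_comp]

variable {R S : Type u} [CommRing R] [CommRing S] [IsLocalRing R] [IsLocalRing S]
  [IsNoetherianRing R] [IsNoetherianRing S] [Algebra R S] [FlatLocalExtension R S]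

theorem minGenerators_tensorProduct (M : Type u) [AddCommGroup M] [Module R M] [Module.Finite R M] :
    minGenerators S (S ⊗[R] M) = minGenerators R M := by
  have h := hilbertSamuel_tensorProduct (R := R) (S := S) M 1
  rw [hilbertSamuel, hilbertSamuel, pow_one, pow_one, length_quotient_maximalIdeal_smul,
    length_quotient_maximalIdeal_smul] at h
  exact_mod_cast h

/-- The number of generators and the multiplicity are the lengths of `S ⊗ M` modulo `𝔪` and modulo
the smaller submodule given by `rs`; finite lengths agree only if the submodules do. -/
theorem ComputesMultiplicity.isUlrich_iff {d : ℕ} (hd : ringKrullDim R = d) {rs : List S}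
    (hrs : ∀ r ∈ rs, r ∈ maximalIdeal S) {M : Type u} [AddCommGroup M] [Module R M]
    (h : ComputesMultiplicity R rs M) : IsUlrich R M ↔ Module.Finite R M ∧ DepthGE R d M ∧
      (maximalIdeal S • ⊤ : Submodule S (S ⊗[R] M)) ≤ Ideal.ofList rs • ⊤ := by
  rw [IsUlrich, isMaximalCM_iff hd, and_assoc]
  refine and_congr_right fun hfin => and_congr_right fun _ => ?_
  have hle : (Ideal.ofList rs • ⊤ : Submodule S (S ⊗[R] M)) ≤ maximalIdeal S • ⊤ :=
    Submodule.smul_mono_left (Ideal.span_le.mpr hrs)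
  have h1 := length_quotSeq rs (ModuleCat.of S (S ⊗[R] M))
  have h2 := length_quotient_maximalIdeal_smul (A := S) (S ⊗[R] M)
  rw [minGenerators_tensorProduct] at h2
  have h3 := h.length_ne_top
  constructor
  · intro hM
    have h4 : minGenerators R M =
        (Module.length S (quotSeq rs (ModuleCat.of S (S ⊗[R] M)))).toNat := by
      exact_mod_cast HasMultiplicity.unique hM h.hasMultiplicity
    refine le_of_length_quotient_le hle (h1 ▸ h3) ?_
    rw [h2, h4, ENat.natCast_toNat h3, h1]
  · intro hM
    have h4 : (Ideal.ofList rs • ⊤ : Submodule S (S ⊗[R] M)) = maximalIdeal S • ⊤ :=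
      le_antisymm hle hM
    have h5 : Module.length S (quotSeq rs (ModuleCat.of S (S ⊗[R] M))) = minGenerators R M := by
      rw [← h2, ← h4, h1]
    have h6 := h.hasMultiplicity
    rwa [h5, ENat.toNat_natCast] at h6

variable {L M N : Type u} [AddCommGroup L] [AddCommGroup M] [AddCommGroup N] [Module R L]
  [Module R M] [Module R N]

theorem IsUlrich.finite (h : IsUlrich R M) : Module.Finite R M := h.1.1

theorem IsUlrich.depthGE {d : ℕ} (hd : ringKrullDim R = d) (h : IsUlrich R M) : DepthGE R d M :=
  ((isMaximalCM_iff hd).mp h.1).2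

/-- The inclusion `𝔪M ⊆ xM` passes to every quotient. It passes to the kernel because `x` is regular
on `S ⊗ N`, so `S ⊗ L` modulo `x` still embeds in `S ⊗ M` modulo `x`. -/
theorem IsUlrich.of_shortExact {d : ℕ} (hd : ringKrullDim R = d) (hR : DepthGE R d R)
    {f : L →ₗ[R] M} {g : M →ₗ[R] N} (hf : Function.Injective f) (hfg : Function.Exact f g)
    (hg : Function.Surjective g) (hM : IsUlrich R M) (hN : DepthGE R d N) :
    IsUlrich R L ∧ IsUlrich R N := by
  have hfM := hM.finite
  have hfN : Module.Finite R N := Module.Finite.of_surjective g hg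
  have hfL : Module.Finite R L := Module.Finite.of_injective f hf
  have hL : DepthGE R d L := DepthGE.kernel hf hfg hg (hM.depthGE hd) hN
  obtain ⟨S, _, _, _, _, _, _⟩ := exists_flatLocalExtension R
  obtain ⟨rs, hlen, hrs, -, hMs⟩ := exists_computesMultiplicity S hd hR
    [ModuleCat.of R L, ModuleCat.of R M, ModuleCat.of R N]
    (by simpa using ⟨hfL, hfM, hfN⟩) (by simpa using ⟨hL, hM.depthGE hd, hN⟩)
  have hL' := hMs (ModuleCat.of R L) (by simp)
  have hM' := hMs (ModuleCat.of R M) (by simp)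
  have hN' := hMs (ModuleCat.of R N) (by simp)
  have hMle := ((hM'.isUlrich_iff hd hrs).mp hM).2.2
  have hf' : Function.Injective (f.baseChange S) := Module.Flat.lTensor_preserves_injective_linearMap f hf
  have hfg' : Function.Exact (f.baseChange S) (g.baseChange S) := lTensor_exact S hfg hg
  have hg' : Function.Surjective (g.baseChange S) := LinearMap.lTensor_surjective S hg
  refine ⟨(hL'.isUlrich_iff hd hrs).mpr ⟨hfL, hL, ?_⟩,
    (hN'.isUlrich_iff hd hrs).mpr ⟨hfN, hN, smul_top_le_of_surjective hg' hMle⟩⟩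
  rw [Submodule.smul_le]
  intro a ha x _
  refine mem_ofList_smul_top_of_injective hf' hfg' hg' hN'.isWeaklyRegular (hMle ?_)
  rw [map_smul]
  exact Submodule.smul_mem_smul ha trivial

theorem IsUlrich.of_retract {d : ℕ} (hd : ringKrullDim R = d) (hR : DepthGE R d R)
    (i : L →ₗ[R] M) (r : M →ₗ[R] L) (h : r ∘ₗ i = LinearMap.id) (hM : IsUlrich R M) :
    IsUlrich R L := by
  have hi : Function.Injective i :=
    Function.LeftInverse.injective (g := r) fun x => LinearMap.congr_fun h x
  have hr : Function.Surjective r :=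
    Function.RightInverse.surjective (g := i) fun x => LinearMap.congr_fun h x
  exact (IsUlrich.of_shortExact (L := LinearMap.ker r) hd hR Subtype.val_injective
    (LinearMap.exact_subtype_ker_map r) hr hM (DepthGE.of_retract i r h (hM.depthGE hd))).2

theorem IsUlrich.of_equiv {d : ℕ} (hd : ringKrullDim R = d) (hR : DepthGE R d R) (e : L ≃ₗ[R] M)
    (hM : IsUlrich R M) : IsUlrich R L :=
  IsUlrich.of_retract hd hR e.toLinearMap e.symm.toLinearMap (by ext; simp) hM

theorem IsUlrich.of_subsingleton {d : ℕ} (hd : ringKrullDim R = d) (hR : DepthGE R d R)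
    [Subsingleton M] : IsUlrich R M := by
  obtain ⟨S, _, _, _, _, _, _⟩ := exists_flatLocalExtension R
  have hfM : Module.Finite R M := inferInstance
  have hM : DepthGE R d M := DepthGE.of_subsingleton d
  obtain ⟨rs, hlen, hrs, -, hMs⟩ := exists_computesMultiplicity S hd hR
    [ModuleCat.of R M] (by simpa using hfM) (by simpa using hM)
  have hM' := hMs (ModuleCat.of R M) (by simp)
  have : Subsingleton (S ⊗[R] M) := inferInstance
  refine (hM'.isUlrich_iff hd hrs).mpr ⟨hfM, hM, ?_⟩
  intro x _
  rw [Subsingleton.elim x 0]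
  exact zero_mem _

theorem IsUlrich.prod {d : ℕ} (hd : ringKrullDim R = d) (hR : DepthGE R d R)
    (hM : IsUlrich R M) (hN : IsUlrich R N) : IsUlrich R (M × N) := by
  have hfM := hM.finite
  have hfN := hN.finite
  have hMN : DepthGE R d (M × N) := (hM.depthGE hd).prod (hN.depthGE hd)
  obtain ⟨S, _, _, _, _, _, _⟩ := exists_flatLocalExtension R
  obtain ⟨rs, hlen, hrs, -, hMs⟩ := exists_computesMultiplicity S hd hR
    [ModuleCat.of R (M × N), ModuleCat.of R M, ModuleCat.of R N]
    (by simpa using ⟨inferInstanceAs (Module.Finite R (M × N)), hfM, hfN⟩)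
    (by simpa using ⟨hMN, hM.depthGE hd, hN.depthGE hd⟩)
  have hMN' := hMs (ModuleCat.of R (M × N)) (by simp)
  have hMle := (((hMs (ModuleCat.of R M) (by simp)).isUlrich_iff hd hrs).mp hM).2.2
  have hNle := (((hMs (ModuleCat.of R N) (by simp)).isUlrich_iff hd hrs).mp hN).2.2
  refine (hMN'.isUlrich_iff hd hrs).mpr ⟨inferInstance, hMN, ?_⟩
  rw [Submodule.smul_le]
  intro a ha x _
  have hsum : LinearMap.inl R M N ∘ₗ LinearMap.fst R M N +
      LinearMap.inr R M N ∘ₗ LinearMap.snd R M N = LinearMap.id := by ext <;> simp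
  have hx : x = (LinearMap.inl R M N).baseChange S ((LinearMap.fst R M N).baseChange S x) +
      (LinearMap.inr R M N).baseChange S ((LinearMap.snd R M N).baseChange S x) := by
    have := congrArg (fun f => LinearMap.baseChange S f x) hsum
    simpa only [LinearMap.baseChange_add, LinearMap.baseChange_comp, LinearMap.baseChange_id,
      LinearMap.add_apply, LinearMap.comp_apply, LinearMap.id_apply] using this.symm
  rw [hx, smul_add]
  refine Submodule.add_mem _ ?_ ?_
  · have := Submodule.mem_map_of_mem (f := (LinearMap.inl R M N).baseChange S)
      (hMle (Submodule.smul_mem_smul ha (Submodule.mem_top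
        (x := (LinearMap.fst R M N).baseChange S x))))
    rw [Submodule.map_smul'', map_smul] at this
    exact Submodule.smul_mono le_rfl le_top this
  · have := Submodule.mem_map_of_mem (f := (LinearMap.inr R M N).baseChange S)
      (hNle (Submodule.smul_mem_smul ha (Submodule.mem_top
        (x := (LinearMap.snd R M N).baseChange S x))))
    rw [Submodule.map_smul'', map_smul] at this
    exact Submodule.smul_mono le_rfl le_top this

theorem IsUlrich.pi {d : ℕ} (hd : ringKrullDim R = d) (hR : DepthGE R d R)
    (hM : IsUlrich R M) (n : ℕ) : IsUlrich R (Fin n → M) := by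
  induction n with
  | zero => exact IsUlrich.of_subsingleton hd hR
  | succ n ih =>
    exact IsUlrich.of_equiv hd hR (Fin.consLinearEquiv R (fun _ => M)).symm
      (IsUlrich.prod hd hR hM ih)

theorem IsUlrich.of_inAdd {d : ℕ} (hd : ringKrullDim R = d) (hR : DepthGE R d R)
    (hM : IsUlrich R M) (h : InAdd R M L) : IsUlrich R L := by
  obtain ⟨n, i, r, hir⟩ := h
  exact IsUlrich.of_retract hd hR i r hir (hM.pi hd hR n)

/-- `F/𝔪F` has length at most `μ(M)`, the length of its quotient `M/𝔪M`. Hence the kernel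
contributes nothing modulo `𝔪F`. -/
theorem ker_minimalCover_le (M : Type u) [AddCommGroup M] [Module R M] [Module.Finite R M] :
    LinearMap.ker (minimalCover R M) ≤ maximalIdeal R • ⊤ := by
  set f := minimalCover R M
  have hf : Function.Surjective f := Classical.choose_spec (exists_minimalCover R M)
  let p : Submodule R (Fin (minGenerators R M) → R) := maximalIdeal R • ⊤
  let q := p ⊔ LinearMap.ker f
  suffices h : q ≤ p from le_sup_right.trans h
  have hp : Module.length R ((Fin (minGenerators R M) → R) ⧸ p) ≤ minGenerators R M := by
    rw [length_quotient_maximalIdeal_smul]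
    have h1 : minGenerators R (Fin (minGenerators R M) → R) ≤ minGenerators R M := by
      rw [minGenerators, ← (Pi.basisFun R (Fin (minGenerators R M))).span_eq]
      refine (Submodule.spanFinrank_span_le_ncard_of_finite (Set.finite_range _)).trans ?_
      rw [← Set.image_univ]
      exact (Set.ncard_image_le).trans (by rw [Set.ncard_univ, Nat.card_eq_fintype_card, Fintype.card_fin])
    exact_mod_cast h1
  refine le_of_length_quotient_le le_sup_left (ne_top_of_le_ne_top (ENat.natCast_ne_top _) hp) ?_
  refine hp.trans ?_
  rw [← length_quotient_maximalIdeal_smul]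
  have hq : q ≤ (maximalIdeal R • ⊤ : Submodule R M).comap f := by
    refine sup_le ?_ ?_
    · rw [← Submodule.map_le_iff_le_comap, Submodule.map_smul'']
      exact Submodule.smul_mono le_rfl le_top
    · exact Submodule.comap_mono bot_le
  refine Module.length_le_of_surjective (q.mapQ _ f hq) fun y => ?_
  obtain ⟨y, rfl⟩ := Submodule.Quotient.mk_surjective _ y
  obtain ⟨x, rfl⟩ := hf y
  exact ⟨Submodule.Quotient.mk x, rfl⟩

theorem isMinSyzygy_syzygy (n : ℕ) :
    IsMinSyzygy R n (ModuleCat.of R (syzygy R n (FGModuleCat.of R (ResidueField R)))) := by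
  induction n with
  | zero => exact ⟨Iso.refl _⟩
  | succ n ih =>
    let M := syzygy R n (FGModuleCat.of R (ResidueField R))
    refine ⟨_, _, (LinearMap.ker (minimalCover R M)).subtype, minimalCover R M, ih,
      Subtype.val_injective, LinearMap.exact_subtype_ker_map _,
      Classical.choose_spec (exists_minimalCover R M), ?_⟩
    exact (Submodule.range_subtype _).le.trans (ker_minimalCover_le M)

theorem IsMinSyzygy.tensorProduct {n : ℕ} {P : ModuleCat.{u} R} (hP : IsMinSyzygy R n P) :
    IsMinSyzygy S n (ModuleCat.of S (S ⊗[R] P)) := by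
  induction n generalizing P with
  | zero =>
    obtain ⟨e⟩ := hP
    refine ⟨LinearEquiv.toModuleIso (X₁ := ResidueField S) (X₂ := S ⊗[R] P) ?_⟩
    exact (Submodule.quotEquivOfEq _ _ FlatLocalExtension.map_maximalIdeal.symm).trans
      (((Algebra.TensorProduct.quotIdealMapEquivTensorQuot S (maximalIdeal R)).toLinearEquiv).trans
        (e.toLinearEquiv.baseChange R S _ _))
  | succ n ih =>
    obtain ⟨P', m, i, p, hP', hi, hip, hp, hmin⟩ := hP
    let e := TensorProduct.piScalarRight R S S (Fin m)
    refine ⟨_, m, e.toLinearMap ∘ₗ i.baseChange S, p.baseChange S ∘ₗ e.symm.toLinearMap, ih hP',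
      e.injective.comp (Module.Flat.lTensor_preserves_injective_linearMap i hi), ?_,
      (LinearMap.lTensor_surjective S hp).comp e.symm.surjective, ?_⟩
    · intro y
      obtain ⟨y, rfl⟩ := e.surjective y
      simp only [LinearMap.comp_apply, LinearEquiv.coe_coe, LinearEquiv.symm_apply_apply,
        Set.mem_range, EmbeddingLike.apply_eq_iff_eq]
      exact lTensor_exact S hip hp y
    · have h1 : LinearMap.range (i.baseChange S) ≤ maximalIdeal S • ⊤ := by
        rintro _ ⟨x, rfl⟩
        rw [← FlatLocalExtension.map_maximalIdeal (R := R), ← ker_lTensor_mkQ_smul_top,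
          LinearMap.mem_ker, ← LinearMap.comp_apply, ← LinearMap.baseChange_comp]
        have : (maximalIdeal R • ⊤ : Submodule R (Fin m → R)).mkQ ∘ₗ i = 0 := by
          refine LinearMap.ext fun x => ?_
          exact ((Submodule.Quotient.mk_eq_zero _).mpr (hmin ⟨x, rfl⟩))
        rw [this, LinearMap.baseChange_zero, LinearMap.zero_apply]
      rw [LinearMap.range_comp]
      refine (Submodule.map_mono h1).trans ?_
      rw [Submodule.map_smul'']
      exact Submodule.smul_mono le_rfl le_top

theorem IsMinSyzygy.finite {n : ℕ} {P : ModuleCat.{u} R} (hP : IsMinSyzygy R n P) :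
    Module.Finite R P := by
  rcases n with _ | n
  · obtain ⟨e⟩ := hP
    have : Module.Finite R (resMod R) := inferInstanceAs (Module.Finite R (ResidueField R))
    exact Module.Finite.equiv e.toLinearEquiv
  · obtain ⟨P', m, i, p, -, hi, -⟩ := hP
    exact Module.Finite.of_injective i hi

theorem IsMinSyzygy.depthGE {n d : ℕ} (hR : DepthGE R d R) (hn : n ≤ d) {P : ModuleCat.{u} R}
    (hP : IsMinSyzygy R n P) : DepthGE R n P := by
  induction n generalizing P with
  | zero => exact fun i hi => absurd hi (by omega)
  | succ n ih =>
    obtain ⟨P', m, i, p, hP', hi, hip, hp, -⟩ := hP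
    exact DepthGE.left hi hip hp ((hR.mono hn).pi m) (ih (by omega) hP')

theorem ComputesMultiplicity.isWeaklyRegular_self {rs : List S} (h : ComputesMultiplicity R rs R) :
    IsWeaklyRegular (ModuleCat.of S S) rs :=
  ((TensorProduct.AlgebraTensorModule.rid R S S).isWeaklyRegular_congr rs).mp h.isWeaklyRegular

theorem IsMinSyzygy.isUlrich {d : ℕ} (hd : ringKrullDim R = d) (hR : DepthGE R d R)
    (hmin : HasMinimalMultiplicity R) {P : ModuleCat.{u} R} (hP : IsMinSyzygy R d P) :
    IsUlrich R P := by
  obtain ⟨S, _, _, _, _, _, _⟩ := exists_flatLocalExtension R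
  have hfP := hP.finite
  have hdP := hP.depthGE hR le_rfl
  obtain ⟨rs, hlen, hrs, hRs, hMs⟩ := exists_computesMultiplicity S hd hR
    [P] (by simpa using hfP) (by simpa using hdP)
  obtain ⟨hsq, hind⟩ := hmin.pow_two_le_and_indepSeq hd hlen hrs hRs
  refine ((hMs P (by simp)).isUlrich_iff hd hrs).mpr ⟨hfP, hdP, ?_⟩
  refine IsMinSyzygy.smul_top_le hrs hRs.isWeaklyRegular_self hsq hind
    (P := ModuleCat.of S (S ⊗[R] P)) ?_
  rw [hlen]
  exact hP.tensorProduct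

end UlrichModules

/-! ### The exact category of Ulrich modules -/

section ExactStructure

variable {R : Type u} [CommRing R] [IsLocalRing R]

/-- The object of `ul(R)` given by an Ulrich module. -/
abbrev Ul.of (M : Type u) [AddCommGroup M] [Module R M] (h : IsUlrich R M) : Ul R :=
  ⟨ModuleCat.of R M, h⟩

/-- The linear map underlying a morphism of `ul(R)`. -/
abbrev Ul.toLin {X Y : Ul R} (f : X ⟶ Y) : X.obj →ₗ[R] Y.obj := f.hom.hom

/-- The morphism of `ul(R)` given by a linear map. -/
abbrev Ul.ofLin {X Y : Ul R} (f : X.obj →ₗ[R] Y.obj) : X ⟶ Y :=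
  ObjectProperty.homMk (ModuleCat.ofHom f)

theorem Ul.hom_ext {X Y : Ul R} {f g : X ⟶ Y} (h : ∀ x, Ul.toLin f x = Ul.toLin g x) : f = g :=
  ObjectProperty.hom_ext _ (ModuleCat.hom_ext (LinearMap.ext h))

theorem Ul.congr_toLin {X Y : Ul R} {f g : X ⟶ Y} (h : f = g) (x : X.obj) :
    Ul.toLin f x = Ul.toLin g x := by
  rw [h]

theorem ulrichSequences_mk_iff {X Y Z : Ul R} (i : X ⟶ Y) (d : Y ⟶ Z) (h : i ≫ d = 0) :
    ulrichSequences R (ShortComplex.mk i d h) ↔ Function.Injective (Ul.toLin i) ∧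
      Function.Exact (Ul.toLin i) (Ul.toLin d) ∧ Function.Surjective (Ul.toLin d) := by
  constructor
  · intro hS
    change ((ShortComplex.mk i d h).map (ulrichProperty R).ι).ShortExact at hS
    exact ⟨hS.moduleCat_injective_f,
      (ShortComplex.ShortExact.moduleCat_exact_iff_function_exact _).mp hS.exact,
      hS.moduleCat_surjective_g⟩
  · rintro ⟨h₁, h₂, h₃⟩
    exact ModuleCat.shortComplex_shortExact _ h₂ h₁ h₃

variable [IsNoetherianRing R] {d : ℕ}

theorem isUlrich_ker (hd : ringKrullDim R = d) (hR : DepthGE R d R)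
    {X Z : Ul R} {g : X.obj →ₗ[R] Z.obj} (hg : Function.Surjective g) :
    IsUlrich R (LinearMap.ker g) :=
  (IsUlrich.of_shortExact (L := LinearMap.ker g) hd hR Subtype.val_injective
    (LinearMap.exact_subtype_ker_map g) hg X.property (Z.property.depthGE hd)).1

theorem isDeflation_iff (hd : ringKrullDim R = d) (hR : DepthGE R d R)
    {Y Z : Ul R} (g : Y ⟶ Z) :
    IsDeflation (ulrichSequences R) g ↔ Function.Surjective (Ul.toLin g) := by
  constructor
  · rintro ⟨X, i, h, hS⟩
    exact ((ulrichSequences_mk_iff i g h).mp hS).2.2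
  · intro hg
    let i : Ul.of _ (isUlrich_ker hd hR hg) ⟶ Y := Ul.ofLin (LinearMap.ker (Ul.toLin g)).subtype
    refine ⟨_, i, Ul.hom_ext fun x => x.2, ?_⟩
    rw [ulrichSequences_mk_iff]
    exact ⟨Subtype.val_injective, LinearMap.exact_subtype_ker_map (Ul.toLin g), hg⟩

/-- Kernels of surjections are MCM automatically, but cokernels of injections are not. With that one
condition, Ulrichness of the cokernel follows. -/
theorem isInflation_iff (hd : ringKrullDim R = d) (hR : DepthGE R d R)
    {X Y : Ul R} (i : X ⟶ Y) :
    IsInflation (ulrichSequences R) i ↔ Function.Injective (Ul.toLin i) ∧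
      DepthGE R d (Y.obj ⧸ LinearMap.range (Ul.toLin i)) := by
  constructor
  · rintro ⟨Z, g, h, hS⟩
    obtain ⟨h₁, h₂, h₃⟩ := (ulrichSequences_mk_iff i g h).mp hS
    exact ⟨h₁, (Z.property.depthGE hd).of_equiv (h₂.linearEquivOfSurjective h₃).symm⟩
  · rintro ⟨hi, hdep⟩
    have hex := LinearMap.exact_map_mkQ_range (Ul.toLin i)
    have hU := (IsUlrich.of_shortExact hd hR hi hex (Submodule.mkQ_surjective _) Y.property
      hdep).2
    let g : Y ⟶ Ul.of _ hU := Ul.ofLin (LinearMap.range (Ul.toLin i)).mkQ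
    refine ⟨_, g, Ul.hom_ext fun x => (hex _).mpr ⟨x, rfl⟩, ?_⟩
    rw [ulrichSequences_mk_iff]
    exact ⟨hi, hex, Submodule.mkQ_surjective _⟩

theorem hasZeroObject_ul (hd : ringKrullDim R = d) (hR : DepthGE R d R)
    : HasZeroObject (Ul R) :=
  ⟨⟨Ul.of PUnit (IsUlrich.of_subsingleton hd hR),
    (IsZero.iff_id_eq_zero _).mpr (Ul.hom_ext fun _ => rfl)⟩⟩

theorem hasFiniteBiproducts_ul (hd : ringKrullDim R = d) (hR : DepthGE R d R)
    : HasFiniteBiproducts (Ul R) := by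
  have h₁ := hasZeroObject_ul hd hR
  have h₂ : HasBinaryBiproducts (Ul R) := ⟨fun X Y => ⟨⟨by
    let P : Ul R := Ul.of (X.obj × Y.obj) (IsUlrich.prod hd hR X.property Y.property)
    let b : BinaryBicone X Y :=
      { pt := P
        fst := (Ul.ofLin (LinearMap.fst R X.obj Y.obj) : P ⟶ X)
        snd := (Ul.ofLin (LinearMap.snd R X.obj Y.obj) : P ⟶ Y)
        inl := (Ul.ofLin (LinearMap.inl R X.obj Y.obj) : X ⟶ P)
        inr := (Ul.ofLin (LinearMap.inr R X.obj Y.obj) : Y ⟶ P)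
        inl_fst := Ul.hom_ext fun _ => rfl
        inl_snd := Ul.hom_ext fun _ => rfl
        inr_fst := Ul.hom_ext fun _ => rfl
        inr_snd := Ul.hom_ext fun _ => rfl }
    refine ⟨b, isBinaryBilimitOfTotal b (Ul.hom_ext fun x => ?_)⟩
    exact Prod.ext (add_zero x.1) (zero_add x.2)⟩⟩⟩
  have : HasTerminal (Ul R) := HasZeroObject.hasTerminal
  have : HasFiniteProducts (Ul R) := hasFiniteProducts_of_has_binary_and_terminal
  exact HasFiniteBiproducts.of_hasFiniteProducts

theorem isKernel_of_ulrichSequences (T : ShortComplex (Ul R)) (hT : ulrichSequences R T) :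
    Nonempty (IsLimit (KernelFork.ofι T.f T.zero)) := by
  change (T.map (ulrichProperty R).ι).ShortExact at hT
  have := hT.mono_f
  let l := hT.fIsKernel
  refine ⟨KernelFork.IsLimit.ofι _ _
    (fun k hk => ObjectProperty.homMk (l.lift (KernelFork.ofι k.hom
      (congrArg InducedCategory.Hom.hom hk)))) (fun k hk => ?_) (fun k hk m hm => ?_)⟩
  · exact ObjectProperty.hom_ext _ (Fork.IsLimit.lift_ι l)
  · refine ObjectProperty.hom_ext _ (Fork.IsLimit.hom_ext l ?_)
    exact (congrArg InducedCategory.Hom.hom hm).trans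
      (Fork.IsLimit.lift_ι (t := KernelFork.ofι k.hom (congrArg InducedCategory.Hom.hom hk)) l).symm

theorem isCokernel_of_ulrichSequences (T : ShortComplex (Ul R)) (hT : ulrichSequences R T) :
    Nonempty (IsColimit (CokernelCofork.ofπ T.g T.zero)) := by
  change (T.map (ulrichProperty R).ι).ShortExact at hT
  have := hT.epi_g
  let l := hT.gIsCokernel
  refine ⟨CokernelCofork.IsColimit.ofπ _ _
    (fun k hk => ObjectProperty.homMk (l.desc (CokernelCofork.ofπ k.hom
      (congrArg InducedCategory.Hom.hom hk)))) (fun k hk => ?_) (fun k hk m hm => ?_)⟩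
  · exact ObjectProperty.hom_ext _ (Cofork.IsColimit.π_desc l)
  · refine ObjectProperty.hom_ext _ (Cofork.IsColimit.hom_ext l ?_)
    exact (congrArg InducedCategory.Hom.hom hm).trans
      (Cofork.IsColimit.π_desc (t := CokernelCofork.ofπ k.hom
        (congrArg InducedCategory.Hom.hom hk)) l).symm

theorem exists_isPullback_of_isDeflation (hd : ringKrullDim R = d) (hR : DepthGE R d R)
    {Z' Y Z : Ul R} (f : Z' ⟶ Z) (g : Y ⟶ Z)
    (hg : IsDeflation (ulrichSequences R) g) :
    ∃ (Y' : Ul R) (f' : Y' ⟶ Y) (g' : Y' ⟶ Z'), IsPullback f' g' g f ∧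
      IsDeflation (ulrichSequences R) g' := by
  rw [isDeflation_iff hd hR] at hg
  let X : Ul R := Ul.of (Y.obj × Z'.obj) (IsUlrich.prod hd hR Y.property Z'.property)
  let φ : X.obj →ₗ[R] Z.obj := (Ul.toLin g).coprod (-(Ul.toLin f))
  have hφ : Function.Surjective φ := fun z => by
    obtain ⟨y, rfl⟩ := hg z
    refine ⟨(y, 0), ?_⟩
    change Ul.toLin g y + (-(Ul.toLin f)) 0 = Ul.toLin g y
    rw [map_zero, add_zero]
  have hker : ∀ x : X.obj, x ∈ LinearMap.ker φ ↔ Ul.toLin g x.1 = Ul.toLin f x.2 := fun x => by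
    rw [LinearMap.mem_ker, LinearMap.coprod_apply, LinearMap.neg_apply, ← sub_eq_add_neg,
      sub_eq_zero]
  let Y' : Ul R := Ul.of _ (isUlrich_ker hd hR (X := X) hφ)
  let f' : Y' ⟶ Y := Ul.ofLin (LinearMap.fst R Y.obj Z'.obj ∘ₗ (LinearMap.ker φ).subtype)
  let g' : Y' ⟶ Z' := Ul.ofLin (LinearMap.snd R Y.obj Z'.obj ∘ₗ (LinearMap.ker φ).subtype)
  have hcomm : f' ≫ g = g' ≫ f := Ul.hom_ext fun x => (hker x.1).mp x.2
  refine ⟨Y', f', g', ⟨⟨hcomm⟩, ⟨PullbackCone.IsLimit.mk _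
    (fun s => Ul.ofLin (((Ul.toLin s.fst).prod (Ul.toLin s.snd)).codRestrict (LinearMap.ker φ)
      fun x => (hker _).mpr (Ul.congr_toLin s.condition x)))
    (fun s => Ul.hom_ext fun _ => rfl) (fun s => Ul.hom_ext fun _ => rfl)
    (fun s m hm₁ hm₂ => Ul.hom_ext fun x => Subtype.ext (Prod.ext ?_ ?_))⟩⟩, ?_⟩
  · exact Ul.congr_toLin hm₁ x
  · exact Ul.congr_toLin hm₂ x
  · rw [isDeflation_iff hd hR]
    intro z
    obtain ⟨y, hy⟩ := hg (Ul.toLin f z)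
    exact ⟨⟨(y, z), (hker _).mpr hy⟩, rfl⟩

theorem exists_isPushout_of_isInflation (hd : ringKrullDim R = d) (hR : DepthGE R d R)
    {X X' Y : Ul R} (f : X ⟶ X') (i : X ⟶ Y)
    (hi : IsInflation (ulrichSequences R) i) :
    ∃ (Y' : Ul R) (f' : Y ⟶ Y') (i' : X' ⟶ Y'), IsPushout i f f' i' ∧
      IsInflation (ulrichSequences R) i' := by
  rw [isInflation_iff hd hR] at hi
  obtain ⟨hi, hdep⟩ := hi
  let W : Ul R := Ul.of (Y.obj × X'.obj) (IsUlrich.prod hd hR Y.property X'.property)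
  let φ : X.obj →ₗ[R] W.obj := (Ul.toLin i).prod (-(Ul.toLin f))
  have hφ : Function.Injective φ := fun x y hxy => hi congr(($hxy).1)
  let Q := (W.obj : Type u) ⧸ LinearMap.range φ
  let j : X'.obj →ₗ[R] Q := (LinearMap.range φ).mkQ ∘ₗ LinearMap.inr R Y.obj X'.obj
  let k : Y.obj →ₗ[R] Q := (LinearMap.range φ).mkQ ∘ₗ LinearMap.inl R Y.obj X'.obj
  have hj : Function.Injective j := by
    rw [← LinearMap.ker_eq_bot, ← le_bot_iff]
    intro x hx
    obtain ⟨z, hz⟩ := (Submodule.Quotient.mk_eq_zero _).mp (LinearMap.mem_ker.mp hx)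
    have h₁ : Ul.toLin i z = 0 := congr(($hz).1)
    have h₂ : -(Ul.toLin f z) = x := congr(($hz).2)
    rw [(map_eq_zero_iff _ hi).mp h₁, map_zero, neg_zero] at h₂
    exact h₂.symm
  let q : Q →ₗ[R] Y.obj ⧸ LinearMap.range (Ul.toLin i) :=
    (LinearMap.range φ).liftQ ((LinearMap.range (Ul.toLin i)).mkQ ∘ₗ LinearMap.fst R Y.obj X'.obj)
      (by
        rintro _ ⟨x, rfl⟩
        exact (Submodule.Quotient.mk_eq_zero _).mpr ⟨x, rfl⟩)
  have hq : Function.Surjective q := fun y => by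
    obtain ⟨y, rfl⟩ := Submodule.Quotient.mk_surjective _ y
    exact ⟨k y, rfl⟩
  have hcomm' : ∀ x, k (Ul.toLin i x) = j (Ul.toLin f x) := fun x => by
    refine (Submodule.Quotient.eq (LinearMap.range φ)).mpr ⟨x, ?_⟩
    change (_, _) = ((_, _) : Y.obj × X'.obj) - (_, _)
    simp
  have hjk : ∀ y x, (Submodule.Quotient.mk (p := LinearMap.range φ) (y, x) : Q) = k y + j x :=
    fun y x => by
      change _ = Submodule.Quotient.mk (p := LinearMap.range φ)
        (((y, 0) : Y.obj × X'.obj) + ((0, x) : Y.obj × X'.obj))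
      simp
  have hjq : Function.Exact j q := by
    intro y
    obtain ⟨⟨y, x⟩, rfl⟩ := Submodule.Quotient.mk_surjective _ y
    constructor
    · intro hy
      obtain ⟨z, rfl⟩ := (Submodule.Quotient.mk_eq_zero (LinearMap.range (Ul.toLin i))).mp hy
      rw [hjk, hcomm', ← map_add]
      exact ⟨_, rfl⟩
    · rintro ⟨z, hz⟩
      rw [← hz]
      exact (Submodule.Quotient.mk_eq_zero (LinearMap.range (Ul.toLin i))).mpr (zero_mem _)
  -- The pushout is an extension of the cokernel of `i` by `X'`, hence MCM; only then is it Ulrich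
  -- as a quotient of `Y ⊕ X'`.
  have hQ : DepthGE R d Q := DepthGE.middle hj hjq hq (X'.property.depthGE hd) hdep
  have hU : IsUlrich R Q := (IsUlrich.of_shortExact hd hR hφ (LinearMap.exact_map_mkQ_range φ)
    (Submodule.mkQ_surjective _) W.property hQ).2
  let Y' : Ul R := Ul.of Q hU
  let f' : Y ⟶ Y' := Ul.ofLin k
  let i' : X' ⟶ Y' := Ul.ofLin j
  have hcomm : i ≫ f' = f ≫ i' := Ul.hom_ext hcomm'
  refine ⟨Y', f', i', ⟨⟨hcomm⟩, ⟨PushoutCocone.IsColimit.mk _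
    (fun s => Ul.ofLin ((LinearMap.range φ).liftQ ((Ul.toLin s.inl).coprod (Ul.toLin s.inr)) ?_))
    (fun s => Ul.hom_ext fun x => ?_) (fun s => Ul.hom_ext fun x => ?_)
    (fun s m hm₁ hm₂ => Ul.hom_ext fun x => ?_)⟩⟩, ?_⟩
  · rintro _ ⟨x, rfl⟩
    have := Ul.congr_toLin s.condition x
    change Ul.toLin s.inl (Ul.toLin i x) + Ul.toLin s.inr (-Ul.toLin f x) = 0
    rw [map_neg, ← sub_eq_add_neg, sub_eq_zero]
    exact this
  · change Ul.toLin s.inl x + Ul.toLin s.inr 0 = Ul.toLin s.inl x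
    rw [map_zero, add_zero]
  · change Ul.toLin s.inl 0 + Ul.toLin s.inr x = Ul.toLin s.inr x
    rw [map_zero, zero_add]
  · obtain ⟨⟨y, x⟩, rfl⟩ := Submodule.Quotient.mk_surjective _ x
    have h₁ := Ul.congr_toLin hm₁ y
    have h₂ := Ul.congr_toLin hm₂ x
    change Ul.toLin m (k y) = _ at h₁
    change Ul.toLin m (j x) = _ at h₂
    rw [hjk, map_add, h₁, h₂, ← hjk]
    rfl
  · rw [isInflation_iff hd hR]
    exact ⟨hj, hdep.of_equiv (hjq.linearEquivOfSurjective hq).symm⟩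

theorem isExactCategory_ulrichSequences (hd : ringKrullDim R = d) (hR : DepthGE R d R)
    : IsExactCategory (ulrichSequences R) where
  hasZeroObject := hasZeroObject_ul hd hR
  hasFiniteBiproducts := hasFiniteBiproducts_ul hd hR
  isKernel := isKernel_of_ulrichSequences
  isCokernel := isCokernel_of_ulrichSequences
  closedUnderIso := ⟨fun {S T} e hS =>
    ShortComplex.shortExact_of_iso ((ulrichProperty R).ι.mapShortComplex.mapIso e) hS⟩
  ex0 Z _ := (isDeflation_iff hd hR _).mpr Function.surjective_id
  ex1 f g hf hg := by
    rw [isDeflation_iff hd hR] at hf hg ⊢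
    exact hg.comp hf
  ex2 := exists_isPullback_of_isDeflation hd hR
  ex2op := exists_isPushout_of_isInflation hd hR

end ExactStructure

/-! ### Projective objects -/

section Projectives

open RingTheory.Sequence TensorProduct

theorem surjective_of_baseChange {R S : Type u} [CommRing R] [CommRing S] [Algebra R S]
    [Module.FaithfullyFlat R S] {X Y X' Y' : Type u} [AddCommGroup X] [AddCommGroup Y]
    [AddCommMonoid X'] [AddCommMonoid Y'] [Module R X] [Module R Y]
    [Module S X'] [Module S Y'] (a : S ⊗[R] X ≃ₗ[S] X') (b : S ⊗[R] Y ≃ₗ[S] Y')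
    (φ : X →ₗ[R] Y) (φ' : X' →ₗ[S] Y')
    (h : ∀ x, φ' (a (1 ⊗ₜ[R] x)) = b (1 ⊗ₜ[R] φ x)) (hφ : Function.Surjective φ') :
    Function.Surjective φ := by
  rw [← Module.FaithfullyFlat.lTensor_surjective_iff_surjective R S]
  have key : ∀ z, b (φ.baseChange S z) = φ' (a z) := fun z => by
    induction z with
    | zero => simp only [map_zero]
    | tmul s x =>
      have h1 : s ⊗ₜ[R] x = s • (1 : S) ⊗ₜ[R] x := by
        rw [TensorProduct.smul_tmul', smul_eq_mul, mul_one]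
      rw [h1, map_smul, map_smul, map_smul, map_smul, h, LinearMap.baseChange_tmul]
    | add x y hx hy => simp only [map_add, hx, hy]
  intro y
  obtain ⟨x', hx'⟩ := hφ (b y)
  refine ⟨a.symm x', b.injective ?_⟩
  refine (key (a.symm x')).trans ?_
  rw [LinearEquiv.apply_symm_apply, hx']

/-- Homomorphisms out of a finitely presented module commute with flat base change. -/
noncomputable def homBaseChangeEquiv (R S : Type u) [CommRing R] [CommRing S] [Algebra R S]
    [Module.Flat R S] (P M : Type u) [AddCommGroup P] [AddCommGroup M] [Module R P] [Module R M]
    [Module.FinitePresentation R P] : S ⊗[R] (P →ₗ[R] M) ≃ₗ[S] S ⊗[R] P →ₗ[S] S ⊗[R] M :=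
  (Module.FinitePresentation.isBaseChange_map R P M S).equiv

theorem homBaseChangeEquiv_one_tmul {R S : Type u} [CommRing R] [CommRing S] [Algebra R S]
    [Module.Flat R S] {P M : Type u} [AddCommGroup P] [AddCommGroup M] [Module R P] [Module R M]
    [Module.FinitePresentation R P] (f : P →ₗ[R] M) :
    homBaseChangeEquiv R S P M (1 ⊗ₜ[R] f) = f.baseChange S := by
  rw [homBaseChangeEquiv, IsBaseChange.equiv_tmul, one_smul]
  rfl

/-- Lifting is surjectivity of `Hom(P, M) → Hom(P, N)`. For finitely presented `P` this map commutes
with flat base change, and faithful flatness reflects surjectivity. -/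
theorem exists_comp_eq_of_baseChange {R S : Type u} [CommRing R] [CommRing S] [Algebra R S]
    [Module.FaithfullyFlat R S] {P M N : Type u} [AddCommGroup P] [AddCommGroup M]
    [AddCommGroup N] [Module R P] [Module R M] [Module R N] [Module.FinitePresentation R P]
    (p : M →ₗ[R] N)
    (h : ∀ f : S ⊗[R] P →ₗ[S] S ⊗[R] N, ∃ f' : S ⊗[R] P →ₗ[S] S ⊗[R] M, p.baseChange S ∘ₗ f' = f)
    (g : P →ₗ[R] N) : ∃ g' : P →ₗ[R] M, p ∘ₗ g' = g :=
  surjective_of_baseChange (homBaseChangeEquiv R S P M) (homBaseChangeEquiv R S P N)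
    (LinearMap.compRight R (M := P) p) (LinearMap.compRight S (M := S ⊗[R] P) (p.baseChange S))
    (fun f => by
      rw [homBaseChangeEquiv_one_tmul, homBaseChangeEquiv_one_tmul]
      exact (LinearMap.baseChange_comp f p).symm) h g

variable {R : Type u} [CommRing R] [IsLocalRing R] [IsNoetherianRing R] {d : ℕ}

theorem IsMinSyzygy.exists_lift (hd : ringKrullDim R = d) (hR : DepthGE R d R)
    {P : ModuleCat.{u} R} (hP : IsMinSyzygy R d P) {M N : Type u} [AddCommGroup M] [AddCommGroup N]
    [Module R M] [Module R N] (hM : IsUlrich R M) (hN : IsUlrich R N) {p : M →ₗ[R] N}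
    (hp : Function.Surjective p) (g : P →ₗ[R] N) : ∃ g' : P →ₗ[R] M, p ∘ₗ g' = g := by
  obtain ⟨S, _, _, _, _, _, _⟩ := exists_flatLocalExtension R
  have := hP.finite
  have hfp : Module.FinitePresentation R P := Module.finitePresentation_of_finite R P
  obtain ⟨rs, rfl, hrs, hRs, hMs⟩ := exists_computesMultiplicity S hd hR
    [ModuleCat.of R M, ModuleCat.of R N] (by simpa using ⟨hM.finite, hN.finite⟩)
    (by simpa using ⟨hM.depthGE hd, hN.depthGE hd⟩)
  have hM' := hMs (ModuleCat.of R M) (by simp)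
  have hN' := hMs (ModuleCat.of R N) (by simp)
  obtain ⟨η, hη⟩ := (hP.tensorProduct (S := S)).exists_isSyzygyClass
  have hle := ((hM'.isUlrich_iff hd hrs).mp hM).2.2
  refine exists_comp_eq_of_baseChange (S := S) p (fun f => ?_) g
  obtain ⟨g', hg'⟩ := hη.exists_lift_of_le hrs hM'.isWeaklyRegular hN'.isWeaklyRegular
    hle (ModuleCat.ofHom (p.baseChange S))
    (LinearMap.lTensor_surjective S hp) (ModuleCat.ofHom f)
  exact ⟨g'.hom, congrArg ModuleCat.Hom.hom hg'⟩

theorem IsMinSyzygy.exists_comp_ne_zero (hd : ringKrullDim R = d) (hR : DepthGE R d R)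
    {P : ModuleCat.{u} R} (hP : IsMinSyzygy R d P) {N : Type u} [AddCommGroup N]
    [Module R N] (hN : IsUlrich R N) {h : N →ₗ[R] ResidueField R} (hh : h ≠ 0) :
    ∃ g : P →ₗ[R] N, h ∘ₗ g ≠ 0 := by
  obtain ⟨S, _, _, _, _, _, _⟩ := exists_flatLocalExtension R
  have := hP.finite
  have hfp : Module.FinitePresentation R P := Module.finitePresentation_of_finite R P
  obtain ⟨rs, rfl, hrs, hRs, hMs⟩ := exists_computesMultiplicity S hd hR
    [ModuleCat.of R N] (by simpa using hN.finite) (by simpa using hN.depthGE hd)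
  have hN' := hMs (ModuleCat.of R N) (by simp)
  obtain ⟨η, hη⟩ := (hP.tensorProduct (S := S)).exists_isSyzygyClass
  have h0 : IsMinSyzygy R 0 (resMod R) := ⟨Iso.refl _⟩
  obtain ⟨e⟩ : Nonempty (resMod S ≅ ModuleCat.of S (S ⊗[R] ResidueField R)) := h0.tensorProduct
  have hne : (ModuleCat.ofHom (h.baseChange S) : ModuleCat.of S (S ⊗[R] N) ⟶ _) ≫ e.inv ≠ 0 := by
    intro h1
    have h2 : (ModuleCat.ofHom (h.baseChange S) : ModuleCat.of S (S ⊗[R] N) ⟶ _) = 0 := by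
      rw [← cancel_mono e.inv, h1, zero_comp]
    refine hh ((Module.FaithfullyFlat.zero_iff_lTensor_zero R S h).mpr ?_)
    exact LinearMap.ext fun x => congr($h2 x)
  obtain ⟨g', hg'⟩ := hη.exists_comp_ne_zero hrs hRs.isWeaklyRegular_self hN'.isWeaklyRegular
    ((hN'.isUlrich_iff hd hrs).mp hN).2.2 _ hne
  by_contra! hcon
  apply hg'
  -- Maps `S ⊗ P → S ⊗ N` are generated over `S` by base changes, so if all maps over `R` are killed
  -- by `h`, all maps over `S` are killed too.
  suffices h3 : LinearMap.compRight S (M := S ⊗[R] P) (h.baseChange S) = 0 by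
    rw [← Category.assoc]
    have : g' ≫ ModuleCat.ofHom (h.baseChange S) = 0 :=
      ModuleCat.hom_ext congr($h3 g'.hom)
    rw [this, zero_comp]
  refine (Module.FinitePresentation.isBaseChange_map R P N S).algHom_ext _ _ fun g => ?_
  have := congrArg (LinearMap.baseChange S) (hcon g)
  rw [LinearMap.baseChange_comp, LinearMap.baseChange_zero] at this
  exact this

/-- Otherwise the ranges lie in a maximal submodule, and the quotient map to `k` would kill every
map from `P`. -/
theorem IsMinSyzygy.iSup_range_eq_top (hd : ringKrullDim R = d) (hR : DepthGE R d R)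
    {P : ModuleCat.{u} R} (hP : IsMinSyzygy R d P) {N : Type u} [AddCommGroup N]
    [Module R N] (hN : IsUlrich R N) : ⨆ g : P →ₗ[R] N, LinearMap.range g = ⊤ := by
  have := hN.finite
  by_contra hne
  obtain ⟨K, hK, hle⟩ := (eq_top_or_exists_le_coatom _).resolve_left hne
  have hsimple : IsSimpleModule R (N ⧸ K) := isSimpleModule_iff_isCoatom.mpr hK
  obtain ⟨I, hI, ⟨e⟩⟩ := isSimpleModule_iff_quot_maximal.mp hsimple
  obtain rfl := eq_maximalIdeal hI
  let h : N →ₗ[R] ResidueField R := e.toLinearMap ∘ₗ K.mkQ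
  have hker : ∀ x, h x = 0 ↔ x ∈ K := fun x => by
    change e (K.mkQ x) = 0 ↔ _
    rw [LinearEquiv.map_eq_zero_iff, Submodule.mkQ_apply, Submodule.Quotient.mk_eq_zero]
  have hh : h ≠ 0 := fun h0 => hK.1 (eq_top_iff.mpr fun x _ => (hker x).mp (by rw [h0]; rfl))
  obtain ⟨g, hg⟩ := hP.exists_comp_ne_zero hd hR hN hh
  exact hg (LinearMap.ext fun x => (hker _).mpr (hle (Submodule.mem_iSup_of_mem g ⟨x, rfl⟩)))

theorem IsMinSyzygy.exists_surjective (hd : ringKrullDim R = d) (hR : DepthGE R d R)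
    {P : ModuleCat.{u} R} (hP : IsMinSyzygy R d P) {N : Type u} [AddCommGroup N]
    [Module R N] (hN : IsUlrich R N) :
    ∃ (n : ℕ) (g : (Fin n → P) →ₗ[R] N), Function.Surjective g := by
  have := hN.finite
  have htop := hP.iSup_range_eq_top hd hR hN
  obtain ⟨s, hs⟩ := CompleteLattice.IsCompactElement.exists_finset_of_le_iSup _
    ((Submodule.fg_iff_compact _).mp (Module.Finite.fg_top (R := R) (M := N))) _ htop.ge
  let e := s.equivFin.symm
  refine ⟨s.card, LinearMap.lsum R (fun _ => P) R fun j => ((e j : s) : P →ₗ[R] N), ?_⟩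
  rw [← LinearMap.range_eq_top, ← top_le_iff]
  refine hs.trans (iSup₂_le fun g hg => ?_)
  rintro _ ⟨x, rfl⟩
  refine ⟨Pi.single (e.symm ⟨g, hg⟩) x, ?_⟩
  rw [LinearMap.lsum_piSingle, Equiv.apply_symm_apply]

theorem IsMinSyzygy.exists_lift_of_inAdd (hd : ringKrullDim R = d) (hR : DepthGE R d R)
    {P : ModuleCat.{u} R} (hP : IsMinSyzygy R d P) {M N Q : Type u} [AddCommGroup M]
    [AddCommGroup N] [AddCommGroup Q] [Module R M] [Module R N] [Module R Q] (hQ : InAdd R P Q)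
    (hM : IsUlrich R M) (hN : IsUlrich R N) {p : M →ₗ[R] N}
    (hp : Function.Surjective p) (g : Q →ₗ[R] N) : ∃ g' : Q →ₗ[R] M, p ∘ₗ g' = g := by
  obtain ⟨n, i, r, hir⟩ := hQ
  choose f hf using fun j : Fin n => hP.exists_lift hd hR hM hN hp
    (g ∘ₗ r ∘ₗ LinearMap.single R (fun _ : Fin n => (P : Type u)) j)
  refine ⟨LinearMap.lsum R (fun _ => P) R f ∘ₗ i, ?_⟩
  have h1 : p ∘ₗ LinearMap.lsum R (fun _ => (P : Type u)) R f = g ∘ₗ r := by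
    refine LinearMap.pi_ext' fun j => ?_
    rw [LinearMap.comp_assoc, LinearMap.comp_assoc, ← hf j]
    congr 1
    ext x
    rw [LinearMap.comp_apply, LinearMap.coe_single, LinearMap.lsum_piSingle]
  rw [← LinearMap.comp_assoc, h1, LinearMap.comp_assoc, hir, LinearMap.comp_id]

theorem inAdd_self (n : ℕ) (P : Type u) [AddCommGroup P] [Module R P] : InAdd R P (Fin n → P) :=
  ⟨n, LinearMap.id, LinearMap.id, rfl⟩

theorem isExactProjective_of_inAdd (hd : ringKrullDim R = d) (hR : DepthGE R d R)
    {P : ModuleCat.{u} R} (hP : IsMinSyzygy R d P) (Q : Ul R) (hQ : InAdd R P Q.obj) :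
    IsExactProjective (ulrichSequences R) Q := by
  intro Y Z g hg f
  obtain ⟨f', hf'⟩ := hP.exists_lift_of_inAdd hd hR hQ Y.property Z.property
    ((isDeflation_iff hd hR g).mp hg) (Ul.toLin f)
  exact ⟨Ul.ofLin f', Ul.hom_ext fun x => congr($hf' x)⟩

theorem exists_deflation_from_pi (hd : ringKrullDim R = d) (hR : DepthGE R d R)
    (hmin : HasMinimalMultiplicity R) {P : ModuleCat.{u} R} (hP : IsMinSyzygy R d P) (X : Ul R) :
    ∃ (Q : Ul R) (n : ℕ) (_ : Q.obj ≃ₗ[R] (Fin n → P)) (g : Q ⟶ X),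
      IsExactProjective (ulrichSequences R) Q ∧ IsDeflation (ulrichSequences R) g := by
  obtain ⟨n, g, hg⟩ := hP.exists_surjective hd hR X.property
  let Q : Ul R := Ul.of _ ((hP.isUlrich hd hR hmin).pi hd hR n)
  exact ⟨Q, n, LinearEquiv.refl R _, Ul.ofLin g,
    isExactProjective_of_inAdd hd hR hP Q (inAdd_self n P), (isDeflation_iff hd hR _).mpr hg⟩

theorem isExactProjective_iff (hd : ringKrullDim R = d) (hR : DepthGE R d R)
    (hmin : HasMinimalMultiplicity R) {P : ModuleCat.{u} R} (hP : IsMinSyzygy R d P)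
    (M : ModuleCat.{u} R) :
    (∃ hM : ulrichProperty R M, IsExactProjective (ulrichSequences R) ⟨M, hM⟩) ↔
      InAdd R P M := by
  constructor
  · rintro ⟨hM, hproj⟩
    obtain ⟨Q, n, e, g, -, hg⟩ := exists_deflation_from_pi hd hR hmin hP ⟨M, hM⟩
    obtain ⟨s, hs⟩ := hproj g hg (𝟙 _)
    refine ⟨n, e.toLinearMap ∘ₗ Ul.toLin s, Ul.toLin g ∘ₗ e.symm.toLinearMap, ?_⟩
    ext x
    change Ul.toLin g (e.symm (e (Ul.toLin s x))) = x
    rw [LinearEquiv.symm_apply_apply]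
    exact Ul.congr_toLin hs x
  · intro h
    exact ⟨IsUlrich.of_inAdd hd hR (hP.isUlrich hd hR hmin) h,
      isExactProjective_of_inAdd hd hR hP ⟨M, _⟩ h⟩

end Projectives

/-! ### Modules of finite injective dimension -/

section FiniteInjectiveDimension

open Abelian RingTheory.Sequence

section

variable {A : Type u} [CommRing A]

theorem subsingleton_ext_of_contravariant_middle {X : ModuleCat.{u} A}
    {S : ShortComplex (ModuleCat.{u} A)} (hS : S.ShortExact) {i : ℕ}
    (h₁ : Subsingleton (Ext S.X₁ X i)) (h₃ : Subsingleton (Ext S.X₃ X i)) :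
    Subsingleton (Ext S.X₂ X i) := by
  refine subsingleton_of_forall_eq 0 fun x => ?_
  obtain ⟨y, rfl⟩ := Ext.contravariant_sequence_exact₂ hS X x (Subsingleton.elim _ _)
  rw [Subsingleton.elim y 0, Ext.comp_zero]

theorem subsingleton_ext_of_contravariant_left {X : ModuleCat.{u} A}
    {S : ShortComplex (ModuleCat.{u} A)} (hS : S.ShortExact) {i : ℕ}
    (h₂ : Subsingleton (Ext S.X₂ X i)) (h₃ : Subsingleton (Ext S.X₃ X (i + 1))) :
    Subsingleton (Ext S.X₁ X i) := by
  refine subsingleton_of_forall_eq 0 fun x => ?_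
  obtain ⟨y, rfl⟩ := Ext.contravariant_sequence_exact₁ hS X x (add_comm 1 i)
    (Subsingleton.elim _ _)
  rw [Subsingleton.elim y 0, Ext.comp_zero]

theorem subsingleton_ext_of_contravariant_right {X : ModuleCat.{u} A}
    {S : ShortComplex (ModuleCat.{u} A)} (hS : S.ShortExact) {i : ℕ}
    (h₁ : Subsingleton (Ext S.X₁ X i)) (h₂ : Subsingleton (Ext S.X₂ X (i + 1))) :
    Subsingleton (Ext S.X₃ X (i + 1)) := by
  refine subsingleton_of_forall_eq 0 fun x => ?_
  obtain ⟨y, rfl⟩ := Ext.contravariant_sequence_exact₃ hS X x (Subsingleton.elim _ _)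
    (add_comm 1 i)
  rw [Subsingleton.elim y 0, Ext.comp_zero]

theorem subsingleton_ext_of_iso {X X' Y : ModuleCat.{u} A} {i : ℕ} (e : X ≅ X')
    (h : Subsingleton (Ext X Y i)) : Subsingleton (Ext X' Y i) := by
  refine subsingleton_of_forall_eq 0 fun x => ?_
  rw [← Ext.mk₀_id_comp x, ← e.inv_hom_id, ← Ext.mk₀_comp_mk₀, Ext.comp_assoc _ _ _ (zero_add 0) (zero_add i) (by omega),
    Subsingleton.elim ((Ext.mk₀ e.hom).comp x _) 0, Ext.comp_zero]

theorem subsingleton_ext_projective_succ (F : Type u) [AddCommGroup F] [Module A F]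
    [Module.Projective A F] (N : ModuleCat.{u} A) (i : ℕ) :
    Subsingleton (Ext (ModuleCat.of A F) N (i + 1)) := by
  have : Projective (ModuleCat.of A F) := (IsProjective.iff_projective (R := A) F).mp inferInstance
  exact subsingleton_of_forall_eq 0 fun x => Ext.eq_zero_of_projective x

theorem subsingleton_ext_quotSeq {N : ModuleCat.{u} A} {n : ℕ} (rs : List A) {M : ModuleCat.{u} A}
    (hM : IsWeaklyRegular M rs) (h : ∀ i, n < i → Subsingleton (Ext M N i)) :
    ∀ i, n + rs.length < i → Subsingleton (Ext (quotSeq rs M) N i) := by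
  induction rs generalizing M n with
  | nil => exact h
  | cons r rs ih =>
    obtain ⟨hM₁, hM₂⟩ := (isWeaklyRegular_cons_iff M r rs).mp hM
    intro i hi
    refine ih (M := quotOne r M) (n := n + 1) hM₂ (fun j hj => ?_) i (by simp at hi; omega)
    obtain ⟨j, rfl⟩ : ∃ l, j = l + 1 := ⟨j - 1, by omega⟩
    exact subsingleton_ext_of_contravariant_right (quotOneComplex_shortExact hM₁)
      (h j (by omega)) (h (j + 1) (by omega))

variable [IsLocalRing A]

theorem exists_resMod_hom_of_ne_zero {k : ℕ} {X : ModuleCat.{u} A} {x : X}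
    (hk : ∀ a ∈ maximalIdeal A ^ k, a • x = 0) (hx : x ≠ 0) :
    ∃ (r : A) (f : resMod A ⟶ X), f (1 : ResidueField A) = r • x ∧ r • x ≠ 0 := by
  induction k generalizing x with
  | zero => exact absurd (by simpa using hk 1 (by simp)) hx
  | succ k ih =>
    by_cases h : ∀ a ∈ maximalIdeal A, a • x = 0
    · obtain ⟨f, hf⟩ := exists_resMod_hom x h
      exact ⟨1, f, by rw [hf, one_smul], by rwa [one_smul]⟩
    · push Not at h
      obtain ⟨a, ha, hax⟩ := h
      obtain ⟨r, f, hf, hr⟩ := ih (x := a • x) (fun b hb => by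
        rw [← mul_smul]
        exact hk _ (by rw [pow_succ]; exact Ideal.mul_mem_mul hb ha)) hax
      exact ⟨r * a, f, by rw [hf, mul_smul], by rwa [mul_smul]⟩

theorem resMod_hom_injective {X : ModuleCat.{u} A} {f : resMod A ⟶ X}
    (hf : f (1 : ResidueField A) ≠ 0) : Function.Injective f := by
  refine (injective_iff_map_eq_zero f.hom).mpr fun x hx => ?_
  obtain ⟨a, rfl⟩ := resProj_surjective (A := A) x
  have h1 : f (resProj A a) = a • f (1 : ResidueField A) := by
    rw [← map_smul]
    congr 1
    change residue A a = algebraMap A (ResidueField A) a * 1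
    rw [mul_one]
    rfl
  rw [resProj_eq_zero_iff]
  by_contra ha
  refine hf ((notMem_maximalIdeal.mp ha).smul_eq_zero.mp ?_)
  rw [← h1]
  exact hx

variable [IsNoetherianRing A]

/-- Dévissage along a prime filtration: under the support condition only `k` can occur as a factor.
-/
theorem subsingleton_ext_of_support {N : ModuleCat.{u} A} {i : ℕ}
    (hk : Subsingleton (Ext (resMod A) N i)) (X : Type u) [AddCommGroup X] [Module A X]
    [hfin : Module.Finite A X]
    (hX : Module.support A X ⊆ PrimeSpectrum.zeroLocus (maximalIdeal A)) :
    Subsingleton (Ext (ModuleCat.of A X) N i) := by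
  revert hX
  induction hfin using IsNoetherianRing.induction_on_isQuotientEquivQuotientPrime A with
  | subsingleton X =>
    intro _
    have : IsZero (ModuleCat.of A X) := ModuleCat.isZero_of_subsingleton _
    refine subsingleton_of_forall_eq 0 fun x => ?_
    rw [← Ext.mk₀_id_comp x, this.eq_of_src (𝟙 _) 0, Ext.mk₀_zero, Ext.zero_comp]
  | quotient X p e =>
    intro hX
    have h1 : p ∈ Module.support A X := by
      rw [e.support_eq, Module.support_eq_zeroLocus, Ideal.annihilator_quotient]
      exact (PrimeSpectrum.mem_zeroLocus _ _).mpr (Set.Subset.refl _)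
    have h3 : maximalIdeal A ≤ p.asIdeal := hX h1
    have h2 : p.1 = maximalIdeal A := le_antisymm (le_maximalIdeal p.2.ne_top) h3
    have e' : X ≃ₗ[A] ResidueField A := e.trans (Submodule.quotEquivOfEq _ _ h2)
    exact subsingleton_ext_of_iso e'.toModuleIso.symm hk
  | exact L M N f g hf hg hfg hL hN =>
    intro hX
    exact subsingleton_ext_of_contravariant_middle (shortExact_of_linearMaps hf hfg hg)
      (hL ((Module.support_subset_of_injective f hf).trans hX))
      (hN ((Module.support_subset_of_surjective g hg).trans hX))

variable {d : ℕ}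

theorem isWeaklyRegular_of_retract {M N : Type u} [AddCommGroup M] [AddCommGroup N] [Module A M]
    [Module A N] (i : M →ₗ[A] N) (r : N →ₗ[A] M) (h : r ∘ₗ i = LinearMap.id) {rs : List A}
    (hN : IsWeaklyRegular N rs) : IsWeaklyRegular M rs := by
  induction rs generalizing M N with
  | nil => exact IsWeaklyRegular.nil A M
  | cons a rs ih =>
    obtain ⟨h₁, h₂⟩ := (isWeaklyRegular_cons_iff N a rs).mp hN
    have hi : Function.Injective i :=
      Function.LeftInverse.injective (g := r) fun x => LinearMap.congr_fun h x
    refine (isWeaklyRegular_cons_iff M a rs).mpr ⟨fun x y hxy => hi (h₁ ?_), ?_⟩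
    · change a • i x = a • i y
      rw [← map_smul, ← map_smul]
      exact congrArg i hxy
    · refine ih (QuotSMulTop.map a i) (QuotSMulTop.map a r) ?_ h₂
      rw [← QuotSMulTop.map_comp, h, QuotSMulTop.map_id]

theorem exists_isWeaklyRegular_of_depthGE (hd : ringKrullDim A = d) (hA : DepthGE A d A)
    {M : Type u} [AddCommGroup M] [Module A M] [Module.Finite A M] (hM : DepthGE A d M) :
    ∃ (rs : List A) (k : ℕ), rs.length = d ∧ (∀ r ∈ rs, r ∈ maximalIdeal A) ∧
      IsWeaklyRegular (ModuleCat.of A A) rs ∧ IsWeaklyRegular (ModuleCat.of A M) rs ∧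
      maximalIdeal A ^ k ≤ Ideal.ofList rs := by
  obtain ⟨rs, hlen, hrs, h⟩ := (hA.prod hM).exists_isWeaklyRegular
  have hA' : IsWeaklyRegular A rs :=
    isWeaklyRegular_of_retract (LinearMap.inl A A M) (LinearMap.fst A A M) (by ext; simp) h
  obtain ⟨k, hk⟩ := exists_pow_le_ofList_of_ringKrullDim_le hd.le hlen hrs hA'
  exact ⟨rs, k, hlen, hrs, hA', isWeaklyRegular_of_retract (LinearMap.inr A A M)
    (LinearMap.snd A A M) (by ext; simp) h, hk⟩

/-- Descending induction from the injective dimension. The field `k` embeds in the socle of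
`A/(rs)`. `Ext` out of `A/(rs)` vanishes above degree `d`, and `Ext^(i+1)` out of the cokernel
vanishes by induction and dévissage, hence so does `Ext^i(k, N)`. -/
theorem subsingleton_ext_resMod (hd : ringKrullDim A = d) (hA : DepthGE A d A)
    {N : ModuleCat.{u} A} {n : ℕ} (hN : HasInjectiveDimensionLE N n) {i : ℕ} (hi : d < i) :
    Subsingleton (Ext (resMod A) N i) := by
  obtain ⟨rs, k, hlen, hrs, hreg, -, hk⟩ := exists_isWeaklyRegular_of_depthGE hd hA hA
  let X := quotSeq rs (ModuleCat.of A A)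
  have hXsupp : Module.support A X ⊆ PrimeSpectrum.zeroLocus (maximalIdeal A) :=
    support_quotSeq_subset hk _
  have hXfin : Module.Finite A X :=
    Module.Finite.of_surjective (quotSeqProj rs (ModuleCat.of A A)).hom
      (quotSeqProj_surjective rs _)
  have hone : quotSeqProj rs (ModuleCat.of A A) (1 : A) ≠ 0 := by
    rw [Ne, quotSeqProj_eq_zero_iff, smul_eq_mul, Ideal.mul_top]
    intro h
    have hle : Ideal.ofList rs ≤ maximalIdeal A := Ideal.span_le.mpr hrs
    exact (Ideal.ne_top_iff_one _).mp (maximalIdeal.isMaximal A).ne_top (hle h)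
  obtain ⟨r, f, hf, hr⟩ := exists_resMod_hom_of_ne_zero (k := k)
    (smul_eq_zero_of_pow_le_ofList hk _ · · _) hone
  have hinj : Function.Injective f := resMod_hom_injective (by rwa [hf])
  suffices H : ∀ j i, d < i → n < i + j → Subsingleton (Ext (resMod A) N i) from
    H n i hi (by omega)
  intro j
  induction j with
  | zero => exact fun i _ hi => HasInjectiveDimensionLT.subsingleton N (n + 1) i (by omega) _
  | succ j ih =>
    intro i hi hij
    have h1 := ih (i + 1) (by omega) (by omega)
    have h2 : Subsingleton (Ext (ModuleCat.of A (X ⧸ LinearMap.range f.hom)) N (i + 1)) :=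
      subsingleton_ext_of_support h1 _ ((Module.support_subset_of_surjective _
        (Submodule.mkQ_surjective _)).trans hXsupp)
    refine subsingleton_ext_of_contravariant_left (shortExact_of_linearMaps hinj
      (LinearMap.exact_map_mkQ_range f.hom) (Submodule.mkQ_surjective _)) ?_ h2
    refine subsingleton_ext_quotSeq rs (n := 0) hreg (fun l hl => ?_) i (by omega)
    obtain ⟨l, rfl⟩ : ∃ l', l = l' + 1 := ⟨l - 1, by omega⟩
    exact subsingleton_ext_projective_succ A N l

/-- Again by descending induction. Once the higher groups vanish, the iterated class sends `Ext^i(M,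
N)` to `Ext^(d+i)(M/(rs)M, N) = 0` with kernel inside `(rs) Ext^i(M, N)`, and Nakayama applies. -/
theorem subsingleton_ext_of_depthGE (hd : ringKrullDim A = d) (hA : DepthGE A d A)
    {N : ModuleCat.{u} A} [Module.Finite A N] {n : ℕ} (hN : HasInjectiveDimensionLE N n)
    {M : Type u} [AddCommGroup M] [Module A M] [Module.Finite A M] (hM : DepthGE A d M) {i : ℕ}
    (hi : 0 < i) : Subsingleton (Ext (ModuleCat.of A M) N i) := by
  obtain ⟨rs, k, hlen, hrs, -, hreg, hk⟩ := exists_isWeaklyRegular_of_depthGE hd hA hM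
  suffices H : ∀ j i, 0 < i → n < i + j → Subsingleton (Ext (ModuleCat.of A M) N i) from
    H n i hi (by omega)
  intro j
  induction j with
  | zero => exact fun i _ hi => HasInjectiveDimensionLT.subsingleton N (n + 1) i (by omega) _
  | succ j ih =>
    intro i hi hij
    have hfin : Module.Finite A (quotSeq rs (ModuleCat.of A M)) :=
      Module.Finite.of_surjective (quotSeqProj rs (ModuleCat.of A M)).hom
        (quotSeqProj_surjective rs _)
    have h1 : Subsingleton (Ext (quotSeq rs (ModuleCat.of A M)) N (rs.length + i)) :=
      subsingleton_ext_of_support (subsingleton_ext_resMod hd hA hN (by omega)) _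
        (support_quotSeq_subset hk _)
    have hmem : (⊤ : Submodule A (Ext (ModuleCat.of A M) N i)) ≤ Ideal.ofList rs • ⊤ := fun u _ =>
      mem_smul_top_of_koszulClass_comp rs hreg (fun l hl => ih l (by omega) (by omega)) rfl u
        (Subsingleton.elim _ _)
    have hM' : Module.Finite A (ModuleCat.of A M) := inferInstanceAs (Module.Finite A M)
    have htop := Submodule.eq_bot_of_le_smul_of_le_jacobson_bot _ ⊤
      (Module.Finite.fg_top (R := A) (M := Ext (ModuleCat.of A M) N i)) hmem
      ((Ideal.span_le.mpr hrs).trans (maximalIdeal_le_jacobson _))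
    exact (Submodule.subsingleton_iff A).mp (subsingleton_of_bot_eq_top htop.symm)

end

end FiniteInjectiveDimension

/-! ### Duality into the canonical module -/

section Duality

open Abelian RingTheory.Sequence TensorProduct Pointwise

section

variable {A : Type u} [CommRing A] {L M N X : Type u} [AddCommGroup L] [AddCommGroup M]
  [AddCommGroup N] [AddCommGroup X] [Module A L] [Module A M] [Module A N] [Module A X]
  {f : L →ₗ[A] M} {g : M →ₗ[A] N}

theorem exists_extend_of_subsingleton_ext (hf : Function.Injective f) (hfg : Function.Exact f g)
    (hg : Function.Surjective g) (h : Subsingleton (Ext (ModuleCat.of A N) (ModuleCat.of A X) 1))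
    (φ : L →ₗ[A] X) : ∃ ψ : M →ₗ[A] X, ψ ∘ₗ f = φ := by
  have hS := shortExact_of_linearMaps hf hfg hg
  obtain ⟨y, hy⟩ := Ext.contravariant_sequence_exact₁ hS (ModuleCat.of A X)
    (Ext.mk₀ (ModuleCat.ofHom φ)) (add_zero 1) (h.elim _ _)
  obtain ⟨ψ, rfl⟩ := (Ext.mk₀_bijective _ _).2 y
  rw [Ext.mk₀_comp_mk₀] at hy
  exact ⟨ψ.hom, congrArg ModuleCat.Hom.hom ((Ext.mk₀_bijective _ _).1 hy)⟩

theorem exists_lift_of_subsingleton_ext (hf : Function.Injective f) (hfg : Function.Exact f g)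
    (hg : Function.Surjective g) (h : Subsingleton (Ext (ModuleCat.of A X) (ModuleCat.of A L) 1))
    (φ : X →ₗ[A] N) : ∃ ψ : X →ₗ[A] M, g ∘ₗ ψ = φ := by
  have hS := shortExact_of_linearMaps hf hfg hg
  obtain ⟨y, hy⟩ := Ext.covariant_sequence_exact₃ (ModuleCat.of A X) hS
    (Ext.mk₀ (ModuleCat.ofHom φ)) (zero_add 1) (h.elim _ _)
  obtain ⟨ψ, rfl⟩ := (Ext.mk₀_bijective _ _).2 y
  rw [Ext.mk₀_comp_mk₀] at hy
  exact ⟨ψ.hom, congrArg ModuleCat.Hom.hom ((Ext.mk₀_bijective _ _).1 hy)⟩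

theorem subsingleton_ext_one_of_exists_extend [Module.Projective A M] (hf : Function.Injective f)
    (hfg : Function.Exact f g) (hg : Function.Surjective g)
    (h : ∀ φ : L →ₗ[A] X, ∃ ψ : M →ₗ[A] X, ψ ∘ₗ f = φ) :
    Subsingleton (Ext (ModuleCat.of A N) (ModuleCat.of A X) 1) := by
  have hS := shortExact_of_linearMaps hf hfg hg
  refine subsingleton_of_forall_eq 0 fun x => ?_
  obtain ⟨y, rfl⟩ := Ext.contravariant_sequence_exact₃ hS (ModuleCat.of A X) x
    ((subsingleton_ext_projective_succ M _ 0).elim _ _) (add_zero 1)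
  obtain ⟨φ, rfl⟩ := (Ext.mk₀_bijective _ _).2 y
  obtain ⟨ψ, hψ⟩ := h φ.hom
  have h1 : φ = (ModuleCat.shortComplexOfCompEqZero f g hfg.linearMap_comp_eq_zero).f ≫
      ModuleCat.ofHom ψ := ModuleCat.hom_ext hψ.symm
  rw [h1, ← Ext.mk₀_comp_mk₀, ShortComplex.ShortExact.extClass_comp_assoc]

/-- A map into `X` that is zero modulo a regular sequence lies in the submodule of maps generated
by that sequence, if the higher extensions by `X` vanish. -/
theorem mem_ofList_smul_top_of_range_le {rs : List A} (hX : IsWeaklyRegular X rs)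
    (hE : ∀ i, Subsingleton (Ext (ModuleCat.of A M) (ModuleCat.of A X) (i + 1))) (φ : M →ₗ[A] X)
    (hφ : LinearMap.range φ ≤ Ideal.ofList rs • ⊤) :
    φ ∈ (Ideal.ofList rs • ⊤ : Submodule A (M →ₗ[A] X)) := by
  induction rs generalizing X with
  | nil =>
    rw [Ideal.ofList_nil, Submodule.bot_smul, le_bot_iff, LinearMap.range_eq_bot] at hφ
    rw [hφ]
    exact zero_mem _
  | cons r rs ih =>
    obtain ⟨hX₁, hX₂⟩ := (isWeaklyRegular_cons_iff X r rs).mp hX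
    have hinj : Function.Injective (LinearMap.lsmul A X r) := hX₁
    have hex := LinearMap.exact_lsmul_mkQ_smul_top X r
    have hsurj := Submodule.mkQ_surjective (r • (⊤ : Submodule A X))
    have hS := shortExact_of_linearMaps hinj hex hsurj
    set π := (r • (⊤ : Submodule A X)).mkQ
    have h1 := ih (X := QuotSMulTop r X) hX₂
      (fun i => subsingleton_ext_of_covariant_right hS (hE (i + 1)) (hE i)) (π ∘ₗ φ) (by
        rw [LinearMap.range_comp]
        refine (Submodule.map_mono hφ).trans ?_
        rw [Ideal.ofList_cons_smul, Submodule.map_sup, Submodule.map_smul'']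
        refine sup_le ?_ (Submodule.smul_mono le_rfl le_top)
        rintro _ ⟨x, hx, rfl⟩
        have hx0 : π x = 0 := (Submodule.Quotient.mk_eq_zero _).mpr hx
        rw [hx0]
        exact zero_mem _)
    have h2 : ∃ w ∈ (Ideal.ofList rs • ⊤ : Submodule A (M →ₗ[A] X)), π ∘ₗ w = π ∘ₗ φ := by
      refine Submodule.smul_induction_on (p := fun y => ∃ w ∈ (Ideal.ofList rs • ⊤ :
        Submodule A (M →ₗ[A] X)), π ∘ₗ w = y) h1 ?_ ?_
      · intro a ha v _
        obtain ⟨w, rfl⟩ := exists_lift_of_subsingleton_ext hinj hex hsurj (hE 0) v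
        exact ⟨a • w, Submodule.smul_mem_smul ha trivial, LinearMap.comp_smul _ _ _⟩
      · rintro _ _ ⟨w, hw, rfl⟩ ⟨w', hw', rfl⟩
        exact ⟨w + w', add_mem hw hw', LinearMap.comp_add _ _ _⟩
    obtain ⟨w, hw, hwφ⟩ := h2
    -- The difference `φ - w` takes values in `rX`, so it factors through multiplication by the
    -- regular element `r`.
    have : Mono (ModuleCat.shortComplexOfCompEqZero _ _ hex.linearMap_comp_eq_zero).f := hS.mono_f
    have h3 : ModuleCat.ofHom (φ - w) ≫
        (ModuleCat.shortComplexOfCompEqZero _ _ hex.linearMap_comp_eq_zero).g = 0 := by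
      refine ModuleCat.hom_ext ?_
      change π ∘ₗ (φ - w) = 0
      rw [LinearMap.comp_sub, hwφ, sub_self]
    have h4 := hS.exact.lift_f _ h3
    have h5 : φ = r • (hS.exact.lift _ h3).hom + w := by
      rw [← sub_eq_iff_eq_add]
      exact (congrArg ModuleCat.Hom.hom h4).symm
    rw [h5, Ideal.ofList_cons_smul]
    exact Submodule.add_mem_sup (Submodule.smul_mem_pointwise_smul _ _ _ trivial) hw

end

section

variable {R : Type u} [CommRing R] [IsLocalRing R] [IsNoetherianRing R] {d : ℕ}

/-- The extensions of positive degree of a module by maximal Cohen--Macaulay modules vanish. -/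
def ExtVanishing (R : Type u) [CommRing R] [IsLocalRing R] (d : ℕ) (ω : Type u) [AddCommGroup ω]
    [Module R ω] : Prop :=
  ∀ (M : Type u) [AddCommGroup M] [Module R M] [Module.Finite R M], DepthGE R d M →
    ∀ i, Subsingleton (Ext (ModuleCat.of R M) (ModuleCat.of R ω) (i + 1))

theorem exists_free_cover_of_depthGE (hR : DepthGE R d R) {M : Type u} [AddCommGroup M] [Module R M]
    [Module.Finite R M] (hM : DepthGE R d M) :
    ∃ (n : ℕ) (p : (Fin n → R) →ₗ[R] M), Function.Surjective p ∧
      DepthGE R d (LinearMap.ker p) := by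
  obtain ⟨n, p, hp⟩ := Module.Finite.exists_fin' R M
  exact ⟨n, p, hp, DepthGE.kernel Subtype.val_injective (LinearMap.exact_subtype_ker_map p) hp
    (hR.pi n) hM⟩

variable {ω : Type u} [AddCommGroup ω] [Module R ω]

/-- Dualising a free cover gives `0 → M† → ω^n → K† → 0`, exact on the right because `Ext¹(M, ω) =
0`. The kernel `K` is again MCM, so the depth bound grows by one at each round. -/
theorem DepthGE.dual (hR : DepthGE R d R) (hω : DepthGE R d ω) (hE : ExtVanishing R d ω)
    {M : Type u} [AddCommGroup M] [Module R M] [Module.Finite R M] (hM : DepthGE R d M) :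
    DepthGE R d (M →ₗ[R] ω) := by
  suffices H : ∀ j ≤ d, ∀ (M : Type u) [AddCommGroup M] [Module R M] [Module.Finite R M],
      DepthGE R d M → DepthGE R j (M →ₗ[R] ω) from H d le_rfl M hM
  intro j
  induction j with
  | zero =>
    intro _ M _ _ _ _ i hi
    omega
  | succ j ih =>
    intro hj M _ _ _ hM
    obtain ⟨n, p, hp, hK⟩ := exists_free_cover_of_depthGE hR hM
    refine DepthGE.left (f := p.lcomp R ω) (g := (LinearMap.ker p).subtype.lcomp R ω)
      (LinearMap.lcomp_injective_of_surjective p hp) ?_ ?_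
      (((hω.mono hj).pi n).of_equiv (LinearEquiv.piRing R ω (Fin n) R).symm)
      (ih (by omega) _ hK)
    · exact LinearMap.exact_lcomp_of_exact_of_surjective _ (LinearMap.exact_subtype_ker_map p) hp
    · exact exists_extend_of_subsingleton_ext (f := (LinearMap.ker p).subtype)
        Subtype.val_injective (LinearMap.exact_subtype_ker_map p) hp (hE M hM 0)

theorem exists_extend_baseChange (S : Type u) [CommRing S] [Algebra R S] [Module.Flat R S]
    {K F N : Type u} [AddCommGroup K] [AddCommGroup F] [AddCommGroup N] [Module R K] [Module R F]
    [Module R N] [Module.FinitePresentation R K] [Module.FinitePresentation R F] (i : K →ₗ[R] F)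
    (h : ∀ φ : K →ₗ[R] N, ∃ ψ : F →ₗ[R] N, ψ ∘ₗ i = φ) (φ : S ⊗[R] K →ₗ[S] S ⊗[R] N) :
    ∃ ψ : S ⊗[R] F →ₗ[S] S ⊗[R] N, ψ ∘ₗ i.baseChange S = φ := by
  obtain ⟨z, rfl⟩ := (homBaseChangeEquiv R S K N).surjective φ
  induction z with
  | zero => exact ⟨0, by rw [map_zero, LinearMap.zero_comp]⟩
  | add x y hx hy =>
    obtain ⟨a, ha⟩ := hx
    obtain ⟨b, hb⟩ := hy
    exact ⟨a + b, by rw [map_add, LinearMap.add_comp, ha, hb]⟩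
  | tmul s φ =>
    obtain ⟨ψ, rfl⟩ := h φ
    refine ⟨s • ψ.baseChange S, ?_⟩
    have h1 : s ⊗ₜ[R] (ψ ∘ₗ i) = s • (1 : S) ⊗ₜ[R] (ψ ∘ₗ i) := by
      rw [TensorProduct.smul_tmul', smul_eq_mul, mul_one]
    rw [h1, map_smul, homBaseChangeEquiv_one_tmul, LinearMap.baseChange_comp, LinearMap.smul_comp]

/-- Restricting to modules extended from `R` avoids proving that `S ⊗ ω` is canonical. Degree one is
the extension of maps along a free cover, which survives flat base change; higher degrees follow by
shifting. -/
theorem ExtVanishing.tensorProduct (hR : DepthGE R d R) (hE : ExtVanishing R d ω) (S : Type u)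
    [CommRing S] [Algebra R S] [Module.Flat R S] {M : Type u} [AddCommGroup M] [Module R M]
    [Module.Finite R M] (hM : DepthGE R d M) (i : ℕ) :
    Subsingleton (Ext (ModuleCat.of S (S ⊗[R] M)) (ModuleCat.of S (S ⊗[R] ω)) (i + 1)) := by
  induction i generalizing M with
  | zero =>
    obtain ⟨n, p, hp, hK⟩ := exists_free_cover_of_depthGE hR hM
    have hfp : Module.FinitePresentation R (LinearMap.ker p) :=
      Module.finitePresentation_of_finite R _
    have hex := LinearMap.exact_subtype_ker_map p
    exact subsingleton_ext_one_of_exists_extend (f := (LinearMap.ker p).subtype.baseChange S)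
      (g := p.baseChange S)
      (Module.Flat.lTensor_preserves_injective_linearMap _ Subtype.val_injective)
      (lTensor_exact S hex hp) (LinearMap.lTensor_surjective S hp)
      (exists_extend_baseChange S _ (exists_extend_of_subsingleton_ext Subtype.val_injective
        hex hp (hE M hM 0)))
  | succ i ih =>
    obtain ⟨n, p, hp, hK⟩ := exists_free_cover_of_depthGE hR hM
    have hex := LinearMap.exact_subtype_ker_map p
    exact subsingleton_ext_of_contravariant_right (shortExact_of_linearMaps
      (f := (LinearMap.ker p).subtype.baseChange S) (g := p.baseChange S)
      (Module.Flat.lTensor_preserves_injective_linearMap _ Subtype.val_injective)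
      (lTensor_exact S hex hp) (LinearMap.lTensor_surjective S hp)) (ih hK)
      (subsingleton_ext_projective_succ _ _ _)

/-- For `a ∈ 𝔪S` and a map `z` on `S ⊗ M`, the map `a z` has image in `x(S ⊗ ω)` because `a(S ⊗ M) ⊆
x(S ⊗ M)`. The vanishing of `Ext` turns this into membership in `x Hom(S ⊗ M, S ⊗ ω)`. -/
theorem IsUlrich.dual (hd : ringKrullDim R = d) (hR : DepthGE R d R) (hωd : DepthGE R d ω)
    [Module.Finite R ω] (hE : ExtVanishing R d ω) {M : Type u} [AddCommGroup M] [Module R M]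
    (hM : IsUlrich R M) : IsUlrich R (M →ₗ[R] ω) := by
  obtain ⟨S, _, _, _, _, _, _⟩ := exists_flatLocalExtension R
  have hfM := hM.finite
  have hfp : Module.FinitePresentation R M := Module.finitePresentation_of_finite R M
  have hdual := DepthGE.dual hR hωd hE (hM.depthGE hd)
  have hfin : Module.Finite R (M →ₗ[R] ω) := inferInstance
  obtain ⟨rs, hlen, hrs, -, hMs⟩ := exists_computesMultiplicity S hd hR
    [ModuleCat.of R M, ModuleCat.of R ω, ModuleCat.of R (M →ₗ[R] ω)]
    (by simpa using ⟨hfM, ‹Module.Finite R ω›, hfin⟩)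
    (by simpa using ⟨hM.depthGE hd, hωd, hdual⟩)
  have hle := (((hMs (ModuleCat.of R M) (by simp)).isUlrich_iff hd hrs).mp hM).2.2
  have hω := (hMs (ModuleCat.of R ω) (by simp)).isWeaklyRegular
  refine ((hMs (ModuleCat.of R (M →ₗ[R] ω)) (by simp)).isUlrich_iff hd hrs).mpr
    ⟨hfin, hdual, ?_⟩
  rw [Submodule.smul_le]
  intro a ha z _
  let e := homBaseChangeEquiv R S M ω
  have h1 : a • e z ∈ (Ideal.ofList rs • ⊤ : Submodule S (S ⊗[R] M →ₗ[S] S ⊗[R] ω)) := by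
    refine mem_ofList_smul_top_of_range_le hω
      (ExtVanishing.tensorProduct hR hE S (hM.depthGE hd)) _ ?_
    rintro _ ⟨x, rfl⟩
    rw [LinearMap.smul_apply, ← map_smul]
    have h2 := Submodule.mem_map_of_mem (f := e z) (hle (Submodule.smul_mem_smul ha
      (Submodule.mem_top (x := x))))
    rw [Submodule.map_smul''] at h2
    exact Submodule.smul_mono le_rfl le_top h2
  have h3 := Submodule.mem_map_of_mem (f := e.symm.toLinearMap) h1
  rw [Submodule.map_smul'', map_smul] at h3
  have h4 : e.symm (e z) = z := e.symm_apply_apply z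
  rw [LinearEquiv.coe_coe, h4] at h3
  exact Submodule.smul_mono le_rfl le_top h3

end

end Duality

/-! ### Injective objects -/

section Injectives

open Abelian RingTheory.Sequence

section

variable {A : Type u} [CommRing A]

theorem exists_lift_quotSeq (rs : List A) {M N : ModuleCat.{u} A} (hN : IsWeaklyRegular N rs)
    (hE : ∀ i, Subsingleton (Ext M N (i + 1))) (g : M ⟶ quotSeq rs N) :
    ∃ ψ : M ⟶ N, ψ ≫ quotSeqProj rs N = g := by
  induction rs generalizing N with
  | nil => exact ⟨g, Category.comp_id _⟩
  | cons r rs ih =>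
    obtain ⟨hN₁, hN₂⟩ := (isWeaklyRegular_cons_iff N r rs).mp hN
    have hS := quotOneComplex_shortExact hN₁
    obtain ⟨ψ, hψ⟩ := ih (N := quotOne r N) hN₂
      (fun i => subsingleton_ext_of_covariant_right hS (hE (i + 1)) (hE i)) g
    obtain ⟨y, hy⟩ := Ext.covariant_sequence_exact₃ M hS (Ext.mk₀ ψ) (zero_add 1)
      ((hE 0).elim _ _)
    obtain ⟨χ, rfl⟩ := (Ext.mk₀_bijective _ _).2 y
    rw [Ext.mk₀_comp_mk₀] at hy
    obtain ⟨χ, hχ⟩ : ∃ χ : M ⟶ N, χ ≫ quotOneProj r N = ψ := ⟨χ, (Ext.mk₀_bijective _ _).1 hy⟩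
    refine ⟨χ, ?_⟩
    change χ ≫ quotOneProj r N ≫ quotSeqProj rs (quotOne r N) = g
    rw [← hψ, ← hχ, Category.assoc]

variable [IsLocalRing A] [IsNoetherianRing A]

/-- If `φ x = 0` then `x = r y`, and regularity gives `φ y = 0`. So the kernel lies in `𝔪` times
itself and Nakayama applies. -/
theorem injective_of_quotSeqMap_injective {rs : List A} (hrs : ∀ r ∈ rs, r ∈ maximalIdeal A)
    {M N : ModuleCat.{u} A} [Module.Finite A M] (hN : IsWeaklyRegular N rs) (φ : M ⟶ N)
    (h : Function.Injective (quotSeqMap rs φ)) : Function.Injective φ := by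
  induction rs generalizing M N with
  | nil => exact h
  | cons r rs ih =>
    obtain ⟨hN₁, hN₂⟩ := (isWeaklyRegular_cons_iff N r rs).mp hN
    have hfin : Module.Finite A (quotOne r M) :=
      Module.Finite.of_surjective (quotOneProj r M).hom (quotOneProj_surjective r M)
    have h1 := ih (fun a ha => hrs a (List.mem_cons_of_mem _ ha)) hN₂ (quotOneMap r φ) h
    have hr : r ∈ maximalIdeal A := hrs r List.mem_cons_self
    suffices hbot : LinearMap.ker φ.hom = ⊥ from LinearMap.ker_eq_bot.mp hbot
    refine Submodule.eq_bot_of_le_smul_of_le_jacobson_bot (maximalIdeal A) _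
      (IsNoetherian.noetherian _) (fun x hx => ?_) (maximalIdeal_le_jacobson _)
    have hx0 : φ x = 0 := hx
    have h2 : quotOneProj r M x = 0 := by
      refine h1 ?_
      rw [map_zero]
      have h3 : quotOneMap r φ (quotOneProj r M x) = quotOneProj r N (φ x) := rfl
      rw [h3, hx0, map_zero]
    obtain ⟨y, -, hy⟩ := (Submodule.mem_smul_pointwise_iff_exists x r ⊤).mp
      ((Submodule.Quotient.mk_eq_zero _).mp h2)
    rw [← hy]
    refine Submodule.smul_mem_smul hr ?_
    change φ y = 0
    refine hN₁ ?_
    change r • φ y = r • (0 : N)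
    rw [← map_smul, smul_zero, hy]
    exact hx0

theorem eq_zero_of_comp_of_quotSeqMap_injective {rs : List A}
    (hrs : ∀ r ∈ rs, r ∈ maximalIdeal A) {M N : ModuleCat.{u} A} [Module.Finite A N]
    (hM : IsWeaklyRegular M rs) (hN : IsWeaklyRegular N rs) {φ : M ⟶ N}
    (h : Function.Injective (quotSeqMap rs φ)) (u : Ext (resMod A) M rs.length)
    (hu : u.comp (Ext.mk₀ φ) (add_zero _) = 0) : u = 0 := by
  obtain ⟨v, rfl⟩ := exists_comp_koszulClass rs hM (X := resMod A)
    (fun r hr => smul_id_resMod (hrs r hr)) (zero_add _) u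
  obtain ⟨v, rfl⟩ := (Ext.mk₀_bijective _ _).2 v
  have h0 : (Ext.mk₀ (v ≫ quotSeqMap rs φ)).comp (koszulClass rs N hN) (zero_add _) = 0 := by
    rw [← Ext.mk₀_comp_mk₀, Ext.comp_assoc _ _ _ (zero_add 0) (zero_add _) (by omega),
      ← koszulClass_naturality rs φ hM hN,
      ← Ext.comp_assoc _ _ _ (zero_add _) (add_zero _) (by omega), hu]
  have h1 := eq_zero_of_comp_koszulClass rs hN (depthGE_of_isWeaklyRegular hrs hN) _ h0
  have h2 : v ≫ quotSeqMap rs φ = 0 := (Ext.mk₀_bijective _ _).1 (h1.trans (Ext.mk₀_zero _ _).symm)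
  have : Mono (quotSeqMap rs φ) := (ModuleCat.mono_iff_injective _).mpr h
  have h3 : v = 0 := by rw [← cancel_mono (quotSeqMap rs φ), h2, zero_comp]
  rw [h3, Ext.mk₀_zero, Ext.zero_comp]

/-- In the long exact sequence only `Ext^(d-1)(k, N)` is in doubt. It embeds in the kernel of
`Ext^d(k, L) → Ext^d(k, M)`, which is `Hom(k, L/xL) → Hom(k, M/xM)`, an injection. -/
theorem depthGE_of_quotSeqMap_injective {rs : List A} (hrs : ∀ r ∈ rs, r ∈ maximalIdeal A)
    {L M N : Type u} [AddCommGroup L] [AddCommGroup M] [AddCommGroup N] [Module A L] [Module A M]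
    [Module A N] [Module.Finite A L] [Module.Finite A M] {f : L →ₗ[A] M} {g : M →ₗ[A] N}
    (hf : Function.Injective f) (hfg : Function.Exact f g) (hg : Function.Surjective g)
    (hL : IsWeaklyRegular (ModuleCat.of A L) rs) (hM : IsWeaklyRegular (ModuleCat.of A M) rs)
    (h : Function.Injective (quotSeqMap rs (ModuleCat.ofHom f))) : DepthGE A rs.length N := by
  intro i hi
  have hS := shortExact_of_linearMaps hf hfg hg
  have hLd := depthGE_of_isWeaklyRegular hrs hL
  have hMd := depthGE_of_isWeaklyRegular hrs hM
  rcases Nat.lt_or_ge (i + 1) rs.length with hi' | hi'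
  · exact subsingleton_ext_of_covariant_right hS (hLd (i + 1) hi') (hMd i hi)
  · have hi₁ : i + 1 = rs.length := by omega
    refine subsingleton_of_forall_eq 0 fun x => ?_
    have hx : x.comp hS.extClass hi₁ = 0 := by
      refine eq_zero_of_comp_of_quotSeqMap_injective hrs hL hM h _ ?_
      rw [Ext.comp_assoc _ _ _ hi₁ (add_zero 1) (by omega)]
      exact (congrArg (fun z => x.comp z hi₁) hS.extClass_comp).trans (Ext.comp_zero ..)
    obtain ⟨y, rfl⟩ := Ext.covariant_sequence_exact₃ _ hS x hi₁ hx
    rw [(hMd i hi).elim y 0, Ext.zero_comp]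

end

variable {R : Type u} [CommRing R] [IsLocalRing R] [IsNoetherianRing R] {d : ℕ}
  {ω : Type u} [AddCommGroup ω] [Module R ω]

/-- The canonical module detects elements of a maximal Cohen--Macaulay module modulo a system of
parameters. -/
theorem exists_dual_notMem {rs : List R} {k : ℕ} (hk : maximalIdeal R ^ k ≤ Ideal.ofList rs)
    (hω : IsWeaklyRegular (ModuleCat.of R ω) rs)
    (htop : Subsingleton (Ext (resMod R) (ModuleCat.of R ω) (rs.length + 1)))
    (htype : ¬ Subsingleton (Ext (resMod R) (ModuleCat.of R ω) rs.length))
    {M : Type u} [AddCommGroup M] [Module R M] [Module.Finite R M]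
    (hE : ∀ i, Subsingleton (Ext (ModuleCat.of R M) (ModuleCat.of R ω) (i + 1))) {x : M}
    (hx : x ∉ (Ideal.ofList rs • ⊤ : Submodule R M)) :
    ∃ ψ : M →ₗ[R] ω, ψ x ∉ (Ideal.ofList rs • ⊤ : Submodule R ω) := by
  let X := quotSeq rs (ModuleCat.of R M)
  have hXsupp : Module.support R X ⊆ PrimeSpectrum.zeroLocus (maximalIdeal R) :=
    support_quotSeq_subset hk _
  have hXfin : Module.Finite R X :=
    Module.Finite.of_surjective (quotSeqProj rs (ModuleCat.of R M)).hom
      (quotSeqProj_surjective rs _)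
  have hx' : quotSeqProj rs (ModuleCat.of R M) x ≠ 0 := by
    rwa [Ne, quotSeqProj_eq_zero_iff]
  obtain ⟨r, f, hf, hr⟩ := exists_resMod_hom_of_ne_zero (k := k)
    (smul_eq_zero_of_pow_le_ofList hk _ · · _) hx'
  have hinj : Function.Injective f := resMod_hom_injective (by rwa [hf])
  have hS := shortExact_of_linearMaps hinj
    (LinearMap.exact_map_mkQ_range f.hom) (Submodule.mkQ_surjective _)
  have hC : Subsingleton (Ext (ModuleCat.of R (X ⧸ LinearMap.range f.hom)) (ModuleCat.of R ω)
      (rs.length + 1)) :=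
    subsingleton_ext_of_support htop _ ((Module.support_subset_of_surjective _
      (Submodule.mkQ_surjective _)).trans hXsupp)
  obtain ⟨u, hu⟩ : ∃ u : Ext (resMod R) (ModuleCat.of R ω) rs.length, u ≠ 0 := by
    by_contra! h
    exact htype (subsingleton_of_forall_eq 0 h)
  -- A nonzero class on a copy of `k` generated by a multiple of `x` extends to `X = M/(rs)M`. There
  -- it corresponds to a map `X → ω/(rs)ω`, which cannot kill `x`.
  obtain ⟨v, hv⟩ := Ext.contravariant_sequence_exact₁ hS _ u (add_comm 1 _) (hC.elim _ _)
  obtain ⟨g, rfl⟩ := exists_comp_koszulClass rs hω (X := X)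
    (fun r hr => smul_id_quotSeq (Ideal.subset_span hr) _) (zero_add _) v
  obtain ⟨g, rfl⟩ := (Ext.mk₀_bijective _ _).2 g
  have hgx : g (quotSeqProj rs (ModuleCat.of R M) x) ≠ 0 := by
    intro h0
    refine hu ?_
    have hfg : f ≫ g = 0 := by
      refine resMod_hom_ext ?_
      change g (f (1 : ResidueField R)) = 0
      rw [hf, map_smul, h0, smul_zero]
    have h1 : (Ext.mk₀ f).comp (Ext.mk₀ g) (zero_add 0) = 0 := by
      rw [Ext.mk₀_comp_mk₀, hfg, Ext.mk₀_zero]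
    rw [← hv, ← Ext.comp_assoc _ _ _ (zero_add 0) (zero_add _) (by omega)]
    change ((Ext.mk₀ f).comp (Ext.mk₀ g) (zero_add 0)).comp _ _ = 0
    rw [h1, Ext.zero_comp]
  obtain ⟨ψ, hψ⟩ := exists_lift_quotSeq rs hω hE (quotSeqProj rs (ModuleCat.of R M) ≫ g)
  refine ⟨ψ.hom, fun hmem => hgx ?_⟩
  rw [← quotSeqProj_eq_zero_iff rs (M := ModuleCat.of R ω)] at hmem
  rw [← hmem]
  exact congr($hψ x).symm

/-- The embedding of a maximal Cohen--Macaulay module into the dual of a module covering its dual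
has a maximal Cohen--Macaulay cokernel. -/
theorem flip_injective_and_depthGE (hd : ringKrullDim R = d) (hR : DepthGE R d R)
    [Module.Finite R ω] (hω : DepthGE R d ω) (hE : ExtVanishing R d ω)
    (htop : Subsingleton (Ext (resMod R) (ModuleCat.of R ω) (d + 1)))
    (htype : ¬ Subsingleton (Ext (resMod R) (ModuleCat.of R ω) d))
    {M F : Type u} [AddCommGroup M] [Module R M] [Module.Finite R M] [AddCommGroup F] [Module R F]
    [Module.Finite R F] (hM : DepthGE R d M) (hF : DepthGE R d F)
    {g : F →ₗ[R] M →ₗ[R] ω} (hg : Function.Surjective g) :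
    Function.Injective g.flip ∧ DepthGE R d ((F →ₗ[R] ω) ⧸ LinearMap.range g.flip) := by
  have hW : DepthGE R d (F →ₗ[R] ω) := DepthGE.dual hR hω hE hF
  have hWfin : Module.Finite R (F →ₗ[R] ω) := inferInstance
  obtain ⟨rs, k, rfl, hrs, -, hreg, hk⟩ := exists_isWeaklyRegular_of_depthGE hd hR
    ((hM.prod hω).prod hW)
  have hMω := isWeaklyRegular_of_retract (LinearMap.inl R (M × ω) (F →ₗ[R] ω))
    (LinearMap.fst R _ _) (by ext <;> simp) hreg
  have hWreg : IsWeaklyRegular (ModuleCat.of R (F →ₗ[R] ω)) rs :=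
    isWeaklyRegular_of_retract (LinearMap.inr R (M × ω) (F →ₗ[R] ω))
      (LinearMap.snd R _ _) (LinearMap.snd_comp_inr ..) hreg
  have hMreg : IsWeaklyRegular (ModuleCat.of R M) rs :=
    isWeaklyRegular_of_retract (LinearMap.inl R M ω) (LinearMap.fst R _ _)
      (LinearMap.fst_comp_inl ..) hMω
  have hωreg : IsWeaklyRegular (ModuleCat.of R ω) rs :=
    isWeaklyRegular_of_retract (LinearMap.inr R M ω) (LinearMap.snd R _ _)
      (LinearMap.snd_comp_inr ..) hMω
  have hmod : Function.Injective (quotSeqMap rs (ModuleCat.ofHom g.flip)) := by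
    refine (injective_iff_map_eq_zero (quotSeqMap rs (ModuleCat.ofHom g.flip)).hom).mpr
      fun y hy => ?_
    obtain ⟨x, rfl⟩ := quotSeqProj_surjective rs (ModuleCat.of R M) y
    have h1 : quotSeqProj rs (ModuleCat.of R (F →ₗ[R] ω)) (g.flip x) = 0 :=
      congr($(quotSeqProj_naturality rs (ModuleCat.ofHom g.flip)) x).trans hy
    rw [quotSeqProj_eq_zero_iff] at h1 ⊢
    by_contra hx
    obtain ⟨ψ, hψ⟩ := exists_dual_notMem hk hωreg htop htype (hE M hM) hx
    -- Evaluation at `p` carries `(rs) Hom(F, ω)` into `(rs)ω`, so a transpose that vanishes modulo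
    -- `rs` contradicts detection by `ψ`.
    obtain ⟨p, rfl⟩ := hg ψ
    refine hψ ?_
    have h2 := Submodule.mem_map_of_mem (f := LinearMap.applyₗ (R := R) (M₂ := ω) p) h1
    rw [Submodule.map_smul''] at h2
    exact Submodule.smul_mono le_rfl le_top h2
  have hinj : Function.Injective g.flip :=
    injective_of_quotSeqMap_injective hrs hWreg (ModuleCat.ofHom g.flip) hmod
  exact ⟨hinj, depthGE_of_quotSeqMap_injective hrs hinj (LinearMap.exact_map_mkQ_range _)
    (Submodule.mkQ_surjective _) hMreg hWreg hmod⟩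

end Injectives

/-! ### The main theorem -/

section Main

open Abelian RingTheory.Sequence

variable {R : Type u} [CommRing R] [IsLocalRing R] [IsNoetherianRing R] {d : ℕ}
  {ω : Type u} [AddCommGroup ω] [Module R ω]

/-- By adjunction, extending `L → P†` along `f` is lifting `P → L†` along `M† → L†`, a surjection of
Ulrich modules since `Ext¹(N, ω) = 0`. -/
theorem IsMinSyzygy.exists_extend_dual (hd : ringKrullDim R = d) (hR : DepthGE R d R)
    [Module.Finite R ω] (hω : DepthGE R d ω) (hE : ExtVanishing R d ω)
    {P : ModuleCat.{u} R} (hP : IsMinSyzygy R d P) {L M N : Type u} [AddCommGroup L]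
    [AddCommGroup M] [AddCommGroup N] [Module R L] [Module R M] [Module R N] (hL : IsUlrich R L)
    (hM : IsUlrich R M) (hN : IsUlrich R N) {f : L →ₗ[R] M} {g : M →ₗ[R] N}
    (hf : Function.Injective f) (hfg : Function.Exact f g) (hg : Function.Surjective g)
    (φ : L →ₗ[R] P →ₗ[R] ω) : ∃ ψ : M →ₗ[R] P →ₗ[R] ω, ψ ∘ₗ f = φ := by
  have := hN.finite
  have hsurj : Function.Surjective (f.lcomp R ω) :=
    exists_extend_of_subsingleton_ext hf hfg hg (hE N (hN.depthGE hd) 0)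
  obtain ⟨χ, hχ⟩ := hP.exists_lift hd hR (IsUlrich.dual hd hR hω hE hM)
    (IsUlrich.dual hd hR hω hE hL) hsurj φ.flip
  refine ⟨χ.flip, LinearMap.ext₂ fun x p => ?_⟩
  exact congr($hχ p x)

theorem isExactInjective_of_inAdd (hd : ringKrullDim R = d) (hR : DepthGE R d R)
    [Module.Finite R ω] (hω : DepthGE R d ω) (hE : ExtVanishing R d ω)
    {P : ModuleCat.{u} R} (hP : IsMinSyzygy R d P) (Q : Ul R) (hQ : InAdd R (P →ₗ[R] ω) Q.obj) :
    IsExactInjective (ulrichSequences R) Q := by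
  obtain ⟨n, s, r, hrs⟩ := hQ
  rintro X Y i ⟨Z, q, h, hS⟩ φ
  obtain ⟨h₁, h₂, h₃⟩ := (ulrichSequences_mk_iff i q h).mp hS
  choose ψ hψ using fun j : Fin n => hP.exists_extend_dual hd hR hω hE X.property Y.property
    Z.property h₁ h₂ h₃ (LinearMap.proj j ∘ₗ s ∘ₗ Ul.toLin φ)
  refine ⟨Ul.ofLin (r ∘ₗ LinearMap.pi ψ), Ul.hom_ext fun x => ?_⟩
  have h4 : LinearMap.pi ψ (Ul.toLin i x) = s (Ul.toLin φ x) := by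
    ext1 j
    exact congr($(hψ j) x)
  change r (LinearMap.pi ψ (Ul.toLin i x)) = _
  rw [h4]
  exact congr($hrs (Ul.toLin φ x))

/-- The inflation is the transpose of a surjection from a power of `P` onto the dual of `X`. -/
theorem exists_inflation_to_pi (hd : ringKrullDim R = d) (hR : DepthGE R d R)
    (hmin : HasMinimalMultiplicity R) [Module.Finite R ω] (hω : DepthGE R d ω)
    (hE : ExtVanishing R d ω)
    (htop : Subsingleton (Ext (resMod R) (ModuleCat.of R ω) (d + 1)))
    (htype : ¬ Subsingleton (Ext (resMod R) (ModuleCat.of R ω) d))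
    {P : ModuleCat.{u} R} (hP : IsMinSyzygy R d P) (X : Ul R) :
    ∃ (Q : Ul R) (n : ℕ) (_ : Q.obj ≃ₗ[R] (Fin n → P →ₗ[R] ω)) (i : X ⟶ Q),
      IsExactInjective (ulrichSequences R) Q ∧ IsInflation (ulrichSequences R) i := by
  have hXfin := X.property.finite
  have hPU := hP.isUlrich hd hR hmin
  obtain ⟨n, g, hg⟩ := hP.exists_surjective hd hR (IsUlrich.dual hd hR hω hE X.property)
  have hF : IsUlrich R (Fin n → P) := hPU.pi hd hR n
  have hFfin := hF.finite
  obtain ⟨h₁, h₂⟩ := flip_injective_and_depthGE hd hR hω hE htop htype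
    (X.property.depthGE hd) (hF.depthGE hd) hg
  let Q : Ul R := Ul.of _ (IsUlrich.dual hd hR hω hE hF)
  let e : Q.obj ≃ₗ[R] (Fin n → P →ₗ[R] ω) :=
    (LinearMap.lsum R (fun _ : Fin n => (P : Type u)) R).symm
  exact ⟨Q, n, e, Ul.ofLin g.flip,
    isExactInjective_of_inAdd hd hR hω hE hP Q ⟨n, e.toLinearMap, e.symm.toLinearMap,
      LinearMap.ext fun x => e.symm_apply_apply x⟩,
    (isInflation_iff hd hR _).mpr ⟨h₁, h₂⟩⟩

theorem isExactInjective_iff (hd : ringKrullDim R = d) (hR : DepthGE R d R)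
    (hmin : HasMinimalMultiplicity R) [Module.Finite R ω] (hω : DepthGE R d ω)
    (hE : ExtVanishing R d ω)
    (htop : Subsingleton (Ext (resMod R) (ModuleCat.of R ω) (d + 1)))
    (htype : ¬ Subsingleton (Ext (resMod R) (ModuleCat.of R ω) d))
    {P : ModuleCat.{u} R} (hP : IsMinSyzygy R d P) (M : ModuleCat.{u} R) :
    (∃ hM : ulrichProperty R M, IsExactInjective (ulrichSequences R) ⟨M, hM⟩) ↔
      InAdd R (P →ₗ[R] ω) M := by
  constructor
  · rintro ⟨hM, hinj⟩
    obtain ⟨Q, n, e, i, -, hi⟩ := exists_inflation_to_pi hd hR hmin hω hE htop htype hP ⟨M, hM⟩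
    obtain ⟨r, hr⟩ := hinj i hi (𝟙 _)
    refine ⟨n, e.toLinearMap ∘ₗ Ul.toLin i, Ul.toLin r ∘ₗ e.symm.toLinearMap, ?_⟩
    ext x
    change Ul.toLin r (e.symm (e (Ul.toLin i x))) = x
    rw [LinearEquiv.symm_apply_apply]
    exact Ul.congr_toLin hr x
  · intro h
    exact ⟨IsUlrich.of_inAdd hd hR (IsUlrich.dual hd hR hω hE (hP.isUlrich hd hR hmin)) h,
      isExactInjective_of_inAdd hd hR hω hE hP ⟨M, _⟩ h⟩

theorem IsCMLocalRing.depthGE (hCM : IsCMLocalRing R) (hd : ringKrullDim R = d) : DepthGE R d R :=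
  (moduleDepth_eq_iff hd).mp hCM

theorem IsCanonicalModule.extVanishing (hω : IsCanonicalModule R ω) (hd : ringKrullDim R = d)
    (hR : DepthGE R d R) : ExtVanishing R d ω := by
  obtain ⟨n, hn⟩ := hω.2.1
  have : Module.Finite R (ModuleCat.of R ω) := hω.1.1
  intro M _ _ _ hM i
  exact subsingleton_ext_of_depthGE hd hR hn hM i.succ_pos

theorem IsCanonicalModule.not_subsingleton_ext (hω : IsCanonicalModule R ω)
    (hd : ringKrullDim R = d) : ¬ Subsingleton (Ext (resMod R) (ModuleCat.of R ω) d) := by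
  intro h
  have h1 := hω.2.2
  rw [krullDimNat_eq hd, Module.length_eq_zero_iff.mpr h] at h1
  exact zero_ne_one h1

end Main

theorem theorem4p7 (R : Type u) [CommRing R] [IsLocalRing R] [IsNoetherianRing R]
    (hCM : IsCMLocalRing R) (hmin : HasMinimalMultiplicity R)
    (d : ℕ) (hd : ringKrullDim R = d)
    (ω : Type u) [AddCommGroup ω] [Module R ω] (hω : IsCanonicalModule R ω) :
    IsExactCategory (ulrichSequences R) ∧
    HasEnoughExactProjectives (ulrichSequences R) ∧
    HasEnoughExactInjectives (ulrichSequences R) ∧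
    (∀ M : ModuleCat.{u} R,
      (∃ hM : ulrichProperty R M, IsExactProjective (ulrichSequences R) ⟨M, hM⟩) ↔
        InAdd R (syzygy R d (FGModuleCat.of R (ResidueField R))) M) ∧
    (∀ M : ModuleCat.{u} R,
      (∃ hM : ulrichProperty R M, IsExactInjective (ulrichSequences R) ⟨M, hM⟩) ↔
        InAdd R (syzygy R d (FGModuleCat.of R (ResidueField R)) →ₗ[R] ω) M) := by
  have hR := hCM.depthGE hd
  have hP : IsMinSyzygy R d
      (ModuleCat.of R (syzygy R d (FGModuleCat.of R (ResidueField R)))) := isMinSyzygy_syzygy d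
  obtain ⟨hfin, hdepth⟩ := (isMaximalCM_iff hd).mp hω.1
  have hE := hω.extVanishing hd hR
  obtain ⟨n, hn⟩ := hω.2.1
  have htop := subsingleton_ext_resMod hd hR hn d.lt_succ_self
  have htype := hω.not_subsingleton_ext hd
  refine ⟨isExactCategory_ulrichSequences hd hR, fun X => ?_, fun X => ?_, fun M => ?_,
    fun M => ?_⟩
  · obtain ⟨Q, -, -, g, hQ, hg⟩ := exists_deflation_from_pi hd hR hmin hP X
    exact ⟨Q, g, hQ, hg⟩
  · obtain ⟨Q, -, -, i, hQ, hi⟩ :=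
      exists_inflation_to_pi hd hR hmin hdepth hE htop htype hP X
    exact ⟨Q, i, hQ, hi⟩
  · exact isExactProjective_iff hd hR hmin hP M
  · exact isExactInjective_iff hd hR hmin hdepth hE htop htype hP M
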